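/- Let $q$ be a prime power, let $\alpha$ be a primitive element of $\mathbb F_q$, and fix a linear order on $\mathbb F_q$; order vectors lexicographically. Call a nonzero vector normalized if its first nonzero entry is $1$. For sets of subspaces of $\mathbb F_q^6$, a *derived $q$-Fano plane* is a $q$-Steiner system $\mathbb S_q(1,2,6)$, that is, a set of $2$-subspaces such that each $1$-subspace lies in exactly one of them (equivalently a $1$-spread). A *residual $q$-Fano plane* relative to a derived $q$-Fano plane $\mathcal S$ is a set of $3$-subspaces of $\mathbb F_q^6$ such that each $2$-subspace not in $\mathcal S$ is contained in exactly $q^2$ of them, and no $2$-subspace in $\mathcal S$ is contained in any of them. *Representations.* The *extension space* is the $4$-dimensional space of all $2\times(q+1)$ matrices over $\mathbb F_q$ whose columns satisfy $v_i=\alpha^{i-3}v_1+v_2$ for $3\le i\le q+1$. An *extension code* $C$ is a $2$-dimensional subspace of it such that, for each $i$, the $i$-th columns of the $q^2$ matrices of $C$ are all the vectors of $\mathbb F_q^2$. A $2$-subspace $X$ of $\mathbb F_q^4$ is represented by the $4\times(q+1)$ matrix $M_X$ whose first two columns are the two smallest normalized vectors $v_1<v_2$ of $X$ and whose other columns are $v_i=\alpha^{i-3}v_1+v_2$.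 For a matrix $M$ with $q+1$ columns, $E(M,u)$ denotes the matrix with $q^2+q+1$ columns consisting of $M$, the column $u$, and the matrices $\alpha^iu+M$ for $0\le i\le q-2$ (the column $\alpha^i u$ added to each column of $M$). A matrix stands for its column span, and $\binom{M}{Z}$ is $M$ on top of $Z$. *Choices.* A parallelism of $\mathbb F_q^4$ (a partition of its $2$-subspaces into $q^2+q+1$ spreads), with its spreads partitioned into a single spread $\mathcal A$, a class $\mathcal B$ of $q$ spreads, and classes $\mathcal C_\xi$, $\xi\in\mathbb F_q$, of $q$ spreads each; an extension code $C$; a partition of the extension space minus $C$ into $q+1$ parts $C_1,\dots,C_{q+1}$, each a union of $q-1$ cosets of $C$; and, for each $X\in\mathcal A$, a bijection $Y\mapsto j(Y)$ from the $q+1$ $3$-subspaces $Y\supset X$ of $\mathbb F_q^4$ to $\{1,\dots,q+1\}$ (each $3$-subspace of $\mathbb F_q^4$ contains exactly one member of $\mathcal A$). *Construction.* - $\mathbb S_0$ consists of the single $2$-subspace of $\mathbb F_q^6$ of vectors starting with four zeroes. - $\mathbb S_{\mathcal A}$ consists of the $2$-subspaces $\binom{M_X}{Z}$ with $X\in\mathcal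 A$, $Z\in C$. - $\mathbb S_{\mathcal B}$ consists of the $3$-subspaces $E\left(\binom{M_X}{Z},e_6\right)$ with $X$ in a spread of $\mathcal B$ and $Z$ in the extension space with zero second row. - $\mathbb S_{\mathcal C}$ consists of the $3$-subspaces $E\left(\binom{M_X}{Z},e_5+\xi e_6\right)$ with $\xi\in\mathbb F_q$, $X$ in a spread of $\mathcal C_\xi$ and $Z$ in the extension space with zero first row. - $\mathbb S_{\mathcal D}$ consists of the $3$-subspaces $\binom{E(M_X,u)}{E(Z,v)}$, where $Y$ is a $3$-subspace of $\mathbb F_q^4$, $X\in\mathcal A$ is contained in $Y$, $u$ is the smallest normalized vector of $Y\setminus X$, $Z\in C_{j(Y)}$ and $v\in\mathbb F_q^2$. **Theorem.** For every prime power $q$ such choices exist, and for all such choices $\mathbb S_0\cup\mathbb S_{\mathcal A}$ is a $1$-spread of $\mathbb F_q^6$, i.e. a derived $q$-Fano plane, and $\mathbb S_{\mathcal B}\cup\mathbb S_{\mathcal C}\cup\mathbb S_{\mathcal D}$ is a residual $q$-Fano plane relative to it. Moreover $$|\mathbb S_0\cup\mathbb S_{\mathcal A}\cup\mathbb S_{\mathcal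 B}\cup\mathbb S_{\mathcal C}\cup\mathbb S_{\mathcal D}|=\frac{\genfrac{[}{]}{0pt}{}{7}{2}_q}{\genfrac{[}{]}{0pt}{}{3}{2}_q},$$ the number of blocks of a $q$-Fano plane $\mathbb S_q(2,3,7)$. -/

import Mathlib

namespace QFano

/-! ### Designs over a finite field -/

/-- The `q`-binomial coefficient `[n choose k]_q`, for `k ≤ n`, as a rational number. -/
def qBinom (q n k : ℕ) : ℚ :=
  ∏ i ∈ Finset.range k, ((q : ℚ) ^ (n - i) - 1) / ((q : ℚ) ^ (k - i) - 1)

/-- A `t`-`(n,k,lam)` design over `F`: a set of `k`-subspaces (blocks) of `F^n` such that each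
`t`-subspace is contained in exactly `lam` blocks. -/
def IsDesign (F : Type*) [Field F] (t k n lam : ℕ) (S : Set (Submodule F (Fin n → F))) : Prop :=
  (∀ B ∈ S, Module.finrank F B = k) ∧
    ∀ T : Submodule F (Fin n → F), Module.finrank F T = t → {B ∈ S | T ≤ B}.ncard = lam

/-- A `q`-Steiner system `S_q(t,k,n)`: a `t`-`(n,k,1)` design over the field with `q` elements. -/
def IsQSteiner (F : Type*) [Field F] (t k n : ℕ) (S : Set (Submodule F (Fin n → F))) : Prop :=
  IsDesign F t k n 1 S

/-- A derived `q`-Steiner system for the parameters `S_q(t+1,k+1,n+1)`: an `S_q(t,k,n)`. -/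
def IsDerivedQSteiner (F : Type*) [Field F] (t k n : ℕ)
    (der : Set (Submodule F (Fin n → F))) : Prop :=
  IsQSteiner F t k n der

/-- A residual `q`-Steiner system for the parameters `S_q(t+1,k+1,n+1)`, relative to the derived
system `der`: a set of `(k+1)`-subspaces of `F^n` such that each `(t+1)`-subspace not contained
in a member of `der` is contained in exactly `q^(t+1)` of them, and each `(t+1)`-subspace
contained in a member of `der` is contained in none of them. -/
def IsResidualQSteiner (F : Type*) [Field F] [Fintype F] (t k n : ℕ)
    (der res : Set (Submodule F (Fin n → F))) : Prop :=
  IsDerivedQSteiner F t k n der ∧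
  (∀ B ∈ res, Module.finrank F B = k + 1) ∧
  (∀ T : Submodule F (Fin n → F), Module.finrank F T = t + 1 →
    (¬ ∃ D ∈ der, T ≤ D) → {B ∈ res | T ≤ B}.ncard = Fintype.card F ^ (t + 1)) ∧
  (∀ T : Submodule F (Fin n → F), Module.finrank F T = t + 1 →
    (∃ D ∈ der, T ≤ D) → ∀ B ∈ res, ¬ T ≤ B)

/-- A derived `q`-Fano plane; the `q`-Fano plane is an `S_q(2,3,7)`. -/
def IsDerivedQFano (F : Type*) [Field F] (der : Set (Submodule F (Fin 6 → F))) : Prop :=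
  IsDerivedQSteiner F 1 2 6 der

/-- A residual `q`-Fano plane, relative to the derived `q`-Fano plane `der`. -/
def IsResidualQFano (F : Type*) [Field F] [Fintype F]
    (der res : Set (Submodule F (Fin 6 → F))) : Prop :=
  IsResidualQSteiner F 1 2 6 der res

/-- A `1`-spread of `F^n`: a set of `2`-subspaces such that each nonzero vector lies in exactly
one of them. -/
def IsSpread {F : Type*} [Field F] {n : ℕ} (S : Set (Submodule F (Fin n → F))) : Prop :=
  (∀ W ∈ S, Module.finrank F W = 2) ∧ ∀ x : Fin n → F, x ≠ 0 → ∃! W, W ∈ S ∧ x ∈ W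

/-- A `1`-parallelism of `F^n`: a partition of the `2`-subspaces into spreads. -/
def IsParallelism {F : Type*} [Field F] {n : ℕ}
    (P : Set (Set (Submodule F (Fin n → F)))) : Prop :=
  (∀ S ∈ P, IsSpread S) ∧
    ∀ W : Submodule F (Fin n → F), Module.finrank F W = 2 → ∃! S, S ∈ P ∧ W ∈ S

/-! ### Matrices representing subspaces

Throughout, `q` is `Fintype.card F`, and columns are numbered from `0`. -/

/-- The columns `v₀, v₁, …, v_q` of `M` satisfy `v_i = α^(i-2) v₀ + v₁` for `2 ≤ i ≤ q`. -/
def HasLineColumns {F : Type*} [Field F] [Fintype F] (α : Fˣ) {r : ℕ}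
    (M : Matrix (Fin r) (Fin (Fintype.card F + 1)) F) : Prop :=
  ∀ i : Fin (Fintype.card F + 1), 2 ≤ (i : ℕ) →
    M.col i = (α : F) ^ ((i : ℕ) - 2) • M.col 0 + M.col 1

/-- The subspace spanned by the columns of a matrix. -/
def colSpan {F : Type*} [Field F] {r : ℕ} {ι : Type*} (M : Matrix (Fin r) ι F) :
    Submodule F (Fin r → F) :=
  Submodule.span F (Set.range M.col)

/-- The first nonzero entry of `x` exists and is equal to one. -/
def IsNormalized {F : Type*} [Field F] {n : ℕ} (x : Fin n → F) : Prop :=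
  ∃ i, x i = 1 ∧ ∀ j < i, x j = 0

/-- `v` is the lexicographically smallest vector of the set `s`. -/
def IsLexLeast {F : Type*} [LinearOrder F] {n : ℕ} (s : Set (Fin n → F)) (v : Fin n → F) : Prop :=
  v ∈ s ∧ ∀ w ∈ s, toLex v ≤ toLex w

/-- `M` is the matrix representing the `2`-subspace `X` of `F^4`: its first two columns are the two
lexicographically smallest normalized vectors of `X`, in increasing order, and the others are
`v_i = α^(i-2) v₀ + v₁`. (If `0` is the smallest element of `F`, the columns are exactly the
normalized vectors of `X`.) -/
def Represents {F : Type*} [Field F] [Fintype F] [LinearOrder F] (α : Fˣ)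
    (X : Submodule F (Fin 4 → F)) (M : Matrix (Fin 4) (Fin (Fintype.card F + 1)) F) : Prop :=
  IsLexLeast {x | x ∈ X ∧ IsNormalized x} (M.col 0) ∧
  IsLexLeast {x | x ∈ X ∧ IsNormalized x ∧ x ≠ M.col 0} (M.col 1) ∧
  HasLineColumns α M

/-- The expansion `E(M,u)`: the `q+1` columns of `M`, then the column `u`, then the `q-1` matrices
`α^i u + M`, `0 ≤ i ≤ q-2`; in total `q^2+q+1` columns. -/
def expand {F : Type*} [Field F] [Fintype F] (α : Fˣ) {r : ℕ}
    (M : Matrix (Fin r) (Fin (Fintype.card F + 1)) F) (u : Fin r → F) :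
    Matrix (Fin r) (Fin (Fintype.card F + 1) ⊕ Unit ⊕
      (Fin (Fintype.card F - 1) × Fin (Fintype.card F + 1))) F :=
  fun a c => match c with
    | .inl j => M a j
    | .inr (.inl _) => u a
    | .inr (.inr (i, j)) => (α : F) ^ (i : ℕ) * u a + M a j

/-- The matrix with six rows whose first four rows are `M` and whose last two rows are `Z`. -/
def stack {F : Type*} {ι : Type*} (M : Matrix (Fin 4) ι F) (Z : Matrix (Fin 2) ι F) :
    Matrix (Fin 6) ι F :=
  fun a c => (Fin.append (M.col c) (Z.col c) : Fin (4 + 2) → F) a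

/-- The extension space: all `2 × (q+1)` matrices whose columns satisfy
`v_i = α^(i-2) v₀ + v₁` for `2 ≤ i`. -/
def extensionSpace (F : Type*) [Field F] [Fintype F] (α : Fˣ) :
    Submodule F (Matrix (Fin 2) (Fin (Fintype.card F + 1)) F) where
  carrier := {Z | HasLineColumns α Z}
  zero_mem' := by
    intro i _
    ext a
    simp [Matrix.col]
  add_mem' := by
    intro Y Z hY hZ i hi
    ext a
    have h1 := congrFun (hY i hi) a
    have h2 := congrFun (hZ i hi) a
    simp only [Matrix.col_apply, Pi.add_apply, Pi.smul_apply, smul_eq_mul, Matrix.add_apply]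
      at h1 h2 ⊢
    rw [h1, h2]
    ring
  smul_mem' := by
    intro c Z hZ i hi
    ext a
    have h1 := congrFun (hZ i hi) a
    simp only [Matrix.col_apply, Pi.add_apply, Pi.smul_apply, smul_eq_mul, Matrix.smul_apply]
      at h1 ⊢
    rw [h1]
    ring

/-- An extension code: a two-dimensional subspace of the extension space such that, for each `i`,
the `i`-th columns of its matrices are distinct and run through all vectors of length `2`. -/
def IsExtensionCode {F : Type*} [Field F] [Fintype F] (α : Fˣ)
    (C : Submodule F (Matrix (Fin 2) (Fin (Fintype.card F + 1)) F)) : Prop :=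
  C ≤ extensionSpace F α ∧ Module.finrank F C = 2 ∧
    ∀ i, Set.BijOn (fun Z : Matrix (Fin 2) (Fin (Fintype.card F + 1)) F => Z.col i) C Set.univ

/-! ### The construction -/

/-- The choices on which the construction depends. -/
structure Choices (F : Type*) [Field F] [Fintype F] (α : Fˣ) where
  /-- the single spread of the class `𝒜` -/
  spreadA : Set (Submodule F (Fin 4 → F))
  /-- the spreads of the class `ℬ` -/
  spreadsB : Set (Set (Submodule F (Fin 4 → F)))
  /-- the spreads of the subclasses `𝒞_ξ`, `ξ ∈ F`, of the class `𝒞` -/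
  spreadsC : F → Set (Set (Submodule F (Fin 4 → F)))
  /-- all these spreads together form a parallelism of `F^4` -/
  parallelism : IsParallelism ({spreadA} ∪ spreadsB ∪ ⋃ ξ, spreadsC ξ)
  spreadA_notMem_B : spreadA ∉ spreadsB
  spreadA_notMem_C : ∀ ξ, spreadA ∉ spreadsC ξ
  disjoint_B_C : ∀ ξ, Disjoint spreadsB (spreadsC ξ)
  disjoint_C : ∀ ξ η, ξ ≠ η → Disjoint (spreadsC ξ) (spreadsC η)
  ncard_B : spreadsB.ncard = Fintype.card F
  ncard_C : ∀ ξ, (spreadsC ξ).ncard = Fintype.card F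
  /-- the extension code -/
  code : Submodule F (Matrix (Fin 2) (Fin (Fintype.card F + 1)) F)
  isExtensionCode : IsExtensionCode α code
  /-- the parts `C_1, …, C_{q+1}` -/
  part : Fin (Fintype.card F + 1) → Set (Matrix (Fin 2) (Fin (Fintype.card F + 1)) F)
  /-- the parts partition the matrices of the extension space outside the extension code -/
  iUnion_part : ⋃ j, part j = (extensionSpace F α : Set _) \ (code : Set _)
  disjoint_part : ∀ i j, i ≠ j → Disjoint (part i) (part j)
  /-- each part is a union of cosets of the extension code -/
  part_add : ∀ j, ∀ Z ∈ part j, ∀ c ∈ code, Z + c ∈ part j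
  /-- each part consists of `q - 1` cosets, that is, of `q^2 (q-1)` matrices -/
  ncard_part : ∀ j, (part j).ncard = Fintype.card F ^ 2 * (Fintype.card F - 1)
  /-- the number `j` of the part `C_j` that is matched with a given `3`-subspace of `F^4`
  (only the values at `3`-subspaces matter) -/
  index : Submodule F (Fin 4 → F) → Fin (Fintype.card F + 1)
  /-- the `3`-subspaces containing a given member of `𝒜` are matched with the parts one-to-one -/
  bijOn_index : ∀ X ∈ spreadA,
    Set.BijOn index {Y | Module.finrank F Y = 3 ∧ X ≤ Y} Set.univ

variable {F : Type*} [Field F] [Fintype F]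

/-- `𝕊₀`: the set whose only member is the `2`-subspace of `F^6` of all vectors starting with four
zeroes. -/
def setS0 (F : Type*) [Field F] : Set (Submodule F (Fin 6 → F)) :=
  {W | ∀ x : Fin 6 → F, x ∈ W ↔ ∀ i : Fin 6, (i : ℕ) < 4 → x i = 0}

/-- `𝕊_𝒜`: the `2`-subspaces obtained by extending the members of `𝒜` with the extension code. -/
def setSA [LinearOrder F] {α : Fˣ} (d : Choices F α) : Set (Submodule F (Fin 6 → F)) :=
  {W | ∃ X ∈ d.spreadA, ∃ M, Represents α X M ∧ ∃ Z ∈ d.code, W = colSpan (stack M Z)}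

/-- `𝕊_ℬ`: the `3`-subspaces obtained by extending the members of `ℬ` in all ways to `2`-subspaces
of `F^5`, and then to `3`-subspaces of `F^6` by expanding with the unit vector `e₆`. -/
def setSB [LinearOrder F] {α : Fˣ} (d : Choices F α) : Set (Submodule F (Fin 6 → F)) :=
  {W | ∃ S ∈ d.spreadsB, ∃ X ∈ S, ∃ M, Represents α X M ∧
    ∃ Z ∈ extensionSpace F α, (∀ j, Z 1 j = 0) ∧
      W = colSpan (expand α (stack M Z) ![0, 0, 0, 0, 0, 1])}

/-- `𝕊_{𝒞_ξ}`: the `3`-subspaces obtained by extending the members of `𝒞_ξ` to `3`-subspaces of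
`F^5`, by appending a zero row and expanding with the unit vector `e₅`, and then in all ways to
`3`-subspaces of `F^6` with the entry `ξ` in the last row below `e₅`. -/
def setSCxi [LinearOrder F] {α : Fˣ} (d : Choices F α) (ξ : F) :
    Set (Submodule F (Fin 6 → F)) :=
  {W | ∃ S ∈ d.spreadsC ξ, ∃ X ∈ S, ∃ M, Represents α X M ∧
    ∃ Z ∈ extensionSpace F α, (∀ j, Z 0 j = 0) ∧
      W = colSpan (expand α (stack M Z) ![0, 0, 0, 0, 1, ξ])}

/-- `𝕊_𝒞`: the union of the sets `𝕊_{𝒞_ξ}`. -/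
def setSC [LinearOrder F] {α : Fˣ} (d : Choices F α) : Set (Submodule F (Fin 6 → F)) :=
  ⋃ ξ, setSCxi d ξ

/-- `𝕊_𝒟`: a `3`-subspace `Y` of `F^4` containing the member `X` of `𝒜` is represented by `E(M,u)`,
where `M` represents `X` and `u` is the smallest normalized vector of `Y` outside `X`; it is
extended with all `E(Z,v)`, where `Z` lies in the part matched with `Y` and `v` is any vector of
length `2`. -/
def setSD [LinearOrder F] {α : Fˣ} (d : Choices F α) : Set (Submodule F (Fin 6 → F)) :=
  {W | ∃ Y : Submodule F (Fin 4 → F), Module.finrank F Y = 3 ∧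
    ∃ X ∈ d.spreadA, X ≤ Y ∧ ∃ M, Represents α X M ∧
    ∃ u, IsLexLeast {x | x ∈ Y ∧ x ∉ X ∧ IsNormalized x} u ∧
    ∃ Z ∈ d.part (d.index Y), ∃ v : Fin 2 → F,
      W = colSpan (stack (expand α M u) (expand α Z v))}

end QFano

set_option linter.unusedSectionVars false
namespace QFano
open Module

/-! ### Counting subspaces over a finite field -/

/-! Write `F^6` as `V × U` with `V = F^4` and `U = F^2`. Every subspace `W` has a shadow in `V` and
a vertical part in `U`, whose dimensions add up to that of `W`. If the vertical part is zero, `W` is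
the graph of a linear map on its shadow, and over a `2`-subspace `X` such a map is a pair `Z` of
vectors of `U`. In these terms the blocks need no matrices: direction blocks have a member of a
class as shadow and that class's direction as vertical part, while `blocksD` consists of graphs over
`3`-subspaces `Y` whose restriction to the member of `A` inside `Y` lies in the part matched with
`Y`.

The derived system is a spread because a codeword is determined by its value at one nonzero vector,
and every value occurs. For a `2`-subspace `T` that is not derived, the dimension of the shadow
decides which blocks lie above it. If it is `1`, only blocks of a single direction do, and the `q`
spreads of that class give `q^2` of them (`ncard_residual_of_shadow_one`). If the shadow is in `A`,
then `T` is a graph given by a non-codeword, its part determines `Y`, and all `q^2` graphs over `Y`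
above `T` are blocks (`ncard_residual_of_shadow_mem_A`). For any other `2`-dimensional shadow there
is one direction block, and `q^2 - 1` members of `blocksD` because the relevant extensions form a
transversal of the code's cosets (`ncard_transversal_part`, `ncard_residual_of_shadow_notMem_A`). A
shadow of dimension `0` occurs only for `0 × U`, which is derived. Double counting incident pairs
then gives the number of blocks.

Existence rests on a quadratic extension `K` of `F`. Multiplication in `K` provides the code
(`exists_code_parametrization`). A parallelism of `K × K` consists of the spread of `K`-lines and
the images of one base spread under the shears `(x, y) ↦ (a x, b x + y)`. The stabilizer of the base
spread is given by `a, b ∈ F`, and every `2`-subspace that is not a `K`-line is reached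
(`mem_base_of_shear_mem`, `exists_shear_eq`). The base spread itself needs a map `m x + n x̄` whose
ratio to `x` avoids `F`, which a norm argument supplies for `q > 2`; `q = 2` has a variant of its
own (`exists_of_card`). -/

theorem ncard_mul_eq_ncard_mul {β γ : Type*} [Finite β] [Finite γ] (s : Set β) (t : Set γ)
    (r : β → γ → Prop) {m n : ℕ} (hm : ∀ a ∈ s, {b ∈ t | r a b}.ncard = m)
    (hn : ∀ b ∈ t, {a ∈ s | r a b}.ncard = n) : s.ncard * m = t.ncard * n := by
  classical
  have := Fintype.ofFinite β
  have := Fintype.ofFinite γ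
  rw [Set.ncard_eq_toFinset_card', Set.ncard_eq_toFinset_card']
  refine Finset.card_mul_eq_card_mul r (fun a ha => ?_) fun b hb => ?_
  · rw [← hm a (by simpa using ha), Set.ncard_eq_toFinset_card']
    congr 1
    ext b
    simp [Finset.mem_bipartiteAbove]
  · rw [← hn b (by simpa using hb), Set.ncard_eq_toFinset_card']
    congr 1
    ext a
    simp [Finset.mem_bipartiteBelow]

theorem ncard_eq_one_of_existsUnique {β : Type*} {p : β → Prop} (h : ∃! a, p a) :
    {a | p a}.ncard = 1 := by
  obtain ⟨a, ha, hu⟩ := h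
  rw [Set.ncard_eq_one]
  exact ⟨a, Set.ext fun b => ⟨fun hb => hu b hb, fun hb => by rw [Set.mem_singleton_iff.1 hb]; exact ha⟩⟩

section
variable {K V : Type*} [Field K] [AddCommGroup V] [Module K V]

/-- A set of `2`-subspaces of `V` such that each nonzero vector lies in exactly one of them. -/
def IsLineSpread (S : Set (Submodule K V)) : Prop :=
  (∀ W ∈ S, finrank K W = 2) ∧ ∀ x : V, x ≠ 0 → ∃! W, W ∈ S ∧ x ∈ W

/-- A partition of the `2`-subspaces of `V` into spreads. -/
def IsLineParallelism (P : Set (Set (Submodule K V))) : Prop :=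
  (∀ S ∈ P, IsLineSpread S) ∧
    ∀ W : Submodule K V, finrank K W = 2 → ∃! S, S ∈ P ∧ W ∈ S

theorem IsLineSpread.eq_of_mem {S : Set (Submodule K V)} (hS : IsLineSpread S)
    {X Y : Submodule K V} (hX : X ∈ S) (hY : Y ∈ S) {x : V} (hx : x ≠ 0) (hxX : x ∈ X)
    (hxY : x ∈ Y) : X = Y :=
  (hS.2 x hx).unique ⟨hX, hxX⟩ ⟨hY, hxY⟩

variable [Module.Finite K V]

theorem eq_sup_span_singleton {T W : Submodule K V} {w : V} (hT : T ≤ W) (hw : w ∈ W) (hwT : w ∉ T)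
    (hd : finrank K W = finrank K T + 1) : T ⊔ K ∙ w = W :=
  Submodule.eq_of_le_of_finrank_le (sup_le hT (by simpa using hw))
    (by rw [Submodule.finrank_sup_span_singleton hwT, hd])

theorem exists_eq_span_singleton {W : Submodule K V} (h : finrank K W = 1) :
    ∃ x, x ≠ 0 ∧ K ∙ x = W := by
  have hW : W ≠ ⊥ := by
    rintro rfl
    rw [finrank_bot] at h
    omega
  obtain ⟨x, hx, hx0⟩ := Submodule.exists_mem_ne_zero_of_ne_bot hW
  exact ⟨x, hx0, Submodule.eq_of_le_of_finrank_le (by simpa using hx)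
    (by rw [h, finrank_span_singleton hx0])⟩

theorem exists_ne_zero_mem_inf {X Y W : Submodule K V} (hX : X ≤ W) (hY : Y ≤ W)
    (h : finrank K W < finrank K X + finrank K Y) : ∃ x, x ≠ 0 ∧ x ∈ X ∧ x ∈ Y := by
  have h1 := Submodule.finrank_sup_add_finrank_inf_eq X Y
  have h2 := Submodule.finrank_mono (sup_le hX hY)
  have h3 : X ⊓ Y ≠ ⊥ := by
    intro h0
    rw [h0, finrank_bot] at h1
    omega
  obtain ⟨x, hx, hx0⟩ := Submodule.exists_mem_ne_zero_of_ne_bot h3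
  exact ⟨x, hx0, hx.1, hx.2⟩

/-- Two `2`-subspaces of a `3`-space share a nonzero vector. This is what makes "the member of `A`
inside `Y`" well defined. -/
theorem IsLineSpread.eq_of_le {S : Set (Submodule K V)} (hS : IsLineSpread S)
    {X X' Y : Submodule K V} (hX : X ∈ S) (hX' : X' ∈ S) (hY : finrank K Y = 3) (hXY : X ≤ Y)
    (hX'Y : X' ≤ Y) : X = X' := by
  obtain ⟨x, hx0, hx, hx'⟩ := exists_ne_zero_mem_inf hXY hX'Y
    (by rw [hY, hS.1 X hX, hS.1 X' hX']; norm_num)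
  exact hS.eq_of_mem hX hX' hx0 hx hx'

end

section
variable {K V : Type*} [Field K] [Fintype K] [AddCommGroup V] [Module K V] [Finite V]

theorem ncard_submodule (W : Submodule K V) :
    (W : Set V).ncard = Fintype.card K ^ finrank K W := by
  rw [← Nat.card_eq_fintype_card, ← natCard_eq_pow_finrank, ← Nat.card_coe_set_eq]
  rfl

theorem ncard_sdiff_submodule {T W : Submodule K V} (h : T ≤ W) :
    ((W : Set V) \ T).ncard = Fintype.card K ^ finrank K W - Fintype.card K ^ finrank K T := by
  rw [Set.ncard_sdiff h, ncard_submodule, ncard_submodule]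

theorem ncard_nonzero (W : Submodule K V) :
    {x | x ∈ W ∧ x ≠ 0}.ncard = Fintype.card K ^ finrank K W - 1 := by
  have h := ncard_sdiff_submodule (bot_le : ⊥ ≤ W)
  rw [finrank_bot, pow_zero] at h
  rw [← h]
  rfl

/-- The number of members of `R` above `T`, counted through the vectors outside `T`. -/
theorem ncard_above (R : Set (Submodule K V)) (T : Submodule K V)
    (hR : ∀ B ∈ R, T ≤ B → finrank K B = finrank K T + 1) :
    {B ∈ R | T ≤ B}.ncard *
      (Fintype.card K ^ (finrank K T + 1) - Fintype.card K ^ finrank K T) =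
      {w | w ∉ T ∧ T ⊔ K ∙ w ∈ R}.ncard := by
  rw [← mul_one (Set.ncard {w | w ∉ T ∧ T ⊔ K ∙ w ∈ R})]
  refine ncard_mul_eq_ncard_mul _ _ (fun B w => w ∈ B) ?_ ?_
  · rintro B ⟨hB, hTB⟩
    rw [← hR B hB hTB, ← ncard_sdiff_submodule hTB]
    congr 1
    ext w
    refine ⟨fun h => ⟨h.2, h.1.1⟩, fun h => ⟨⟨h.2, ?_⟩, h.1⟩⟩
    rwa [eq_sup_span_singleton hTB h.1 h.2 (hR B hB hTB)]
  · rintro w ⟨hw, hwR⟩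
    refine ncard_eq_one_of_existsUnique ⟨T ⊔ K ∙ w, ⟨⟨hwR, le_sup_left⟩, ?_⟩, ?_⟩
    · exact Submodule.mem_sup_right (Submodule.mem_span_singleton_self w)
    · rintro B ⟨⟨hB, hTB⟩, hwB⟩
      exact (eq_sup_span_singleton hTB hwB hw (hR B hB hTB)).symm

theorem two_le_card : 2 ≤ Fintype.card K := Fintype.one_lt_card

theorem pow_succ_sub_pow_pos (a k : ℕ) (ha : 2 ≤ a) : 0 < a ^ (k + 1) - a ^ k := by
  have : a ^ k < a ^ (k + 1) := Nat.pow_lt_pow_right (by omega) (by omega)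
  omega

/-- The number of `2`-subspaces of a subspace. -/
theorem ncard_lines_le (W : Submodule K V) (hW : 2 ≤ finrank K W) :
    {T : Submodule K V | finrank K T = 2 ∧ T ≤ W}.ncard *
      ((Fintype.card K ^ 2 - 1) * (Fintype.card K ^ 2 - Fintype.card K)) =
      (Fintype.card K ^ finrank K W - 1) *
        (Fintype.card K ^ finrank K W - Fintype.card K) := by
  -- Ordered independent pairs are counted once in `W` and once in each `2`-subspace, since every
  -- such pair spans exactly one `2`-subspace.
  have key : ∀ B : Submodule K V, 2 ≤ finrank K B →
      {s : Fin 2 → V | LinearIndependent K s ∧ ∀ i, s i ∈ B}.ncard =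
      (Fintype.card K ^ finrank K B - 1) * (Fintype.card K ^ finrank K B - Fintype.card K) := by
    intro B hB
    have h := card_linearIndependent (K := K) (V := B) hB
    rw [Fin.prod_univ_two, Fin.val_zero, pow_zero, Fin.val_one, pow_one] at h
    rw [← h, ← Nat.card_coe_set_eq]
    refine Nat.card_congr
      { toFun := fun s => ⟨fun i => ⟨s.1 i, s.2.2 i⟩, ?_⟩
        invFun := fun s => ⟨fun i => s.1 i, ?_⟩
        left_inv := fun s => rfl
        right_inv := fun s => rfl }
    · exact LinearIndependent.of_comp B.subtype (by exact s.2.1)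
    · exact ⟨s.2.map' B.subtype (Submodule.ker_subtype B), fun i => (s.1 i).2⟩
  rw [← key W hW, ← mul_one (Set.ncard {s : Fin 2 → V | LinearIndependent K s ∧ ∀ i, s i ∈ W})]
  refine ncard_mul_eq_ncard_mul _ _ (fun T s => ∀ i, s i ∈ T) ?_ ?_
  · rintro T ⟨hT, hTW⟩
    have := key T hT.ge
    rw [hT] at this
    rw [← this]
    congr 1
    ext s
    exact ⟨fun h => ⟨h.1.1, h.2⟩, fun h => ⟨⟨h.1, fun i => hTW (h.2 i)⟩, h.2⟩⟩
  · rintro s ⟨hs, hsW⟩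
    have hd : finrank K (Submodule.span K (Set.range s)) = 2 := by
      simpa using finrank_span_eq_card hs
    refine ncard_eq_one_of_existsUnique ⟨Submodule.span K (Set.range s), ⟨⟨hd, ?_⟩, ?_⟩, ?_⟩
    · exact Submodule.span_le.2 (by rintro _ ⟨i, rfl⟩; exact hsW i)
    · exact fun i => Submodule.subset_span ⟨i, rfl⟩
    · rintro B ⟨⟨hB, -⟩, hsB⟩
      refine (Submodule.eq_of_le_of_finrank_le (Submodule.span_le.2 ?_) (by rw [hB, hd])).symm
      rintro _ ⟨i, rfl⟩
      exact hsB i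

theorem IsLineSpread.ncard_mul {S : Set (Submodule K V)} (hS : IsLineSpread S) :
    S.ncard * (Fintype.card K ^ 2 - 1) = Fintype.card K ^ finrank K V - 1 := by
  have h := ncard_nonzero (⊤ : Submodule K V)
  rw [finrank_top] at h
  rw [← h, ← mul_one (Set.ncard {x : V | _})]
  refine ncard_mul_eq_ncard_mul _ _ (fun B w => w ∈ B) (fun B hB => ?_) fun w hw => ?_
  · rw [← hS.1 B hB, ← ncard_nonzero B]
    congr 1
    ext w
    simp [and_comm]
  · exact ncard_eq_one_of_existsUnique (hS.2 w hw.2)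

theorem IsLineSpread.ncard_eq {S : Set (Submodule K V)} (hS : IsLineSpread S)
    (hV : finrank K V = 4) : S.ncard = Fintype.card K ^ 2 + 1 := by
  have h := hS.ncard_mul
  have h2 := two_le_card (K := K)
  rw [hV] at h
  have h3 : 0 < Fintype.card K ^ 2 - 1 := by
    have : 2 ^ 2 ≤ Fintype.card K ^ 2 := Nat.pow_le_pow_left h2 2
    omega
  refine Nat.eq_of_mul_eq_mul_right h3 (h.trans ?_)
  rw [← Nat.sq_sub_sq, ← pow_mul, one_pow]

/-- Each `3`-subspace contains a member of a given spread of the `4`-dimensional space. -/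
theorem IsLineSpread.exists_le {S : Set (Submodule K V)} (hS : IsLineSpread S)
    (hV : finrank K V = 4) {Y : Submodule K V} (hY : finrank K Y = 3) : ∃ X ∈ S, X ≤ Y := by
  -- Otherwise each of the `q^2 + 1` members meets the hyperplane `Y` in a `1`-subspace, so `Y` has
  -- only `(q^2 + 1)(q - 1)` nonzero vectors, fewer than `q^3 - 1`.
  by_contra! hne
  have h : S.ncard * (Fintype.card K - 1) = {x | x ∈ Y ∧ x ≠ 0}.ncard * 1 := by
    refine ncard_mul_eq_ncard_mul _ _ (fun B w => w ∈ B) (fun B hB => ?_) fun w hw => ?_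
    · have h1 := Submodule.finrank_sup_add_finrank_inf_eq B Y
      have h2 : finrank K (B ⊔ Y : Submodule K V) ≤ 4 := hV ▸ Submodule.finrank_le _
      have h3 : finrank K (B ⊓ Y : Submodule K V) < 2 := by
        rw [← hS.1 B hB]
        exact Submodule.finrank_lt_finrank_of_lt (inf_lt_left.2 (hne B hB))
      have h4 : finrank K (B ⊓ Y : Submodule K V) = 1 := by
        rw [hS.1 B hB, hY] at h1
        omega
      have h5 := ncard_nonzero (B ⊓ Y)
      rw [h4, pow_one] at h5
      rw [← h5]
      congr 1
      ext w
      simp only [Set.mem_ofPred_eq, Submodule.mem_inf]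
      tauto
    · exact ncard_eq_one_of_existsUnique (hS.2 w hw.2)
  rw [hS.ncard_eq hV, ncard_nonzero, hY, mul_one] at h
  obtain ⟨k, hk⟩ : ∃ k, Fintype.card K = k + 2 := ⟨_, (Nat.sub_add_cancel two_le_card).symm⟩
  rw [hk] at h
  have h6 : (k + 2) ^ 3 - 1 = k ^ 3 + 6 * k ^ 2 + 12 * k + 7 := by
    rw [Nat.sub_eq_iff_eq_add (Nat.one_le_pow _ _ (by omega))]
    ring
  rw [h6, show k + 2 - 1 = k + 1 by omega] at h
  nlinarith

theorem IsLineParallelism.ncard_eq {P : Set (Set (Submodule K V))} (hP : IsLineParallelism P)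
    (hV : finrank K V = 4) :
    P.ncard = Fintype.card K ^ 2 + Fintype.card K + 1 := by
  have h : P.ncard * (Fintype.card K ^ 2 + 1) =
      {T : Submodule K V | finrank K T = 2 ∧ T ≤ ⊤}.ncard * 1 := by
    refine ncard_mul_eq_ncard_mul _ _ (fun S W => W ∈ S) (fun S hS => ?_) fun W hW => ?_
    · rw [← (hP.1 S hS).ncard_eq hV]
      congr 1
      ext W
      exact ⟨fun h => h.2, fun h => ⟨⟨(hP.1 S hS).1 W h, le_top⟩, h⟩⟩
    · exact ncard_eq_one_of_existsUnique (hP.2 W hW.1)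
  have h' := ncard_lines_le (⊤ : Submodule K V) (by rw [finrank_top, hV]; norm_num)
  rw [mul_one] at h
  rw [← h, finrank_top, hV] at h'
  have h2 := two_le_card (K := K)
  generalize Fintype.card K = q at *
  have e1 : 1 ≤ q ^ 2 := Nat.one_le_pow _ _ (by omega)
  have e2 : q ≤ q ^ 2 := Nat.le_self_pow (by norm_num) q
  have e3 : 1 ≤ q ^ 4 := Nat.one_le_pow _ _ (by omega)
  have e4 : q ≤ q ^ 4 := Nat.le_self_pow (by norm_num) q
  zify [e1, e2, e3, e4] at h' ⊢
  have h2' : (2 : ℤ) ≤ q := by exact_mod_cast h2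
  have hne : ((q : ℤ) ^ 2 + 1) * (((q : ℤ) ^ 2 - 1) * ((q : ℤ) ^ 2 - q)) ≠ 0 := by
    have : (0 : ℤ) < (q : ℤ) ^ 2 - q := by nlinarith
    have : (0 : ℤ) < (q : ℤ) ^ 2 - 1 := by nlinarith
    positivity
  refine mul_right_cancel₀ hne ?_
  linear_combination h'

/-- The number of `3`-subspaces above a `2`-subspace of a `4`-dimensional space. -/
theorem ncard_hyperplanes_above (hV : finrank K V = 4) {X : Submodule K V}
    (hX : finrank K X = 2) :
    {Y : Submodule K V | finrank K Y = 3 ∧ X ≤ Y}.ncard = Fintype.card K + 1 := by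
  have h := ncard_above {Y : Submodule K V | finrank K Y = 3} X (fun B hB _ => by rw [hX]; exact hB)
  -- Any vector outside `X` spans a `3`-subspace with `X`, and each `3`-subspace arises from `q^3 -
  -- q^2` vectors; the quotient `(q^4 - q^2) / (q^3 - q^2)` is `q + 1`.
  have h1 : {w | w ∉ X ∧ X ⊔ K ∙ w ∈ {Y : Submodule K V | finrank K Y = 3}} =
      ((⊤ : Submodule K V) : Set V) \ X := by
    ext w
    simp only [Set.mem_ofPred_eq, Set.mem_sdiff, Submodule.top_coe, Set.mem_univ, true_and,
      SetLike.mem_coe, and_iff_left_iff_imp]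
    intro hw
    rw [Submodule.finrank_sup_span_singleton hw, hX]
  rw [h1, ncard_sdiff_submodule le_top, finrank_top, hV, hX] at h
  have h2 := two_le_card (K := K)
  have h3 := pow_succ_sub_pow_pos _ 2 h2
  refine Nat.eq_of_mul_eq_mul_right h3 (h.trans ?_)
  generalize Fintype.card K = q at *
  have e1 : q ^ 2 ≤ q ^ 3 := Nat.pow_le_pow_right (by omega) (by omega)
  have e2 : q ^ 2 ≤ q ^ 4 := Nat.pow_le_pow_right (by omega) (by omega)
  zify [e1, e2]
  ring

end

/-! ### The construction on `V × U` -/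

section
variable {K V U : Type*} [Field K] [AddCommGroup V] [Module K V] [AddCommGroup U] [Module K U]

/-- The projection of a subspace of `V × U` to `V`. -/
abbrev shadow (W : Submodule K (V × U)) : Submodule K V := W.map (LinearMap.fst K V U)

theorem fst_mem_shadow {W : Submodule K (V × U)} {w : V × U} (hw : w ∈ W) : w.1 ∈ shadow W :=
  ⟨w, hw, rfl⟩

theorem shadow_sup_span (W : Submodule K (V × U)) (w : V × U) :
    shadow (W ⊔ K ∙ w) = shadow W ⊔ K ∙ w.1 := by
  rw [shadow, Submodule.map_sup, Submodule.map_span, Set.image_singleton]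
  rfl

/-- The part of `W` above zero. -/
def vertical (W : Submodule K (V × U)) : Submodule K U := W.comap (LinearMap.inr K V U)

theorem mem_vertical {W : Submodule K (V × U)} {u : U} :
    u ∈ vertical W ↔ ((0 : V), u) ∈ W := Iff.rfl

variable [Module.Finite K V] [Module.Finite K U]

/-- Rank-nullity for the first projection restricted to `W`, whose kernel is the vertical part. -/
theorem finrank_shadow_add (W : Submodule K (V × U)) :
    finrank K (shadow W) + finrank K (vertical W) = finrank K W := by
  have h := LinearMap.finrank_range_add_finrank_ker ((LinearMap.fst K V U).domRestrict W)
  have e : vertical W ≃ₗ[K] LinearMap.ker ((LinearMap.fst K V U).domRestrict W) :=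
    LinearEquiv.ofBijective
      ((((LinearMap.inr K V U).comp (vertical W).subtype).codRestrict W (fun u => u.2)).codRestrict _
        (fun u => rfl))
      ⟨fun u v h => by
        have := congrArg (fun z => z.1.1.2) h
        exact Subtype.ext this,
       fun w => by
        obtain ⟨⟨⟨x, u⟩, hw⟩, hk⟩ := w
        have hx : x = 0 := by simpa using hk
        subst hx
        exact ⟨⟨u, hw⟩, rfl⟩⟩
  rw [e.finrank_eq, ← h, LinearMap.range_domRestrict]

/-- Equal dimensions force the vertical part to vanish, so `W` is a graph over its shadow. -/
theorem eq_of_fst_eq {W : Submodule K (V × U)} (hW : finrank K (shadow W) = finrank K W)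
    {x : V} {u u' : U} (h : (x, u) ∈ W) (h' : (x, u') ∈ W) : u = u' := by
  have h0 := finrank_shadow_add W
  have h1 : vertical W = ⊥ := Submodule.finrank_eq_zero.1 (by omega)
  have h2 : u - u' ∈ vertical W := by
    rw [mem_vertical]
    simpa using W.sub_mem h h'
  rw [h1, Submodule.mem_bot] at h2
  exact sub_eq_zero.1 h2

theorem finrank_prod_bot_top (hU : finrank K U = 2) :
    finrank K ((⊥ : Submodule K V).prod (⊤ : Submodule K U)) = 2 := by
  have h := finrank_shadow_add ((⊥ : Submodule K V).prod (⊤ : Submodule K U))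
  have h1 : shadow ((⊥ : Submodule K V).prod (⊤ : Submodule K U)) = ⊥ := by
    rw [eq_bot_iff]
    rintro _ ⟨w, hw, rfl⟩
    exact hw.1
  have h2 : vertical ((⊥ : Submodule K V).prod (⊤ : Submodule K U)) = ⊤ := by
    rw [eq_top_iff]
    rintro u -
    simp [mem_vertical]
  rw [h1, h2, finrank_bot, finrank_top, hU] at h
  omega

end

/-- The data of the construction, without coordinates: a pair `(z₀, z₁)` stands for the linear map
that takes the basis `b₀ X, b₁ X` of a `2`-subspace `X` of `V` to `z₀, z₁`. -/
structure ConstructionData (K V U ι J : Type*) [Field K] [Fintype K] [AddCommGroup V] [Module K V]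
    [AddCommGroup U] [Module K U] where
  finrank_V : finrank K V = 4
  finrank_U : finrank K U = 2
  A : Set (Submodule K V)
  spread_A : IsLineSpread A
  dir : ι → U
  dir_ne : ∀ i, dir i ≠ 0
  dir_unique : ∀ u : U, u ≠ 0 → ∃! i, u ∈ K ∙ dir i
  cls : ι → Set (Set (Submodule K V))
  spread_cls : ∀ i, ∀ S ∈ cls i, IsLineSpread S
  ncard_cls : ∀ i, (cls i).ncard = Fintype.card K
  covered : ∀ X : Submodule K V, finrank K X = 2 → X ∉ A → ∃ i, ∃ S ∈ cls i, X ∈ S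
  notMem_A : ∀ i, ∀ S ∈ cls i, ∀ X ∈ S, X ∉ A
  unique_cls : ∀ i j, ∀ S ∈ cls i, ∀ S' ∈ cls j, ∀ X, X ∈ S → X ∈ S' → i = j ∧ S = S'
  b₀ : Submodule K V → V
  b₁ : Submodule K V → V
  span_basis : ∀ X : Submodule K V, finrank K X = 2 → Submodule.span K {b₀ X, b₁ X} = X
  code : Submodule K (U × U)
  code_eval : ∀ a b : K, (a ≠ 0 ∨ b ≠ 0) → ∀ u : U, ∃! Z, Z ∈ code ∧ a • Z.1 + b • Z.2 = u
  part : J → Set (U × U)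
  mem_part_iff : ∀ Z, (∃ j, Z ∈ part j) ↔ Z ∉ code
  part_unique : ∀ i j Z, Z ∈ part i → Z ∈ part j → i = j
  part_add : ∀ j, ∀ Z ∈ part j, ∀ c ∈ code, Z + c ∈ part j
  ncard_part : ∀ j, (part j).ncard = Fintype.card K ^ 2 * (Fintype.card K - 1)
  index : Submodule K V → J
  bijOn_index : ∀ X ∈ A, Set.BijOn index {Y | finrank K Y = 3 ∧ X ≤ Y} Set.univ

/-! ### The coordinate-free blocks and the derived spread -/

namespace ConstructionData
variable {K V U ι J : Type*} [Field K] [Fintype K] [AddCommGroup V] [Module K V] [Finite V]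
  [AddCommGroup U] [Module K U] [Finite U] (d : ConstructionData K V U ι J)

/-- The subspace `W` contains the extension of the basis of `X` by `Z`. -/
def Extends (X : Submodule K V) (Z : U × U) (W : Submodule K (V × U)) : Prop :=
  (d.b₀ X, Z.1) ∈ W ∧ (d.b₁ X, Z.2) ∈ W

def blocksA : Set (Submodule K (V × U)) :=
  {W | finrank K W = 2 ∧ shadow W ∈ d.A ∧ ∃ Z ∈ d.code, d.Extends (shadow W) Z W}

/-- No extension `Z` is mentioned: every extension of the shadow is allowed, and extensions that
agree modulo the direction give the same block. -/
def blocksDir (i : ι) : Set (Submodule K (V × U)) :=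
  {W | finrank K W = 3 ∧ (0, d.dir i) ∈ W ∧ ∃ S ∈ d.cls i, shadow W ∈ S}

/-- The two rank conditions make `W` a graph over a `3`-subspace. The value at a vector outside `X`
is unrestricted, which accounts for the free vector `v` of the construction. -/
def blocksD : Set (Submodule K (V × U)) :=
  {W | finrank K W = 3 ∧ finrank K (shadow W) = 3 ∧ ∃ X ∈ d.A, X ≤ shadow W ∧
    ∃ Z ∈ d.part (d.index (shadow W)), d.Extends X Z W}

def derived : Set (Submodule K (V × U)) :=
  {W | W = (⊥ : Submodule K V).prod ⊤} ∪ d.blocksA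

def residual : Set (Submodule K (V × U)) := (⋃ i, d.blocksDir i) ∪ d.blocksD

theorem b₀_mem {X : Submodule K V} (hX : finrank K X = 2) : d.b₀ X ∈ X := by
  have h : d.b₀ X ∈ Submodule.span K {d.b₀ X, d.b₁ X} := Submodule.subset_span (by simp)
  rwa [d.span_basis X hX] at h

theorem b₁_mem {X : Submodule K V} (hX : finrank K X = 2) : d.b₁ X ∈ X := by
  have h : d.b₁ X ∈ Submodule.span K {d.b₀ X, d.b₁ X} := Submodule.subset_span (by simp)
  rwa [d.span_basis X hX] at h

theorem le_of_basis_mem {X Y : Submodule K V} (hX : finrank K X = 2) (h0 : d.b₀ X ∈ Y)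
    (h1 : d.b₁ X ∈ Y) : X ≤ Y := by
  rw [← d.span_basis X hX, Submodule.span_le]
  rintro _ (rfl | rfl) <;> assumption

theorem exists_coords {X : Submodule K V} (hX : finrank K X = 2) {x : V} (hx : x ∈ X) :
    ∃ a b : K, a • d.b₀ X + b • d.b₁ X = x := by
  rw [← d.span_basis X hX] at hx
  exact Submodule.mem_span_pair.1 hx

/-- The graph over `X` of the map given by `Z`. -/
def graph (X : Submodule K V) (Z : U × U) : Submodule K (V × U) :=
  Submodule.span K {(d.b₀ X, Z.1), (d.b₁ X, Z.2)}

theorem graph_extends (X : Submodule K V) (Z : U × U) : d.Extends X Z (d.graph X Z) :=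
  ⟨Submodule.subset_span (by simp), Submodule.subset_span (by simp)⟩

theorem graph_le_iff {X : Submodule K V} {Z : U × U} {W : Submodule K (V × U)} :
    d.graph X Z ≤ W ↔ d.Extends X Z W := by
  refine ⟨fun h => ⟨h (d.graph_extends X Z).1, h (d.graph_extends X Z).2⟩, fun h => ?_⟩
  rw [graph, Submodule.span_le]
  rintro _ (rfl | rfl)
  exacts [h.1, h.2]

theorem shadow_graph {X : Submodule K V} (hX : finrank K X = 2) (Z : U × U) :
    shadow (d.graph X Z) = X := by
  rw [shadow, graph, Submodule.map_span, Set.image_pair]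
  exact d.span_basis X hX

theorem finrank_graph {X : Submodule K V} (hX : finrank K X = 2) (Z : U × U) :
    finrank K (d.graph X Z) = 2 := by
  refine le_antisymm ?_ ?_
  · classical
    refine le_trans (b := ({(d.b₀ X, Z.1), (d.b₁ X, Z.2)} : Finset (V × U)).card) ?_ Finset.card_le_two
    have h := finrank_span_finset_le_card (R := K)
      ({(d.b₀ X, Z.1), (d.b₁ X, Z.2)} : Finset (V × U))
    rwa [Set.finrank, Finset.coe_pair] at h
  · have h := finrank_shadow_add (d.graph X Z)
    rw [d.shadow_graph hX, hX] at h
    omega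

theorem mem_of_extends {X : Submodule K V} {Z : U × U} {W : Submodule K (V × U)}
    (h : d.Extends X Z W) (a b : K) :
    (a • d.b₀ X + b • d.b₁ X, a • Z.1 + b • Z.2) ∈ W := by
  simpa using W.add_mem (W.smul_mem a h.1) (W.smul_mem b h.2)

theorem extends_unique {X : Submodule K V} {Z Z' : U × U} {W : Submodule K (V × U)}
    (hW : finrank K (shadow W) = finrank K W) (h : d.Extends X Z W) (h' : d.Extends X Z' W) :
    Z = Z' :=
  Prod.ext (eq_of_fst_eq hW h.1 h'.1) (eq_of_fst_eq hW h.2 h'.2)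

theorem exists_extends {X : Submodule K V} (hX : finrank K X = 2) {W : Submodule K (V × U)}
    (h : X ≤ shadow W) : ∃ Z, d.Extends X Z W := by
  obtain ⟨⟨x, u⟩, hu, rfl : x = _⟩ := h (d.b₀_mem hX)
  obtain ⟨⟨y, v⟩, hv, rfl : y = _⟩ := h (d.b₁_mem hX)
  exact ⟨(u, v), hu, hv⟩

theorem finrank_shadow_A {W : Submodule K (V × U)} (hW : W ∈ d.blocksA) :
    finrank K (shadow W) = finrank K W := by
  rw [hW.1, d.spread_A.1 _ hW.2.1]

/-- A vector with first component `x ≠ 0` singles out the member `X` of `A` through `x`, and then,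
by `code_eval`, the one codeword whose map on `X` takes `x` to the second component. The vectors
above zero are covered by `0 × U`. -/
theorem derived_spread : IsLineSpread d.derived := by
  refine ⟨?_, ?_⟩
  · rintro W (rfl | hW)
    · exact finrank_prod_bot_top d.finrank_U
    · exact hW.1
  · rintro ⟨x, y⟩ hxy
    by_cases hx : x = 0
    · subst hx
      refine ⟨_, ⟨Or.inl rfl, by simp⟩, ?_⟩
      rintro W ⟨rfl | hW, h⟩
      · rfl
      · have := eq_of_fst_eq (d.finrank_shadow_A hW) h W.zero_mem
        simp [this] at hxy
    · obtain ⟨X, ⟨hXA, hxX⟩, hXu⟩ := d.spread_A.2 x hx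
      have hX := d.spread_A.1 X hXA
      obtain ⟨a, b, rfl⟩ := d.exists_coords hX hxX
      have hab : a ≠ 0 ∨ b ≠ 0 := by
        by_contra! h
        simp [h.1, h.2] at hx
      obtain ⟨Z, ⟨hZ, rfl⟩, hZu⟩ := d.code_eval a b hab y
      refine ⟨d.graph X Z, ⟨Or.inr ⟨d.finrank_graph hX Z, ?_, Z, hZ, ?_⟩,
        d.mem_of_extends (d.graph_extends X Z) a b⟩, ?_⟩
      · rwa [d.shadow_graph hX]
      · rw [d.shadow_graph hX]
        exact d.graph_extends X Z
      · rintro W ⟨rfl | hW, h⟩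
        · exact absurd h.1 hx
        · obtain ⟨hW2, hWA, Z', hZ', hZW⟩ := id hW
          have hXW : shadow W = X := hXu _ ⟨hWA, fst_mem_shadow h⟩
          rw [hXW] at hZW
          have := hZu Z' ⟨hZ', eq_of_fst_eq (d.finrank_shadow_A hW) (d.mem_of_extends hZW a b) h⟩
          subst this
          exact (Submodule.eq_of_le_of_finrank_le (d.graph_le_iff.2 hZW)
            (by rw [hW2, d.finrank_graph hX])).symm

theorem finrank_residual {B : Submodule K (V × U)} (hB : B ∈ d.residual) : finrank K B = 3 := by
  rcases hB with hB | hB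
  · obtain ⟨i, hi⟩ := Set.mem_iUnion.1 hB
    exact hi.1
  · exact hB.1

theorem finrank_shadow_dir {i : ι} {B : Submodule K (V × U)} (hB : B ∈ d.blocksDir i) :
    finrank K (shadow B) = 2 := by
  obtain ⟨-, -, S, hS, hBS⟩ := hB
  exact (d.spread_cls i S hS).1 _ hBS

theorem vertical_dir {i : ι} {B : Submodule K (V × U)} (hB : B ∈ d.blocksDir i) :
    vertical B = K ∙ d.dir i := by
  have h := finrank_shadow_add B
  rw [d.finrank_shadow_dir hB, hB.1] at h
  refine (Submodule.eq_of_le_of_finrank_le ?_ ?_).symm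
  · rw [Submodule.span_singleton_le_iff_mem]
    exact hB.2.1
  · rw [finrank_span_singleton (d.dir_ne i)]
    omega

theorem finrank_shadow_D {B : Submodule K (V × U)} (hB : B ∈ d.blocksD) :
    finrank K (shadow B) = finrank K B := by
  rw [hB.1, hB.2.1]

theorem shadow_eq_of_le_dir {T B : Submodule K (V × U)} {i : ι} (hB : B ∈ d.blocksDir i)
    (h : T ≤ B) (hT : finrank K (shadow T) = 2) : shadow T = shadow B :=
  Submodule.eq_of_le_of_finrank_le (Submodule.map_mono h) (by rw [d.finrank_shadow_dir hB, hT])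

theorem shadow_notMem_A {B : Submodule K (V × U)} {i : ι} (hB : B ∈ d.blocksDir i) :
    shadow B ∉ d.A := by
  obtain ⟨-, -, S, hS, hBS⟩ := hB
  exact d.notMem_A i S hS _ hBS

/-- For equal dimensions containment in a derived member is equality. Then `0 × U` is excluded
because residual blocks have vertical part of dimension at most `1`. A graph over `X ∈ A` is
excluded from direction blocks by its shadow, and from `blocksD` because its pair `Z` would be both
a codeword and in a part. -/
theorem not_le_residual {T D B : Submodule K (V × U)} (hT : finrank K T = 2)
    (hD : D ∈ d.derived) (hTD : T ≤ D) (hB : B ∈ d.residual) : ¬ T ≤ B := by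
  have : T = D :=
    Submodule.eq_of_le_of_finrank_le hTD (by rw [hT, d.derived_spread.1 D hD])
  subst this
  intro hTB
  rcases hD with rfl | hA
  · have hv : vertical B = ⊤ := by
      rw [eq_top_iff]
      rintro u -
      exact hTB (by simp)
    rcases hB with hB | hB
    · obtain ⟨i, hi⟩ := Set.mem_iUnion.1 hB
      have h1 := congrArg (fun S : Submodule K U => finrank K S) (hv.symm.trans (d.vertical_dir hi))
      simp only [finrank_top, d.finrank_U, finrank_span_singleton (d.dir_ne i)] at h1
      omega
    · have h1 := finrank_shadow_add B
      rw [hv, finrank_top, d.finrank_U, hB.1, hB.2.1] at h1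
      omega
  · have hd := d.spread_A.1 _ hA.2.1
    rcases hB with hB | hB
    · obtain ⟨i, hi⟩ := Set.mem_iUnion.1 hB
      apply d.shadow_notMem_A hi
      rw [← d.shadow_eq_of_le_dir hi hTB hd]
      exact hA.2.1
    · have hinj := d.finrank_shadow_D hB
      obtain ⟨-, h3, X, hX, hXB, Z, hZ, hZB⟩ := hB
      obtain ⟨-, hTA, Z', hZ', hZT⟩ := hA
      have := d.spread_A.eq_of_le hX hTA h3 hXB (Submodule.map_mono hTB)
      rw [← this] at hZT
      have hZZ := d.extends_unique hinj hZB ⟨hTB hZT.1, hTB hZT.2⟩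
      subst hZZ
      exact (d.mem_part_iff Z).1 ⟨_, hZ⟩ hZ'

end ConstructionData

/-! ### Counting the residual blocks above a `2`-subspace -/

namespace ConstructionData
variable {K V U ι J : Type*} [Field K] [Fintype K] [AddCommGroup V] [Module K V] [Finite V]
  [AddCommGroup U] [Module K U] [Finite U] (d : ConstructionData K V U ι J)

/-- A block above `T` is `T ⊔ K ∙ w` for each of its `q^3 - q^2` vectors `w` outside `T`, so blocks
can be counted through vectors. -/
theorem ncard_above_residual {T : Submodule K (V × U)} (hT : finrank K T = 2)
    {R : Set (Submodule K (V × U))} (hR : R ⊆ d.residual) :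
    {B ∈ R | T ≤ B}.ncard * (Fintype.card K ^ 3 - Fintype.card K ^ 2) =
      {w | w ∉ T ∧ T ⊔ K ∙ w ∈ R}.ncard := by
  have h := ncard_above R T (fun B hB _ => by rw [hT, d.finrank_residual (hR hB)])
  rwa [hT] at h

theorem ncard_univ_of_finrank_two (hU : finrank K U = 2) : (Set.univ : Set U).ncard = Fintype.card K ^ 2 := by
  have h := ncard_submodule (⊤ : Submodule K U)
  rwa [finrank_top, hU] at h

theorem ncard_fst_mem (hU : finrank K U = 2) (G : Set V) :
    {w : V × U | w.1 ∈ G}.ncard = G.ncard * Fintype.card K ^ 2 := by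
  rw [← ncard_univ_of_finrank_two hU, ← Set.ncard_prod]
  congr 1
  ext w
  simp

theorem ncard_above_eq_of_ncard {n N : ℕ} (hN : N * (Fintype.card K ^ 3 - Fintype.card K ^ 2) = n)
    (hn : n = Fintype.card K ^ 2 * (Fintype.card K ^ 3 - Fintype.card K ^ 2)) :
    N = Fintype.card K ^ 2 :=
  Nat.eq_of_mul_eq_mul_right (pow_succ_sub_pow_pos _ 2 two_le_card) (hN.trans hn)

/-- The vectors that span a member of the `i`-th direction class together with a `2`-subspace
containing the `i`-th direction. -/
theorem ncard_class_vectors (i : ι) {x : V} (hx : x ≠ 0) :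
    {v | (∃ S ∈ d.cls i, ∃ X ∈ S, x ∈ X ∧ v ∈ X) ∧ v ∉ K ∙ x}.ncard =
      Fintype.card K * (Fintype.card K ^ 2 - Fintype.card K) := by
  rw [← mul_one (Set.ncard {v | _}), ← d.ncard_cls i]
  refine (ncard_mul_eq_ncard_mul _ _ (fun S v => ∃ X ∈ S, x ∈ X ∧ v ∈ X) ?_ ?_).symm
  · intro S hS
    obtain ⟨X, ⟨hXS, hxX⟩, hu⟩ := (d.spread_cls i S hS).2 x hx
    have hX := (d.spread_cls i S hS).1 X hXS
    have h := ncard_sdiff_submodule (T := K ∙ x) (W := X) (by simpa using hxX)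
    rw [hX, finrank_span_singleton hx, pow_one] at h
    rw [d.ncard_cls i, ← h]
    congr 1
    ext v
    constructor
    · rintro ⟨⟨-, hv⟩, X', hX', hx', hv'⟩
      have := hu X' ⟨hX', hx'⟩
      subst this
      exact ⟨hv', hv⟩
    · rintro ⟨hv, hv'⟩
      exact ⟨⟨⟨S, hS, X, hXS, hxX, hv⟩, hv'⟩, X, hXS, hxX, hv⟩
  -- Since `x` and `v` span a single `2`-subspace, and it lies in only one spread, different spreads
  -- of the class contribute disjoint sets of vectors.
  · rintro v ⟨⟨S, hS, X, hX, hxX, hvX⟩, hv⟩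
    refine ncard_eq_one_of_existsUnique ⟨S, ⟨hS, X, hX, hxX, hvX⟩, ?_⟩
    rintro S' ⟨hS', X', hX', hxX', hvX'⟩
    have key : ∀ Y : Submodule K V, finrank K Y = 2 → x ∈ Y → v ∈ Y → K ∙ x ⊔ K ∙ v = Y :=
      fun Y hY hxY hvY => eq_sup_span_singleton (by simpa using hxY) hvY hv
        (by rw [hY, finrank_span_singleton hx])
    have h1 := key X ((d.spread_cls i S hS).1 X hX) hxX hvX
    have h2 := key X' ((d.spread_cls i S' hS').1 X' hX') hxX' hvX'
    rw [← h2, h1] at hX'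
    exact (d.unique_cls i i S hS S' hS' X hX hX').2.symm

/-- The vertical part of `T` is one direction `i`, which rules out `blocksD` and all other direction
classes. Whether `T ⊔ K ∙ w` is a block then depends only on `w.1`, which must lie outside `⟨x⟩` in
a member through `x` of a spread of class `i`. This leaves `q (q^2 - q) q^2` vectors `w`. -/
theorem ncard_residual_of_shadow_one {T : Submodule K (V × U)} (hT : finrank K T = 2)
    (hs : finrank K (shadow T) = 1) :
    {B ∈ d.residual | T ≤ B}.ncard = Fintype.card K ^ 2 := by
  have h := finrank_shadow_add T
  obtain ⟨u, hu0, hu⟩ := exists_eq_span_singleton (show finrank K (vertical T) = 1 by omega)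
  obtain ⟨x, hx0, hx⟩ := exists_eq_span_singleton hs
  obtain ⟨i, hi, hiu⟩ := d.dir_unique u hu0
  have huT : (0, u) ∈ T := by
    rw [← mem_vertical, ← hu]
    exact Submodule.mem_span_singleton_self u
  have hiT : (0, d.dir i) ∈ T := by
    rw [← mem_vertical, ← hu]
    obtain ⟨a, rfl⟩ := Submodule.mem_span_singleton.1 hi
    have ha : a ≠ 0 := by
      rintro rfl
      simp at hu0
    exact Submodule.mem_span_singleton.2 ⟨a⁻¹, by rw [smul_smul, inv_mul_cancel₀ ha, one_smul]⟩
  refine ncard_above_eq_of_ncard (d.ncard_above_residual hT subset_rfl) ?_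
  have hset : {w | w ∉ T ∧ T ⊔ K ∙ w ∈ d.residual} =
      {w : V × U | w.1 ∈ {v | (∃ S ∈ d.cls i, ∃ X ∈ S, x ∈ X ∧ v ∈ X) ∧ v ∉ K ∙ x}} := by
    ext w
    simp only [Set.mem_ofPred_eq]
    constructor
    · rintro ⟨hw, hB | hB⟩
      · obtain ⟨l, hl⟩ := Set.mem_iUnion.1 hB
        have hul : u ∈ K ∙ d.dir l := by
          rw [← d.vertical_dir hl]
          exact Submodule.mem_sup_left huT
        obtain rfl := hiu l hul
        have hsB := shadow_sup_span T w
        rw [← hx] at hsB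
        obtain ⟨-, -, S, hS, hBS⟩ := id hl
        have hd := d.finrank_shadow_dir hl
        rw [hsB] at hBS hd
        refine ⟨⟨S, hS, _, hBS, ?_, ?_⟩, ?_⟩
        · exact Submodule.mem_sup_left (Submodule.mem_span_singleton_self x)
        · exact Submodule.mem_sup_right (Submodule.mem_span_singleton_self w.1)
        · intro hmem
          rw [sup_eq_left.2 (by simpa using hmem), finrank_span_singleton hx0] at hd
          omega
      · have huB : (0, u) ∈ T ⊔ K ∙ w := Submodule.mem_sup_left huT
        exact absurd (eq_of_fst_eq (d.finrank_shadow_D hB) huB (Submodule.zero_mem _)) hu0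
    · rintro ⟨⟨S, hS, X, hX, hxX, hwX⟩, hwx⟩
      have hwT : w ∉ T := fun h => hwx (hx ▸ fst_mem_shadow h)
      refine ⟨hwT, Or.inl (Set.mem_iUnion.2 ⟨i, ?_, Submodule.mem_sup_left hiT, S, hS, ?_⟩)⟩
      · rw [Submodule.finrank_sup_span_singleton hwT, hT]
      · rwa [shadow_sup_span, ← hx, eq_sup_span_singleton (by simpa using hxX) hwX hwx
          (by rw [(d.spread_cls i S hS).1 X hX, finrank_span_singleton hx0])]
  rw [hset, ncard_fst_mem d.finrank_U, d.ncard_class_vectors i hx0]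
  rw [Nat.mul_sub, Nat.sub_mul, Nat.mul_sub]
  ring_nf

/-- As `T` is not derived, its pair `Z` lies in exactly one part, matched with exactly one `Y` above
the shadow. The blocks above `T` are then all `T ⊔ K ∙ w` with `w.1` in `Y` outside the shadow. -/
theorem ncard_residual_of_shadow_mem_A {T : Submodule K (V × U)} (hT : finrank K T = 2)
    (hs : finrank K (shadow T) = 2) (hA : shadow T ∈ d.A) (hder : T ∉ d.derived) :
    {B ∈ d.residual | T ≤ B}.ncard = Fintype.card K ^ 2 := by
  obtain ⟨Z, hZ⟩ := d.exists_extends hs le_rfl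
  have hZC : Z ∉ d.code := fun h => hder (Or.inr ⟨hT, hA, Z, h, hZ⟩)
  obtain ⟨j, hj⟩ := (d.mem_part_iff Z).2 hZC
  obtain ⟨Y, ⟨hY, hXY⟩, rfl⟩ := (d.bijOn_index _ hA).surjOn (Set.mem_univ j)
  refine ncard_above_eq_of_ncard (d.ncard_above_residual hT subset_rfl) ?_
  have hset : {w | w ∉ T ∧ T ⊔ K ∙ w ∈ d.residual} = {w : V × U | w.1 ∈ (Y : Set V) \ shadow T} := by
    ext w
    simp only [Set.mem_ofPred_eq, Set.mem_sdiff, SetLike.mem_coe]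
    constructor
    · rintro ⟨hw, hB | hB⟩
      · obtain ⟨i, hi⟩ := Set.mem_iUnion.1 hB
        rw [d.shadow_eq_of_le_dir hi le_sup_left hs] at hA
        exact absurd hA (d.shadow_notMem_A hi)
      · have hinj := d.finrank_shadow_D hB
        have hTB : shadow T ≤ shadow (T ⊔ K ∙ w) := Submodule.map_mono le_sup_left
        obtain ⟨-, h3, X, hX, hXB, Z', hZ', hZB⟩ := hB
        obtain rfl := d.spread_A.eq_of_le hX hA h3 hXB hTB
        obtain rfl := d.extends_unique hinj hZB
          ⟨Submodule.mem_sup_left hZ.1, Submodule.mem_sup_left hZ.2⟩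
        have hidx := d.part_unique _ _ _ hZ' hj
        have hYB := (d.bijOn_index _ hA).injOn ⟨h3, hTB⟩ ⟨hY, hXY⟩ hidx
        refine ⟨?_, fun hmem => ?_⟩
        · rw [← hYB]
          exact fst_mem_shadow (Submodule.mem_sup_right (Submodule.mem_span_singleton_self w))
        · rw [shadow_sup_span, sup_eq_left.2 (by simpa using hmem), hs] at h3
          omega
    · rintro ⟨hwY, hwX⟩
      have hwT : w ∉ T := fun h => hwX (fst_mem_shadow h)
      have hYB : shadow (T ⊔ K ∙ w) = Y := by
        rw [shadow_sup_span]
        exact eq_sup_span_singleton hXY hwY hwX (by rw [hY, hs])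
      refine ⟨hwT, Or.inr ⟨?_, ?_, shadow T, hA, ?_, Z, ?_, ?_⟩⟩
      · rw [Submodule.finrank_sup_span_singleton hwT, hT]
      · rw [hYB, hY]
      · rwa [hYB]
      · rwa [hYB]
      · exact ⟨Submodule.mem_sup_left hZ.1, Submodule.mem_sup_left hZ.2⟩
  rw [hset, ncard_fst_mem d.finrank_U, ncard_sdiff_submodule hXY, hY, hs, mul_comm]

theorem ncard_code : (d.code : Set (U × U)).ncard = Fintype.card K ^ 2 := by
  rw [← ncard_univ_of_finrank_two d.finrank_U]
  refine Set.ncard_congr (fun Z _ => Z.1) (fun _ _ => Set.mem_univ _) ?_ ?_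
  · intro Z Z' hZ hZ' h
    exact (d.code_eval 1 0 (Or.inl one_ne_zero) Z.1).unique ⟨hZ, by simp⟩ ⟨hZ', by simpa using h.symm⟩
  · intro u _
    obtain ⟨Z, ⟨hZ, h⟩, -⟩ := d.code_eval 1 0 (Or.inl one_ne_zero) u
    exact ⟨Z, hZ, by simpa using h⟩

/-- The pairs `(a z, b z)` form the kernel of `(Z₁, Z₂) ↦ b Z₁ - a Z₂`, and this map is bijective
from the code onto `U`. Hence the kernel is a complement of the code. -/
theorem existsUnique_sub_mem_code (D : U × U) {a b : K} (hab : a ≠ 0 ∨ b ≠ 0) :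
    ∃! z : U, D - (a • z, b • z) ∈ d.code := by
  have hab' : b ≠ 0 ∨ -a ≠ 0 := by
    rcases hab with h | h
    · exact Or.inr (neg_ne_zero.2 h)
    · exact Or.inl h
  -- The codeword `E` with the same image as `D`; the difference `D - E` lies in the kernel.
  obtain ⟨E, ⟨hE, hev⟩, hu⟩ := d.code_eval b (-a) hab' (b • D.1 + (-a) • D.2)
  have key : ∃ z : U, D - E = (a • z, b • z) := by
    have h1 : b • (D.1 - E.1) = a • (D.2 - E.2) := by
      have h2 : b • (D.1 - E.1) - a • (D.2 - E.2) =
          (b • D.1 + (-a) • D.2) - (b • E.1 + (-a) • E.2) := by module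
      rw [← sub_eq_zero, h2, hev, sub_self]
    by_cases ha : a = 0
    · subst ha
      have hb : b ≠ 0 := by simpa using hab
      refine ⟨b⁻¹ • (D.2 - E.2), Prod.ext ?_ ?_⟩
      · simpa [hb] using h1
      · simp [smul_smul, hb]
    · refine ⟨a⁻¹ • (D.1 - E.1), Prod.ext ?_ ?_⟩
      · simp [smul_smul, ha]
      · simp only [Prod.snd_sub]
        rw [smul_comm, h1, smul_smul, inv_mul_cancel₀ ha, one_smul]
  obtain ⟨z, hz⟩ := key
  refine ⟨z, by simpa [← hz] using hE, fun z' hz' => ?_⟩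
  have h3 := hu _ ⟨hz', by simp only [Prod.fst_sub, Prod.snd_sub]; module⟩
  have h4 : (a • z', b • z') = (a • z, b • z) := by
    rw [← hz, ← h3]
    simp
  rw [Prod.mk.injEq] at h4
  rcases hab with h | h
  · exact smul_right_injective U h h4.1
  · exact smul_right_injective U h h4.2

/-- Each part meets every transversal `Z + (a z, b z)` of the cosets in `q - 1` elements. -/
theorem ncard_transversal_part (j : J) (Z : U × U) {a b : K} (hab : a ≠ 0 ∨ b ≠ 0) :
    {z : U | Z + (a • z, b • z) ∈ d.part j}.ncard = Fintype.card K - 1 := by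
  have h : {z : U | Z + (a • z, b • z) ∈ d.part j}.ncard * Fintype.card K ^ 2 =
      (d.part j).ncard * 1 := by
    -- Each element of the part lies in the coset of exactly one point of the transversal, and each
    -- such coset has `q^2` elements, all in the part.
    refine ncard_mul_eq_ncard_mul _ _ (fun z Y => Y - Z - (a • z, b • z) ∈ d.code) ?_ ?_
    · intro z hz
      rw [← d.ncard_code]
      refine Set.ncard_congr (fun Y _ => Y - Z - (a • z, b • z)) (fun Y hY => hY.2) ?_ ?_
      · intro Y Y' _ _ h
        simpa using h
      · intro c hc
        refine ⟨Z + (a • z, b • z) + c, ⟨d.part_add j _ hz c hc, ?_⟩, ?_⟩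
        · simpa [add_sub_cancel_left, sub_sub] using hc
        · simp [sub_sub]
    · intro Y hY
      obtain ⟨z, hz, hu⟩ := d.existsUnique_sub_mem_code (Y - Z) hab
      refine ncard_eq_one_of_existsUnique ⟨z, ⟨?_, hz⟩, fun z' hz' => hu z' hz'.2⟩
      have := d.part_add j Y hY _ (d.code.neg_mem hz)
      rw [Set.mem_ofPred_eq]
      convert this using 1
      abel
  rw [d.ncard_part, mul_one, mul_comm] at h
  exact Nat.eq_of_mul_eq_mul_left (by have := two_le_card (K := K); positivity) h

/-- The `3`-space `Y = shadow T ⊔ ⟨y⟩` contains a unique `X ∈ A`, different from the shadow of `T`.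
The graph `T ⊔ ⟨(y, z)⟩` restricts to `X` as a fixed pair plus `(a z, b z)`, where `a, b` are the
`y`-coefficients of the basis of `X`. As `z` varies, this runs through a transversal of the cosets
of the code. -/
theorem ncard_extensions_blocksD {T : Submodule K (V × U)} (hT : finrank K T = 2)
    (hs : finrank K (shadow T) = 2) (hA : shadow T ∉ d.A) {y : V} (hy : y ∉ shadow T) :
    {z : U | T ⊔ K ∙ (y, z) ∈ d.blocksD}.ncard = Fintype.card K - 1 := by
  have hY3 : finrank K (shadow T ⊔ K ∙ y : Submodule K V) = 3 := by
    rw [Submodule.finrank_sup_span_singleton hy, hs]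
  obtain ⟨X, hX, hXY⟩ := d.spread_A.exists_le d.finrank_V hY3
  have hX2 := d.spread_A.1 X hX
  have hdec : ∀ v ∈ X, ∃ (c : K) (g : U), (v - c • y, g) ∈ T := by
    intro v hv
    obtain ⟨x, hx, t, ht, rfl⟩ := Submodule.mem_sup.1 (hXY hv)
    obtain ⟨c, rfl⟩ := Submodule.mem_span_singleton.1 ht
    obtain ⟨⟨x', g⟩, hg, rfl : x' = x⟩ := hx
    exact ⟨c, g, by simpa using hg⟩
  obtain ⟨a, g, hg⟩ := hdec _ (d.b₀_mem hX2)
  obtain ⟨b, g', hg'⟩ := hdec _ (d.b₁_mem hX2)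
  -- If both `y`-coefficients vanished, `X` would lie in the shadow of `T`, hence equal it.
  have hab : a ≠ 0 ∨ b ≠ 0 := by
    by_contra! h
    rw [h.1, zero_smul, sub_zero] at hg
    rw [h.2, zero_smul, sub_zero] at hg'
    have hle := d.le_of_basis_mem hX2 (fst_mem_shadow hg) (fst_mem_shadow hg')
    exact hA (Submodule.eq_of_le_of_finrank_le hle (by rw [hs, hX2]) ▸ hX)
  rw [← d.ncard_transversal_part (d.index (shadow T ⊔ K ∙ y)) (g, g') hab]
  congr 1
  ext z
  have hsh : shadow (T ⊔ K ∙ (y, z)) = shadow T ⊔ K ∙ y := shadow_sup_span _ _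
  have hext : d.Extends X ((g, g') + (a • z, b • z)) (T ⊔ K ∙ (y, z)) := by
    have hz : (y, z) ∈ T ⊔ K ∙ (y, z) :=
      Submodule.mem_sup_right (Submodule.mem_span_singleton_self _)
    have h0 := Submodule.add_mem _ (Submodule.mem_sup_left (T := K ∙ (y, z)) hg)
      (Submodule.smul_mem _ a hz)
    have h1 := Submodule.add_mem _ (Submodule.mem_sup_left (T := K ∙ (y, z)) hg')
      (Submodule.smul_mem _ b hz)
    exact ⟨by simpa using h0, by simpa using h1⟩
  have hzT : (y, z) ∉ T := fun h => hy (fst_mem_shadow h)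
  simp only [Set.mem_ofPred_eq]
  constructor
  · intro hB
    have hinj := d.finrank_shadow_D hB
    obtain ⟨-, h3, X', hX', hXB, Z, hZ, hZB⟩ := hB
    obtain rfl := d.spread_A.eq_of_le hX' hX h3 hXB (by rwa [hsh])
    rw [d.extends_unique hinj hext hZB, ← hsh]
    exact hZ
  · intro hz
    refine ⟨?_, ?_, X, hX, ?_, _, ?_, hext⟩
    · rw [Submodule.finrank_sup_span_singleton hzT, hT]
    · rw [hsh, hY3]
    · rwa [hsh]
    · rwa [hsh]

/-- There are `q^4 - q^2` choices of `y` and `q - 1` of `z`, and each block is counted `q^3 - q^2`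
times. -/
theorem ncard_blocksD_above {T : Submodule K (V × U)} (hT : finrank K T = 2)
    (hs : finrank K (shadow T) = 2) (hA : shadow T ∉ d.A) :
    {B ∈ d.blocksD | T ≤ B}.ncard = (Fintype.card K + 1) * (Fintype.card K - 1) := by
  have h := d.ncard_above_residual hT (R := d.blocksD) Set.subset_union_right
  have h1 : (((⊤ : Submodule K V) : Set V) \ shadow T).ncard * (Fintype.card K - 1) =
      {w | w ∉ T ∧ T ⊔ K ∙ w ∈ d.blocksD}.ncard * 1 := by
    refine ncard_mul_eq_ncard_mul _ _ (fun v w => w.1 = v) ?_ ?_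
    · rintro y ⟨-, hy⟩
      rw [← d.ncard_extensions_blocksD hT hs hA hy]
      refine Set.ncard_congr (fun w _ => w.2) ?_ ?_ ?_
      · rintro ⟨x, z⟩ ⟨⟨-, hw⟩, rfl : x = y⟩
        exact hw
      · rintro ⟨x, z⟩ ⟨x', z'⟩ ⟨-, rfl : x = y⟩ ⟨-, hx : x' = x⟩ h
        exact Prod.ext hx.symm h
      · intro z hz
        exact ⟨(y, z), ⟨⟨fun h => hy (fst_mem_shadow h), hz⟩, rfl⟩, rfl⟩
    · rintro w ⟨hw, hB⟩
      refine ncard_eq_one_of_existsUnique ⟨w.1, ⟨⟨Set.mem_univ _, fun hmem => ?_⟩, rfl⟩,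
        fun v hv => hv.2.symm⟩
      have h3 := hB.2.1
      rw [shadow_sup_span, sup_eq_left.2 (by simpa using hmem), hs] at h3
      omega
  rw [mul_one, ncard_sdiff_submodule le_top, finrank_top, d.finrank_V, hs] at h1
  refine Nat.eq_of_mul_eq_mul_right (pow_succ_sub_pow_pos _ 2 two_le_card) (h.trans ?_)
  rw [← h1]
  have h2 := two_le_card (K := K)
  generalize Fintype.card K = q at *
  have e0 : 1 ≤ q := by omega
  have e1 : q ^ 2 ≤ q ^ 3 := Nat.pow_le_pow_right e0 (by omega)
  have e2 : q ^ 2 ≤ q ^ 4 := Nat.pow_le_pow_right e0 (by omega)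
  zify [e0, e1, e2]
  ring

/-- The shadow lies in one spread of one class `i`, so the only direction block above `T` is `T ⊔
⟨(0, dir i)⟩`. Adding the members of `blocksD` gives `1 + (q + 1)(q - 1)`. -/
theorem ncard_residual_of_shadow_notMem_A {T : Submodule K (V × U)} (hT : finrank K T = 2)
    (hs : finrank K (shadow T) = 2) (hA : shadow T ∉ d.A) :
    {B ∈ d.residual | T ≤ B}.ncard = Fintype.card K ^ 2 := by
  obtain ⟨i, S, hS, hTS⟩ := d.covered _ hs hA
  have hnot : (0, d.dir i) ∉ T := fun h =>
    d.dir_ne i (eq_of_fst_eq (by rw [hs, hT]) h T.zero_mem)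
  have hset : {B ∈ d.residual | T ≤ B} =
      insert (T ⊔ K ∙ (0, d.dir i)) {B ∈ d.blocksD | T ≤ B} := by
    ext B
    simp only [Set.mem_ofPred_eq, Set.mem_insert_iff]
    constructor
    · rintro ⟨hB | hB, hTB⟩
      · obtain ⟨l, hl⟩ := Set.mem_iUnion.1 hB
        obtain ⟨h3, hlB, S', hS', hBS'⟩ := id hl
        rw [← d.shadow_eq_of_le_dir hl hTB hs] at hBS'
        obtain ⟨rfl, -⟩ := d.unique_cls _ _ _ hS _ hS' _ hTS hBS'
        exact Or.inl (eq_sup_span_singleton hTB hlB hnot (by rw [h3, hT])).symm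
      · exact Or.inr ⟨hB, hTB⟩
    · rintro (rfl | ⟨hB, hTB⟩)
      · refine ⟨Or.inl (Set.mem_iUnion.2 ⟨i, ?_, ?_, S, hS, ?_⟩), le_sup_left⟩
        · rw [Submodule.finrank_sup_span_singleton hnot, hT]
        · exact Submodule.mem_sup_right (Submodule.mem_span_singleton_self _)
        · rw [shadow_sup_span]
          simpa using hTS
      · exact ⟨Or.inr hB, hTB⟩
  rw [hset, Set.ncard_insert_of_notMem, d.ncard_blocksD_above hT hs hA]
  · obtain ⟨k, hk⟩ : ∃ k, Fintype.card K = k + 1 :=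
      ⟨_, (Nat.sub_add_cancel (by have := two_le_card (K := K); omega)).symm⟩
    rw [hk, Nat.add_sub_cancel]
    ring
  · rintro ⟨hB, -⟩
    exact d.dir_ne i (eq_of_fst_eq (d.finrank_shadow_D hB)
      (Submodule.mem_sup_right (Submodule.mem_span_singleton_self _)) (Submodule.zero_mem _))

theorem ncard_residual_above {T : Submodule K (V × U)} (hT : finrank K T = 2)
    (hder : T ∉ d.derived) :
    {B ∈ d.residual | T ≤ B}.ncard = Fintype.card K ^ 2 := by
  have h := finrank_shadow_add T
  obtain hs | hs | hs : finrank K (shadow T) = 0 ∨ finrank K (shadow T) = 1 ∨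
    finrank K (shadow T) = 2 := by omega
  · refine absurd (Or.inl ?_) hder
    refine Submodule.eq_of_le_of_finrank_le (fun w hw => ⟨?_, Submodule.mem_top⟩)
      (by rw [finrank_prod_bot_top d.finrank_U, hT])
    have h0 := fst_mem_shadow hw
    rwa [Submodule.finrank_eq_zero.1 hs] at h0
  · exact d.ncard_residual_of_shadow_one hT hs
  · by_cases hA : shadow T ∈ d.A
    · exact d.ncard_residual_of_shadow_mem_A hT hs hA hder
    · exact d.ncard_residual_of_shadow_notMem_A hT hs hA

/-! ### The total number of blocks -/

theorem ncard_residual_mul :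
    (d.residual.ncard : ℚ) * (Fintype.card K ^ 2 + Fintype.card K + 1) =
      ({T : Submodule K (V × U) | finrank K T = 2 ∧ T ≤ ⊤}.ncard - d.derived.ncard : ℚ) *
        Fintype.card K ^ 2 := by
  have hsub : d.derived ⊆ {T : Submodule K (V × U) | finrank K T = 2 ∧ T ≤ ⊤} :=
    fun W hW => ⟨d.derived_spread.1 W hW, le_top⟩
  have h : d.residual.ncard * (Fintype.card K ^ 2 + Fintype.card K + 1) =
      ({T : Submodule K (V × U) | finrank K T = 2 ∧ T ≤ ⊤} \ d.derived).ncard *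
        Fintype.card K ^ 2 := by
    -- Each block has `q^2 + q + 1` subspaces of dimension `2`, none of them derived; each
    -- non-derived one lies in `q^2` blocks.
    refine ncard_mul_eq_ncard_mul _ _ (fun B T => T ≤ B) ?_ ?_
    · intro B hB
      have h3 := ncard_lines_le B (by rw [d.finrank_residual hB]; omega)
      rw [d.finrank_residual hB] at h3
      have hset : {T ∈ {T : Submodule K (V × U) | finrank K T = 2 ∧ T ≤ ⊤} \ d.derived | T ≤ B} =
          {T : Submodule K (V × U) | finrank K T = 2 ∧ T ≤ B} := by
        ext T
        exact ⟨fun h => ⟨h.1.1.1, h.2⟩, fun h => ⟨⟨⟨h.1, le_top⟩,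
          fun hT => d.not_le_residual h.1 hT le_rfl hB h.2⟩, h.2⟩⟩
      rw [hset]
      have h2 := two_le_card (K := K)
      generalize Fintype.card K = q at *
      have e1 : 1 ≤ q ^ 2 := Nat.one_le_pow _ _ (by omega)
      have e2 : q ≤ q ^ 2 := Nat.le_self_pow (by norm_num) q
      have e3 : 1 ≤ q ^ 3 := Nat.one_le_pow _ _ (by omega)
      have e4 : q ≤ q ^ 3 := Nat.le_self_pow (by norm_num) q
      zify [e1, e2, e3, e4] at h3 ⊢
      have h2' : (2 : ℤ) ≤ q := by exact_mod_cast h2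
      have hne : ((q : ℤ) ^ 2 - 1) * ((q : ℤ) ^ 2 - q) ≠ 0 := by
        have : (0 : ℤ) < (q : ℤ) ^ 2 - q := by nlinarith
        have : (0 : ℤ) < (q : ℤ) ^ 2 - 1 := by nlinarith
        positivity
      refine mul_right_cancel₀ hne ?_
      linear_combination h3
    · rintro T ⟨⟨hT, -⟩, hder⟩
      exact d.ncard_residual_above hT hder
  rw [Set.ncard_sdiff hsub] at h
  have hle := Set.ncard_le_ncard hsub (Set.toFinite _)
  rw [← Nat.cast_sub hle]
  exact_mod_cast h

theorem ncard_blocks :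
    ((d.derived ∪ d.residual).ncard : ℚ) =
      qBinom (Fintype.card K) 7 2 / qBinom (Fintype.card K) 3 2 := by
  have hdim : finrank K (V × U) = 6 := by rw [finrank_prod, d.finrank_V, d.finrank_U]
  have h6 := ncard_lines_le (⊤ : Submodule K (V × U)) (by rw [finrank_top, hdim]; omega)
  have hder := d.derived_spread.ncard_mul
  have hres := d.ncard_residual_mul
  rw [finrank_top, hdim] at h6
  rw [hdim] at hder
  have hdisj : Disjoint d.derived d.residual := by
    rw [Set.disjoint_left]
    intro B hB hB'
    have := d.derived_spread.1 B hB
    have := d.finrank_residual hB'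
    omega
  rw [Set.ncard_union_eq hdisj (Set.toFinite _) (Set.toFinite _)]
  have h2 := two_le_card (K := K)
  simp only [qBinom, Finset.prod_range_succ, Finset.prod_range_zero]
  generalize Fintype.card K = q at *
  have e1 : 1 ≤ q ^ 2 := Nat.one_le_pow _ _ (by omega)
  have e2 : q ≤ q ^ 2 := Nat.le_self_pow (by norm_num) q
  have e3 : 1 ≤ q ^ 6 := Nat.one_le_pow _ _ (by omega)
  have e4 : q ≤ q ^ 6 := Nat.le_self_pow (by norm_num) q
  have h6' := congrArg (Nat.cast : ℕ → ℚ) h6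
  have hder' := congrArg (Nat.cast : ℕ → ℚ) hder
  push_cast [e1, e2, e3, e4] at h6' hder' ⊢
  have h2' : (2 : ℚ) ≤ q := by exact_mod_cast h2
  generalize (q : ℚ) = x at *
  have n1 : x - 1 ≠ 0 := by linarith
  have n2 : x ^ 2 - 1 ≠ 0 := by nlinarith
  have n3 : x ^ 3 - 1 ≠ 0 := by
    have : x ^ 3 - 1 = (x - 1) * (x ^ 2 + x + 1) := by ring
    rw [this]
    exact mul_ne_zero n1 (by nlinarith)
  have n4 : x ^ 2 + x + 1 ≠ 0 := by nlinarith
  have n5 : x ^ 2 - x ≠ 0 := by nlinarith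
  have n6 : x ≠ 0 := by linarith
  rw [← eq_div_iff n2] at hder'
  rw [← eq_div_iff (mul_ne_zero n2 n5)] at h6'
  rw [← eq_div_iff n4] at hres
  rw [hres, h6', hder']
  norm_num
  rw [show x ^ 2 - x = x * (x - 1) by ring]
  field_simp
  ring

end ConstructionData

/-! ### Transport along a linear equivalence -/

section
variable {K E E' : Type*} [Field K] [AddCommGroup E] [Module K E] [AddCommGroup E'] [Module K E']

theorem finrank_map_equiv (e : E ≃ₗ[K] E') (W : Submodule K E) :
    finrank K (W.map (e : E →ₗ[K] E')) = finrank K W :=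
  LinearEquiv.finrank_map_eq e W

theorem map_equiv_injective (e : E ≃ₗ[K] E') :
    Function.Injective (Submodule.map (e : E →ₗ[K] E')) :=
  Submodule.map_injective_of_injective e.injective

theorem map_comap_equiv (e : E ≃ₗ[K] E') (W : Submodule K E') :
    (W.comap (e : E →ₗ[K] E')).map (e : E →ₗ[K] E') = W :=
  Submodule.map_comap_eq_of_surjective e.surjective W

theorem IsLineSpread.map {S : Set (Submodule K E)} (hS : IsLineSpread S) (e : E ≃ₗ[K] E') :
    IsLineSpread (Submodule.map (e : E →ₗ[K] E') '' S) := by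
  refine ⟨?_, fun x hx => ?_⟩
  · rintro _ ⟨W, hW, rfl⟩
    rw [finrank_map_equiv, hS.1 W hW]
  · obtain ⟨W, ⟨hW, hxW⟩, hu⟩ := hS.2 (e.symm x) (by simpa using hx)
    refine ⟨_, ⟨⟨W, hW, rfl⟩, e.symm x, hxW, by simp⟩, ?_⟩
    rintro _ ⟨⟨W', hW', rfl⟩, y, hy, rfl⟩
    rw [hu W' ⟨hW', by simpa using hy⟩]

theorem IsLineParallelism.map {P : Set (Set (Submodule K E))} (hP : IsLineParallelism P)
    (e : E ≃ₗ[K] E') :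
    IsLineParallelism ((fun S => Submodule.map (e : E →ₗ[K] E') '' S) '' P) := by
  refine ⟨?_, fun W hW => ?_⟩
  · rintro _ ⟨S, hS, rfl⟩
    exact (hP.1 S hS).map e
  · obtain ⟨S, ⟨hS, hWS⟩, hu⟩ := hP.2 (W.comap (e : E →ₗ[K] E'))
      (by rw [← finrank_map_equiv e, map_comap_equiv, hW])
    refine ⟨_, ⟨⟨S, hS, rfl⟩, _, hWS, map_comap_equiv e W⟩, ?_⟩
    rintro _ ⟨⟨S', hS', rfl⟩, W', hW', rfl⟩
    rw [hu S' ⟨hS', by rwa [Submodule.comap_map_eq_of_injective e.injective]⟩]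

end

/-! ### Representing matrices -/

section
variable {F : Type*} [Field F] [Fintype F]

/-- The matrix with columns `v₀, v₁` and `α^(i-2) v₀ + v₁`. -/
def lineMatrix (α : Fˣ) {r : ℕ} (v₀ v₁ : Fin r → F) :
    Matrix (Fin r) (Fin (Fintype.card F + 1)) F :=
  fun a i => if (i : ℕ) = 0 then v₀ a else if (i : ℕ) = 1 then v₁ a else
    (α : F) ^ ((i : ℕ) - 2) * v₀ a + v₁ a

theorem val_one_card : ((1 : Fin (Fintype.card F + 1)) : ℕ) = 1 := by
  have h : 1 < Fintype.card F := Fintype.one_lt_card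
  rw [Fin.val_one']
  exact Nat.mod_eq_of_lt (by omega)

theorem lineMatrix_col_zero (α : Fˣ) {r : ℕ} (v₀ v₁ : Fin r → F) :
    (lineMatrix α v₀ v₁).col 0 = v₀ := by
  ext a
  simp [lineMatrix]

theorem lineMatrix_col_one (α : Fˣ) {r : ℕ} (v₀ v₁ : Fin r → F) :
    (lineMatrix α v₀ v₁).col 1 = v₁ := by
  ext a
  simp [lineMatrix]

theorem lineMatrix_col_of_le (α : Fˣ) {r : ℕ} (v₀ v₁ : Fin r → F)
    {i : Fin (Fintype.card F + 1)} (hi : 2 ≤ (i : ℕ)) :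
    (lineMatrix α v₀ v₁).col i = (α : F) ^ ((i : ℕ) - 2) • v₀ + v₁ := by
  ext a
  simp [lineMatrix, show (i : ℕ) ≠ 0 by omega, show (i : ℕ) ≠ 1 by omega]

theorem hasLineColumns_lineMatrix (α : Fˣ) {r : ℕ} (v₀ v₁ : Fin r → F) :
    HasLineColumns α (lineMatrix α v₀ v₁) := by
  intro i hi
  rw [lineMatrix_col_of_le α v₀ v₁ hi, lineMatrix_col_zero, lineMatrix_col_one]

theorem HasLineColumns.eq_lineMatrix {α : Fˣ} {r : ℕ}
    {M : Matrix (Fin r) (Fin (Fintype.card F + 1)) F} (h : HasLineColumns α M) :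
    M = lineMatrix α (M.col 0) (M.col 1) := by
  suffices H : ∀ i, M.col i = (lineMatrix α (M.col 0) (M.col 1)).col i by
    ext a i
    exact congrFun (H i) a
  intro i
  obtain hi | hi | hi : (i : ℕ) = 0 ∨ (i : ℕ) = 1 ∨ 2 ≤ (i : ℕ) := by omega
  · obtain rfl : i = 0 := Fin.ext hi
    rw [lineMatrix_col_zero]
  · obtain rfl : i = 1 := Fin.ext (by rw [hi, val_one_card])
    rw [lineMatrix_col_one]
  · rw [lineMatrix_col_of_le _ _ _ hi, h i hi]

/-- The coefficients that express the `i`-th column in terms of the first two. -/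
theorem exists_col_eq (α : Fˣ) (i : Fin (Fintype.card F + 1)) : ∃ a b : F, ∀ (r : ℕ)
    (M : Matrix (Fin r) (Fin (Fintype.card F + 1)) F), HasLineColumns α M →
      M.col i = a • M.col 0 + b • M.col 1 := by
  obtain hi | hi | hi : (i : ℕ) = 0 ∨ (i : ℕ) = 1 ∨ 2 ≤ (i : ℕ) := by omega
  · obtain rfl : i = 0 := Fin.ext hi
    exact ⟨1, 0, fun r M _ => by simp⟩
  · obtain rfl : i = 1 := Fin.ext (by rw [hi, val_one_card])
    exact ⟨0, 1, fun r M _ => by simp⟩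
  · exact ⟨(α : F) ^ ((i : ℕ) - 2), 1, fun r M h => by rw [h i hi, one_smul]⟩

/-- Each nonzero combination of the first two columns is proportional to some column. -/
theorem exists_smul_col_eq {α : Fˣ} (hα : ∀ x : Fˣ, x ∈ Subgroup.zpowers α) {a b : F}
    (hab : a ≠ 0 ∨ b ≠ 0) : ∃ (i : Fin (Fintype.card F + 1)) (c : F), c ≠ 0 ∧ ∀ (r : ℕ)
    (M : Matrix (Fin r) (Fin (Fintype.card F + 1)) F), HasLineColumns α M →
      a • M.col 0 + b • M.col 1 = c • M.col i := by
  by_cases hb : b = 0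
  · exact ⟨0, a, by simpa [hb] using hab, fun r M _ => by simp [hb]⟩
  by_cases ha : a = 0
  · exact ⟨1, b, hb, fun r M _ => by simp [ha]⟩
  -- Write `a v₀ + b v₁ = b ((a / b) v₀ + v₁)` and `a / b = α ^ k`. Since `k ≤ q - 2`, there is a
  -- column `k + 2`.
  obtain ⟨k, hk, hkα⟩ : ∃ k < orderOf α, α ^ k = Units.mk0 (a / b) (div_ne_zero ha hb) := by
    have h := hα (Units.mk0 (a / b) (div_ne_zero ha hb))
    classical
    rw [mem_zpowers_iff_mem_range_orderOf] at h
    simpa using h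
  have hord : orderOf α ≤ Fintype.card F - 1 := by
    classical
    rw [← Fintype.card_units]
    exact orderOf_le_card_univ
  refine ⟨⟨k + 2, by omega⟩, b, hb, fun r M h => ?_⟩
  have hval := congrArg (Units.val) hkα
  rw [Units.val_pow_eq_pow_val, Units.val_mk0] at hval
  have hcol := h ⟨k + 2, by omega⟩ (by simp)
  simp only [Nat.add_sub_cancel, hval] at hcol
  rw [hcol, smul_add, smul_smul, mul_div_cancel₀ _ hb]

theorem exists_smul_isNormalized {n : ℕ} {x : Fin n → F} (hx : x ≠ 0) :
    ∃ c : F, c ≠ 0 ∧ IsNormalized (c • x) := by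
  classical
  have hne : (Finset.univ.filter fun i => x i ≠ 0).Nonempty := by
    obtain ⟨i, hi⟩ := Function.ne_iff.1 hx
    exact ⟨i, by simpa using hi⟩
  have hmin := Finset.min'_mem _ hne
  rw [Finset.mem_filter] at hmin
  refine ⟨(x (Finset.min' _ hne))⁻¹, inv_ne_zero hmin.2, Finset.min' _ hne, ?_, ?_⟩
  · simp [hmin.2]
  · intro j hj
    by_contra h
    have hxj : x j ≠ 0 := by
      intro h0
      simp [h0] at h
    exact absurd (Finset.min'_le _ j (by simpa using hxj)) (not_le.2 hj)

theorem IsNormalized.ne_zero {n : ℕ} {x : Fin n → F} (h : IsNormalized x) : x ≠ 0 := by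
  rintro rfl
  obtain ⟨i, hi, -⟩ := h
  simp at hi

theorem IsNormalized.eq_of_mem_span {n : ℕ} {x y : Fin n → F} (hx : IsNormalized x)
    (hy : IsNormalized y) (h : y ∈ F ∙ x) : y = x := by
  obtain ⟨c, rfl⟩ := Submodule.mem_span_singleton.1 h
  obtain ⟨i, hi, hi'⟩ := hx
  obtain ⟨j, hj, hj'⟩ := hy
  have hc : c ≠ 0 := by
    rintro rfl
    simp at hj
  rcases lt_trichotomy i j with hij | rfl | hij
  · have := hj' i hij
    simp [hi, hc] at this
  · have : c = 1 := by simpa [hi] using hj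
    rw [this, one_smul]
  · simp [hi' j hij] at hj

variable [LinearOrder F]

theorem exists_isLexLeast {n : ℕ} {s : Set (Fin n → F)} (hs : s.Nonempty) :
    ∃ v, IsLexLeast s v := by
  obtain ⟨v, hv, h⟩ := Set.exists_min_image s toLex (Set.toFinite s) hs
  exact ⟨v, hv, h⟩

theorem IsLexLeast.eq {n : ℕ} {s : Set (Fin n → F)} {v w : Fin n → F} (hv : IsLexLeast s v)
    (hw : IsLexLeast s w) : v = w :=
  toLex.injective (le_antisymm (hv.2 w hw.1) (hw.2 v hv.1))

theorem exists_represents (α : Fˣ) {X : Submodule F (Fin 4 → F)} (hX : finrank F X = 2) :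
    ∃ M, Represents α X M := by
  have hnorm : ∀ x ∈ X, x ≠ 0 → ∃ y ∈ X, IsNormalized y ∧ F ∙ x = F ∙ y := by
    intro x hx hx0
    obtain ⟨c, hc, hn⟩ := exists_smul_isNormalized hx0
    exact ⟨c • x, X.smul_mem c hx, hn, (Submodule.span_singleton_smul_eq (IsUnit.mk0 c hc) x).symm⟩
  have h0 : {x | x ∈ X ∧ IsNormalized x}.Nonempty := by
    have hb : X ≠ ⊥ := by
      rintro rfl
      rw [finrank_bot] at hX
      omega
    obtain ⟨x, hx, hx0⟩ := Submodule.exists_mem_ne_zero_of_ne_bot hb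
    obtain ⟨y, hy, hyn, -⟩ := hnorm x hx hx0
    exact ⟨y, hy, hyn⟩
  obtain ⟨v₀, hv₀⟩ := exists_isLexLeast h0
  have h1 : {x | x ∈ X ∧ IsNormalized x ∧ x ≠ v₀}.Nonempty := by
    have hlt : F ∙ v₀ < X := by
      refine lt_of_le_of_ne (by simpa using hv₀.1.1) fun h => ?_
      rw [← h, finrank_span_singleton hv₀.1.2.ne_zero] at hX
      omega
    obtain ⟨x, hx, hxv⟩ := SetLike.exists_of_lt hlt
    have hx0 : x ≠ 0 := by
      rintro rfl
      exact hxv (Submodule.zero_mem _)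
    obtain ⟨y, hy, hyn, hs⟩ := hnorm x hx hx0
    refine ⟨y, hy, hyn, ?_⟩
    rintro rfl
    exact hxv (hs ▸ Submodule.mem_span_singleton_self x)
  obtain ⟨v₁, hv₁⟩ := exists_isLexLeast h1
  refine ⟨lineMatrix α v₀ v₁, ?_, ?_, hasLineColumns_lineMatrix α v₀ v₁⟩
  · rwa [lineMatrix_col_zero]
  · rwa [lineMatrix_col_zero, lineMatrix_col_one]

/-- Lexicographic minima are unique and the first two columns determine the rest. Hence any
representing matrix may be replaced by a fixed chosen one. -/
theorem Represents.eq {α : Fˣ} {X : Submodule F (Fin 4 → F)}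
    {M N : Matrix (Fin 4) (Fin (Fintype.card F + 1)) F} (hM : Represents α X M)
    (hN : Represents α X N) : M = N := by
  have h0 := hM.1.eq hN.1
  have h1 := hM.2.1
  rw [h0] at h1
  rw [hM.2.2.eq_lineMatrix, hN.2.2.eq_lineMatrix, h0, h1.eq hN.2.1]

/-- Distinct normalized vectors are never proportional, so the first two columns are independent. -/
theorem Represents.span_eq {α : Fˣ} {X : Submodule F (Fin 4 → F)} (hX : finrank F X = 2)
    {M : Matrix (Fin 4) (Fin (Fintype.card F + 1)) F} (hM : Represents α X M) :
    Submodule.span F {M.col 0, M.col 1} = X := by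
  rw [Submodule.span_insert]
  refine eq_sup_span_singleton (by simpa using hM.1.1.1) hM.2.1.1.1 (fun h => ?_) ?_
  · exact hM.2.1.1.2.2 (hM.1.1.2.eq_of_mem_span hM.2.1.1.2.1 h)
  · rw [hX, finrank_span_singleton hM.1.1.2.ne_zero]

end

/-! ### Column spans -/

section
variable {F : Type*} [Field F] [Fintype F]

/-- Vectors of length six as pairs of vectors of lengths four and two. -/
def appendEquiv (F : Type*) [Field F] : ((Fin 4 → F) × (Fin 2 → F)) ≃ₗ[F] (Fin 6 → F) where
  toFun p := (Fin.append p.1 p.2 : Fin (4 + 2) → F)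
  invFun w := (fun i => w (Fin.castAdd 2 i), fun i => w (Fin.natAdd 4 i))
  map_add' p p' := by
    funext i
    refine Fin.addCases (m := 4) (n := 2) (fun j => ?_) (fun j => ?_) i <;>
      simp [Fin.append_left, Fin.append_right]
  map_smul' c p := by
    funext i
    refine Fin.addCases (m := 4) (n := 2) (fun j => ?_) (fun j => ?_) i <;>
      simp [Fin.append_left, Fin.append_right]
  left_inv p := by
    refine Prod.ext (funext fun i => ?_) (funext fun i => ?_)
    · exact Fin.append_left p.1 p.2 i
    · exact Fin.append_right p.1 p.2 i
  right_inv w := by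
    funext i
    refine Fin.addCases (m := 4) (n := 2) (fun j => ?_) (fun j => ?_) i
    · exact Fin.append_left _ _ j
    · exact Fin.append_right _ _ j

theorem stack_col {ι : Type*} (M : Matrix (Fin 4) ι F) (Z : Matrix (Fin 2) ι F) (c : ι) :
    (stack M Z).col c = appendEquiv F (M.col c, Z.col c) := rfl

/-- Each column is the same combination of the first two in `M` as in `Z`, so the first two stacked
columns suffice. -/
theorem colSpan_stack {α : Fˣ} {M : Matrix (Fin 4) (Fin (Fintype.card F + 1)) F}
    {Z : Matrix (Fin 2) (Fin (Fintype.card F + 1)) F} (hM : HasLineColumns α M)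
    (hZ : HasLineColumns α Z) :
    colSpan (stack M Z) = (Submodule.span F {(M.col 0, Z.col 0), (M.col 1, Z.col 1)}).map
      (appendEquiv F : _ →ₗ[F] (Fin 6 → F)) := by
  apply le_antisymm
  · rw [colSpan, Submodule.span_le]
    rintro _ ⟨c, rfl⟩
    rw [stack_col]
    refine Submodule.mem_map_of_mem ?_
    obtain ⟨a, b, h⟩ := exists_col_eq α c
    rw [h 4 M hM, h 2 Z hZ]
    exact Submodule.mem_span_pair.2 ⟨a, b, by simp⟩
  · rw [Submodule.map_span, Set.image_pair, Submodule.span_le]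
    rintro _ (rfl | rfl)
    · exact Submodule.subset_span ⟨0, stack_col M Z 0⟩
    · exact Submodule.subset_span ⟨1, stack_col M Z 1⟩

theorem colSpan_expand (α : Fˣ) {r : ℕ} (M : Matrix (Fin r) (Fin (Fintype.card F + 1)) F)
    (u : Fin r → F) : colSpan (expand α M u) = colSpan M ⊔ F ∙ u := by
  have hu : u ∈ colSpan M ⊔ F ∙ u := Submodule.mem_sup_right (Submodule.mem_span_singleton_self u)
  have hM : ∀ j, M.col j ∈ colSpan M ⊔ F ∙ u := fun j =>
    Submodule.mem_sup_left (Submodule.subset_span ⟨j, rfl⟩)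
  apply le_antisymm
  · rw [colSpan, Submodule.span_le]
    rintro _ ⟨j | _ | ⟨i, j⟩, rfl⟩
    · exact hM j
    · exact hu
    · exact Submodule.add_mem _ (Submodule.smul_mem _ ((α : F) ^ (i : ℕ)) hu) (hM j)
  · refine sup_le ?_ ?_
    · rw [colSpan, Submodule.span_le]
      rintro _ ⟨j, rfl⟩
      exact Submodule.subset_span ⟨.inl j, rfl⟩
    · rw [Submodule.span_singleton_le_iff_mem]
      exact Submodule.subset_span ⟨.inr (.inl ()), rfl⟩

theorem stack_expand (α : Fˣ) (M : Matrix (Fin 4) (Fin (Fintype.card F + 1)) F)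
    (Z : Matrix (Fin 2) (Fin (Fintype.card F + 1)) F) (u : Fin 4 → F) (v : Fin 2 → F) :
    stack (expand α M u) (expand α Z v) = expand α (stack M Z) (appendEquiv F (u, v)) := by
  suffices H : ∀ c, (stack (expand α M u) (expand α Z v)).col c =
      (expand α (stack M Z) (appendEquiv F (u, v))).col c by
    ext a c
    exact congrFun (H c) a
  intro c
  obtain j | _ | ⟨i, j⟩ := c
  · rfl
  · rfl
  · have h := map_add (appendEquiv F) ((α : F) ^ (i : ℕ) • (u, v)) (M.col j, Z.col j)
    rw [map_smul] at h
    exact h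

end

/-! ### The blocks as spans -/

namespace ConstructionData
variable {K V U ι J : Type*} [Field K] [Fintype K] [AddCommGroup V] [Module K V] [Finite V]
  [AddCommGroup U] [Module K U] [Finite U] (d : ConstructionData K V U ι J)

theorem mem_blocksA_iff {W : Submodule K (V × U)} :
    W ∈ d.blocksA ↔ ∃ X ∈ d.A, ∃ Z ∈ d.code, W = d.graph X Z := by
  constructor
  · rintro ⟨hW, hA, Z, hZ, hZW⟩
    exact ⟨_, hA, Z, hZ, (Submodule.eq_of_le_of_finrank_le (d.graph_le_iff.2 hZW)
      (by rw [hW, d.finrank_graph (d.spread_A.1 _ hA)])).symm⟩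
  · rintro ⟨X, hX, Z, hZ, rfl⟩
    have hX2 := d.spread_A.1 X hX
    refine ⟨d.finrank_graph hX2 Z, ?_, Z, hZ, ?_⟩
    · rwa [d.shadow_graph hX2]
    · rw [d.shadow_graph hX2]
      exact d.graph_extends X Z

/-- The extensions of a `2`-subspace may be restricted to a set `N` of representatives modulo the
direction. -/
theorem mem_blocksDir_iff {i : ι} {N : Set U} (hN : ∀ u, ∃ c : K, u - c • d.dir i ∈ N)
    {W : Submodule K (V × U)} :
    W ∈ d.blocksDir i ↔ ∃ S ∈ d.cls i, ∃ X ∈ S, ∃ Z : U × U, Z.1 ∈ N ∧ Z.2 ∈ N ∧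
      W = d.graph X Z ⊔ K ∙ (0, d.dir i) := by
  have hdir : ∀ {X : Submodule K V}, finrank K X = 2 → ∀ Z, (0, d.dir i) ∉ d.graph X Z :=
    fun {X} hX Z h => d.dir_ne i (eq_of_fst_eq
      (by rw [d.shadow_graph hX, hX, d.finrank_graph hX]) h (Submodule.zero_mem _))
  constructor
  · rintro ⟨hW, hdW, S, hS, hWS⟩
    have hX := (d.spread_cls i S hS).1 _ hWS
    obtain ⟨Z, hZ⟩ := d.exists_extends hX (le_refl (shadow W))
    obtain ⟨a, ha⟩ := hN Z.1
    obtain ⟨b, hb⟩ := hN Z.2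
    refine ⟨S, hS, _, hWS, (Z.1 - a • d.dir i, Z.2 - b • d.dir i), ha, hb, ?_⟩
    have hext : d.Extends (shadow W) (Z.1 - a • d.dir i, Z.2 - b • d.dir i) W := by
      have h0 := W.sub_mem hZ.1 (W.smul_mem a hdW)
      have h1 := W.sub_mem hZ.2 (W.smul_mem b hdW)
      exact ⟨by simpa using h0, by simpa using h1⟩
    exact (eq_sup_span_singleton (d.graph_le_iff.2 hext) hdW (hdir hX _)
      (by rw [hW, d.finrank_graph hX])).symm
  · rintro ⟨S, hS, X, hX, Z, -, -, rfl⟩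
    have hX2 := (d.spread_cls i S hS).1 X hX
    refine ⟨?_, Submodule.mem_sup_right (Submodule.mem_span_singleton_self _), S, hS, ?_⟩
    · rw [Submodule.finrank_sup_span_singleton (hdir hX2 Z), d.finrank_graph hX2]
    · rw [shadow_sup_span, d.shadow_graph hX2]
      simpa using hX

theorem graph_sup_mem_blocksD {Y X : Submodule K V} (hY : finrank K Y = 3) (hX : X ∈ d.A)
    (hXY : X ≤ Y) {u : V} (hu : u ∈ Y) (huX : u ∉ X) {Z : U × U} (hZ : Z ∈ d.part (d.index Y))
    (v : U) : d.graph X Z ⊔ K ∙ (u, v) ∈ d.blocksD := by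
  have hX2 := d.spread_A.1 X hX
  have hsh : shadow (d.graph X Z ⊔ K ∙ (u, v)) = Y := by
    rw [shadow_sup_span, d.shadow_graph hX2]
    exact eq_sup_span_singleton hXY hu huX (by rw [hY, hX2])
  refine ⟨?_, by rw [hsh, hY], X, hX, by rwa [hsh], Z, by rwa [hsh], ?_⟩
  · rw [Submodule.finrank_sup_span_singleton, d.finrank_graph hX2]
    intro h
    have := fst_mem_shadow h
    rw [d.shadow_graph hX2] at this
    exact huX this
  · exact ⟨Submodule.mem_sup_left (d.graph_extends X Z).1,
      Submodule.mem_sup_left (d.graph_extends X Z).2⟩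

/-- The vector `u` in `Y` outside `X` is arbitrary, so the lexicographic choice of `u` in the
construction does not affect the set of blocks. -/
theorem exists_of_mem_blocksD {W : Submodule K (V × U)} (hW : W ∈ d.blocksD) :
    ∃ Y : Submodule K V, finrank K Y = 3 ∧ ∃ X ∈ d.A, X ≤ Y ∧ ∃ Z ∈ d.part (d.index Y),
      ∀ u ∈ Y, u ∉ X → ∃ v, W = d.graph X Z ⊔ K ∙ (u, v) := by
  obtain ⟨h3, hY, X, hX, hXY, Z, hZ, hZW⟩ := hW
  have hX2 := d.spread_A.1 X hX
  refine ⟨_, hY, X, hX, hXY, Z, hZ, fun u hu huX => ?_⟩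
  obtain ⟨⟨u', v⟩, hv, rfl : u' = u⟩ := hu
  refine ⟨v, (eq_sup_span_singleton (d.graph_le_iff.2 hZW) hv (fun h => ?_)
    (by rw [h3, d.finrank_graph hX2])).symm⟩
  have := fst_mem_shadow h
  rw [d.shadow_graph hX2] at this
  exact huX this

end ConstructionData

/-! ### The data given by the choices -/

section
variable {F : Type*} [Field F] [Fintype F]

/-- The first two columns of a `2 × (q+1)` matrix. -/
def colPair : Matrix (Fin 2) (Fin (Fintype.card F + 1)) F →ₗ[F] (Fin 2 → F) × (Fin 2 → F) where
  toFun Z := (Z.col 0, Z.col 1)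
  map_add' _ _ := rfl
  map_smul' _ _ := rfl

theorem colPair_apply (Z : Matrix (Fin 2) (Fin (Fintype.card F + 1)) F) :
    colPair Z = (Z.col 0, Z.col 1) := rfl

theorem colPair_lineMatrix (α : Fˣ) (p : (Fin 2 → F) × (Fin 2 → F)) :
    colPair (lineMatrix α p.1 p.2) = p := by
  rw [colPair_apply, lineMatrix_col_zero, lineMatrix_col_one]

theorem lineMatrix_mem (α : Fˣ) (v₀ v₁ : Fin 2 → F) :
    lineMatrix α v₀ v₁ ∈ extensionSpace F α :=
  hasLineColumns_lineMatrix α v₀ v₁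

theorem colPair_injOn (α : Fˣ) : Set.InjOn (colPair (F := F)) (extensionSpace F α) := by
  intro Z hZ Z' hZ' h
  rw [colPair_apply, colPair_apply, Prod.mk.injEq] at h
  rw [HasLineColumns.eq_lineMatrix hZ, HasLineColumns.eq_lineMatrix hZ', h.1, h.2]

/-- The directions in `F^2`: `e₂`, and `e₁ + ξ e₂` for `ξ ∈ F`. -/
def direction : Option F → Fin 2 → F
  | none => ![0, 1]
  | some ξ => ![1, ξ]

theorem direction_ne (i : Option F) : direction i ≠ 0 := by
  cases i with
  | none => exact fun h => one_ne_zero (congrFun h 1)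
  | some ξ => exact fun h => one_ne_zero (congrFun h 0)

theorem direction_unique (u : Fin 2 → F) (hu : u ≠ 0) : ∃! i, u ∈ F ∙ direction i := by
  simp only [Submodule.mem_span_singleton]
  by_cases h0 : u 0 = 0
  · refine ⟨none, ⟨u 1, ?_⟩, ?_⟩
    · ext k
      fin_cases k <;> simp [direction, h0]
    · rintro (_ | ξ) ⟨c, hc⟩
      · rfl
      · have h1 := congrFun hc 0
        simp only [direction, Pi.smul_apply, Matrix.cons_val_zero, smul_eq_mul, mul_one, h0] at h1
        rw [h1, zero_smul] at hc
        exact absurd hc.symm hu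
  · refine ⟨some (u 1 / u 0), ⟨u 0, ?_⟩, ?_⟩
    · ext k
      fin_cases k
      · simp [direction]
      · simp [direction, mul_div_cancel₀ _ h0]
    · rintro (_ | ξ) ⟨c, hc⟩
      · have h1 := congrFun hc 0
        simp only [direction, Pi.smul_apply, Matrix.cons_val_zero, smul_zero] at h1
        exact absurd h1.symm h0
      · have h1 := congrFun hc 0
        have h2 := congrFun hc 1
        simp only [direction, Pi.smul_apply, Matrix.cons_val_zero, Matrix.cons_val_one, smul_eq_mul,
          mul_one] at h1 h2
        rw [← h2, ← h1, mul_div_cancel_left₀ _ (by rwa [h1])]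

theorem setS0_eq : setS0 F =
    Submodule.map (appendEquiv F : (Fin 4 → F) × (Fin 2 → F) →ₗ[F] (Fin 6 → F)) ''
      {W | W = (⊥ : Submodule F (Fin 4 → F)).prod ⊤} := by
  have h0 : (((⊥ : Submodule F (Fin 4 → F)).prod ⊤).map
      (appendEquiv F : (Fin 4 → F) × (Fin 2 → F) →ₗ[F] (Fin 6 → F))) ∈ setS0 F := by
    intro x
    constructor
    · rintro ⟨⟨v, u⟩, ⟨hv, -⟩, rfl⟩ i hi
      obtain rfl : v = 0 := hv
      exact Fin.append_left (0 : Fin 4 → F) u ⟨i, hi⟩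
    · intro h
      refine ⟨(appendEquiv F).symm x, ⟨?_, Submodule.mem_top⟩, by simp⟩
      exact funext fun i => h (Fin.castAdd 2 i) i.2
  ext W
  constructor
  · intro hW
    refine ⟨_, rfl, ?_⟩
    ext x
    rw [h0 x, hW x]
  · rintro ⟨_, rfl, rfl⟩
    exact h0

variable [LinearOrder F] {α : Fˣ}

open Classical in
/-- The matrix representing a `2`-subspace of `F^4`. -/
noncomputable def repMatrix (α : Fˣ) (X : Submodule F (Fin 4 → F)) :
    Matrix (Fin 4) (Fin (Fintype.card F + 1)) F :=
  if hX : finrank F X = 2 then (exists_represents α hX).choose else 0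

theorem repMatrix_spec (α : Fˣ) {X : Submodule F (Fin 4 → F)} (hX : finrank F X = 2) :
    Represents α X (repMatrix α X) := by
  rw [repMatrix, dif_pos hX]
  exact (exists_represents α hX).choose_spec

namespace Choices
variable (d : Choices F α)

/-- The classes `ℬ` and `𝒞_ξ`. -/
def classOf : Option F → Set (Set (Submodule F (Fin 4 → F)))
  | none => d.spreadsB
  | some ξ => d.spreadsC ξ

theorem mem_parallelism_of_class {i : Option F} {S} (hS : S ∈ d.classOf i) :
    S ∈ {d.spreadA} ∪ d.spreadsB ∪ ⋃ ξ, d.spreadsC ξ := by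
  cases i with
  | none => exact Or.inl (Or.inr hS)
  | some ξ => exact Or.inr (Set.mem_iUnion.2 ⟨ξ, hS⟩)

theorem spreadA_notMem_class (i : Option F) : d.spreadA ∉ d.classOf i := by
  cases i with
  | none => exact d.spreadA_notMem_B
  | some ξ => exact d.spreadA_notMem_C ξ

theorem class_unique {i j : Option F} {S} (hi : S ∈ d.classOf i) (hj : S ∈ d.classOf j) :
    i = j := by
  match i, j with
  | none, none => rfl
  | none, some ξ => exact absurd hj (Set.disjoint_left.1 (d.disjoint_B_C ξ) hi)
  | some ξ, none => exact absurd hi (Set.disjoint_left.1 (d.disjoint_B_C ξ) hj)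
  | some ξ, some η =>
    by_contra h
    exact Set.disjoint_left.1 (d.disjoint_C ξ η fun h' => h (congrArg some h')) hi hj

theorem part_subset {j} {Z} (hZ : Z ∈ d.part j) :
    Z ∈ extensionSpace F α ∧ Z ∉ d.code := by
  have h : Z ∈ ⋃ j, d.part j := Set.mem_iUnion.2 ⟨j, hZ⟩
  rw [d.iUnion_part] at h
  exact h

/-- The coordinate-free data of the construction. -/
noncomputable def toData (hα : ∀ x : Fˣ, x ∈ Subgroup.zpowers α) :
    ConstructionData F (Fin 4 → F) (Fin 2 → F) (Option F) (Fin (Fintype.card F + 1)) where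
  finrank_V := by simp
  finrank_U := by simp
  A := d.spreadA
  spread_A := d.parallelism.1 _ (Or.inl (Or.inl rfl))
  dir := direction
  dir_ne := direction_ne
  dir_unique := direction_unique
  cls := d.classOf
  spread_cls := fun i S hS => d.parallelism.1 S (d.mem_parallelism_of_class hS)
  ncard_cls := fun i => by
    cases i with
    | none => exact d.ncard_B
    | some ξ => exact d.ncard_C ξ
  covered := fun X hX hXA => by
    obtain ⟨S, ⟨(rfl | hS) | hS, hXS⟩, -⟩ := d.parallelism.2 X hX
    · exact absurd hXS hXA
    · exact ⟨none, S, hS, hXS⟩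
    · obtain ⟨ξ, hξ⟩ := Set.mem_iUnion.1 hS
      exact ⟨some ξ, S, hξ, hXS⟩
  notMem_A := fun i S hS X hX hXA => by
    have hmem := d.mem_parallelism_of_class hS
    have := (d.parallelism.2 X ((d.parallelism.1 S hmem).1 X hX)).unique ⟨hmem, hX⟩
      ⟨Or.inl (Or.inl rfl), hXA⟩
    subst this
    exact d.spreadA_notMem_class i hS
  unique_cls := fun i j S hS S' hS' X hX hX' => by
    have hmem := d.mem_parallelism_of_class hS
    have := (d.parallelism.2 X ((d.parallelism.1 S hmem).1 X hX)).unique ⟨hmem, hX⟩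
      ⟨d.mem_parallelism_of_class hS', hX'⟩
    subst this
    exact ⟨d.class_unique hS hS', rfl⟩
  b₀ := fun X => (repMatrix α X).col 0
  b₁ := fun X => (repMatrix α X).col 1
  span_basis := fun X hX => (repMatrix_spec α hX).span_eq hX
  code := d.code.map colPair
  code_eval := fun a b hab u => by
    -- Here primitivity of `α` is needed: every nonzero combination of the first two columns is
    -- proportional to one column, with the same index and factor for all codewords, and on that
    -- column the code is bijective.
    obtain ⟨i, c, hc, h⟩ := exists_smul_col_eq hα hab
    obtain ⟨hext, -, hbij⟩ := d.isExtensionCode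
    obtain ⟨Z, hZ, hZi : Z.col i = c⁻¹ • u⟩ := (hbij i).surjOn (Set.mem_univ (c⁻¹ • u))
    refine ⟨colPair Z, ⟨⟨Z, hZ, rfl⟩, ?_⟩, ?_⟩
    · rw [colPair_apply, h 2 Z (hext hZ), hZi, smul_smul, mul_inv_cancel₀ hc, one_smul]
    · rintro _ ⟨⟨Z', hZ', rfl⟩, hu⟩
      rw [colPair_apply, h 2 Z' (hext hZ')] at hu
      have : Z'.col i = Z.col i := by
        rw [hZi, ← hu, smul_smul, inv_mul_cancel₀ hc, one_smul]
      rw [(hbij i).injOn hZ' hZ this]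
  part := fun j => colPair '' d.part j
  mem_part_iff := fun p => by
    have hp := lineMatrix_mem α p.1 p.2
    constructor
    · rintro ⟨j, Z, hZ, rfl⟩ ⟨Z', hZ', h⟩
      have := colPair_injOn α (d.isExtensionCode.1 hZ') (d.part_subset hZ).1 h
      subst this
      exact (d.part_subset hZ).2 hZ'
    · intro h
      have hmem : lineMatrix α p.1 p.2 ∈ ⋃ j, d.part j := by
        rw [d.iUnion_part]
        exact ⟨hp, fun hc => h ⟨_, hc, colPair_lineMatrix α p⟩⟩
      obtain ⟨j, hj⟩ := Set.mem_iUnion.1 hmem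
      exact ⟨j, _, hj, colPair_lineMatrix α p⟩
  part_unique := by
    rintro i j _ ⟨Z, hZ, rfl⟩ ⟨Z', hZ', h⟩
    have := colPair_injOn α (d.part_subset hZ').1 (d.part_subset hZ).1 h
    subst this
    by_contra hij
    exact Set.disjoint_left.1 (d.disjoint_part i j hij) hZ hZ'
  part_add := by
    rintro j _ ⟨Z, hZ, rfl⟩ _ ⟨c, hc, rfl⟩
    exact ⟨Z + c, d.part_add j Z hZ c hc, map_add _ _ _⟩
  ncard_part := fun j => by
    rw [((colPair_injOn α).mono fun Z hZ => (d.part_subset hZ).1).ncard_image]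
    exact d.ncard_part j
  index := d.index
  bijOn_index := d.bijOn_index

/-! ### The matrix blocks as images of the coordinate-free blocks -/

variable (hα : ∀ x : Fˣ, x ∈ Subgroup.zpowers α)

theorem colSpan_stack_repMatrix {X : Submodule F (Fin 4 → F)} (hX : finrank F X = 2)
    {Z : Matrix (Fin 2) (Fin (Fintype.card F + 1)) F} (hZ : Z ∈ extensionSpace F α) :
    colSpan (stack (repMatrix α X) Z) =
      ((d.toData hα).graph X (colPair Z)).map (appendEquiv F : _ →ₗ[F] (Fin 6 → F)) :=
  colSpan_stack (repMatrix_spec α hX).2.2 hZ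

theorem setSA_eq :
    setSA d = Submodule.map (appendEquiv F : _ →ₗ[F] (Fin 6 → F)) '' (d.toData hα).blocksA := by
  ext W
  constructor
  · rintro ⟨X, hX, M, hM, Z, hZ, rfl⟩
    have hX2 : finrank F X = 2 := (d.toData hα).spread_A.1 X hX
    rw [hM.eq (repMatrix_spec α hX2), d.colSpan_stack_repMatrix hα hX2 (d.isExtensionCode.1 hZ)]
    exact ⟨_, (d.toData hα).mem_blocksA_iff.2 ⟨X, hX, colPair Z, ⟨Z, hZ, rfl⟩, rfl⟩, rfl⟩
  · rintro ⟨W, hW, rfl⟩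
    obtain ⟨X, hX, _, ⟨Z, hZ, rfl⟩, rfl⟩ := (d.toData hα).mem_blocksA_iff.1 hW
    have hX2 : finrank F X = 2 := (d.toData hα).spread_A.1 X hX
    exact ⟨X, hX, _, repMatrix_spec α hX2, Z, hZ,
      (d.colSpan_stack_repMatrix hα hX2 (d.isExtensionCode.1 hZ)).symm⟩

/-- The common form of `setSB` and `setSCxi`: the classes of blocks with a given direction, where the
extending matrices have zeroes in the row `k`. -/
theorem directionBlocks_eq (i : Option F) (k : Fin 2) (hk : direction i (1 - k) = 1)
    (e : Fin 6 → F) (he : e = appendEquiv F (0, direction i)) :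
    {W | ∃ S ∈ d.classOf i, ∃ X ∈ S, ∃ M, Represents α X M ∧
      ∃ Z ∈ extensionSpace F α, (∀ j, Z (1 - k) j = 0) ∧ W = colSpan (expand α (stack M Z) e)} =
    Submodule.map (appendEquiv F : _ →ₗ[F] (Fin 6 → F)) '' (d.toData hα).blocksDir i := by
  -- The row required to vanish is row `1 - k`. The direction has entry `1` there, so a multiple of
  -- it clears that entry of any vector, and these extensions represent all extensions modulo the
  -- direction.
  have hN : ∀ u : Fin 2 → F, ∃ c : F, u - c • (d.toData hα).dir i ∈ {u : Fin 2 → F | u (1 - k) = 0} := by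
    intro u
    refine ⟨u (1 - k), ?_⟩
    show u (1 - k) - u (1 - k) * direction i (1 - k) = 0
    rw [hk, mul_one, sub_self]
  have hspan : ∀ X : Submodule F (Fin 4 → F), finrank F X = 2 → ∀ Z ∈ extensionSpace F α,
      colSpan (expand α (stack (repMatrix α X) Z) e) =
        ((d.toData hα).graph X (colPair Z) ⊔ F ∙ (0, direction i)).map
          (appendEquiv F : _ →ₗ[F] (Fin 6 → F)) := by
    intro X hX Z hZ
    rw [colSpan_expand, d.colSpan_stack_repMatrix hα hX hZ, Submodule.map_sup, Submodule.map_span,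
      Set.image_singleton, he]
    rfl
  ext W
  constructor
  · rintro ⟨S, hS, X, hX, M, hM, Z, hZ, hZ0, rfl⟩
    have hX2 : finrank F X = 2 := ((d.toData hα).spread_cls i S hS).1 X hX
    rw [hM.eq (repMatrix_spec α hX2), hspan X hX2 Z hZ]
    exact ⟨_, ((d.toData hα).mem_blocksDir_iff hN).2
      ⟨S, hS, X, hX, colPair Z, hZ0 0, hZ0 1, rfl⟩, rfl⟩
  · rintro ⟨W, hW, rfl⟩
    obtain ⟨S, hS, X, hX, Z, h0, h1, rfl⟩ := ((d.toData hα).mem_blocksDir_iff hN).1 hW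
    have hX2 : finrank F X = 2 := ((d.toData hα).spread_cls i S hS).1 X hX
    refine ⟨S, hS, X, hX, _, repMatrix_spec α hX2, lineMatrix α Z.1 Z.2, lineMatrix_mem α _ _,
      fun j => ?_, ?_⟩
    · rw [Set.mem_ofPred_eq] at h0 h1
      simp [lineMatrix, h0, h1]
    · rw [hspan X hX2 _ (lineMatrix_mem α _ _), colPair_lineMatrix]
      rfl

theorem setSB_eq :
    setSB d =
      Submodule.map (appendEquiv F : _ →ₗ[F] (Fin 6 → F)) '' (d.toData hα).blocksDir none := by
  rw [← d.directionBlocks_eq hα none 0 rfl ![0, 0, 0, 0, 0, 1]]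
  · rfl
  · funext i
    fin_cases i <;> rfl

theorem setSCxi_eq (ξ : F) :
    setSCxi d ξ =
      Submodule.map (appendEquiv F : _ →ₗ[F] (Fin 6 → F)) '' (d.toData hα).blocksDir (some ξ) := by
  rw [← d.directionBlocks_eq hα (some ξ) 1 rfl ![0, 0, 0, 0, 1, ξ]]
  · rfl
  · funext i
    fin_cases i <;> rfl

theorem setSD_eq :
    setSD d = Submodule.map (appendEquiv F : _ →ₗ[F] (Fin 6 → F)) '' (d.toData hα).blocksD := by
  have hspan : ∀ X : Submodule F (Fin 4 → F), finrank F X = 2 → ∀ Z ∈ extensionSpace F α, ∀ u v,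
      colSpan (stack (expand α (repMatrix α X) u) (expand α Z v)) =
        ((d.toData hα).graph X (colPair Z) ⊔ F ∙ (u, v)).map
          (appendEquiv F : _ →ₗ[F] (Fin 6 → F)) := by
    intro X hX Z hZ u v
    rw [stack_expand, colSpan_expand, d.colSpan_stack_repMatrix hα hX hZ, Submodule.map_sup,
      Submodule.map_span, Set.image_singleton]
    rfl
  ext W
  constructor
  · rintro ⟨Y, hY, X, hX, hXY, M, hM, u, hu, Z, hZ, v, rfl⟩
    have hX2 : finrank F X = 2 := (d.toData hα).spread_A.1 X hX
    rw [hM.eq (repMatrix_spec α hX2), hspan X hX2 Z (d.part_subset hZ).1]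
    exact ⟨_, (d.toData hα).graph_sup_mem_blocksD hY hX hXY hu.1.1 hu.1.2.1 ⟨Z, hZ, rfl⟩ v, rfl⟩
  · rintro ⟨W, hW, rfl⟩
    obtain ⟨Y, hY, X, hX, hXY, _, ⟨Z, hZ, rfl⟩, h⟩ := (d.toData hα).exists_of_mem_blocksD hW
    have hX2 : finrank F X = 2 := (d.toData hα).spread_A.1 X hX
    have hne : {x | x ∈ Y ∧ x ∉ X ∧ IsNormalized x}.Nonempty := by
      have hlt : X < Y := lt_of_le_of_ne hXY (by rintro rfl; omega)
      obtain ⟨x, hx, hxX⟩ := SetLike.exists_of_lt hlt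
      have hx0 : x ≠ 0 := by
        rintro rfl
        exact hxX X.zero_mem
      obtain ⟨c, hc, hn⟩ := exists_smul_isNormalized hx0
      exact ⟨c • x, Y.smul_mem c hx, fun h => hxX ((X.smul_mem_iff hc).1 h), hn⟩
    obtain ⟨u, hu⟩ := exists_isLexLeast hne
    obtain ⟨v, rfl⟩ := h u hu.1.1 hu.1.2.1
    exact ⟨Y, hY, X, hX, hXY, _, repMatrix_spec α hX2, u, hu, Z, hZ, v,
      (hspan X hX2 Z (d.part_subset hZ).1 u v).symm⟩

theorem derived_eq : setS0 F ∪ setSA d =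
    Submodule.map (appendEquiv F : _ →ₗ[F] (Fin 6 → F)) '' (d.toData hα).derived := by
  rw [setS0_eq, d.setSA_eq hα, ← Set.image_union]
  rfl

theorem residual_eq : setSB d ∪ setSC d ∪ setSD d =
    Submodule.map (appendEquiv F : _ →ₗ[F] (Fin 6 → F)) '' (d.toData hα).residual := by
  rw [setSC, d.setSB_eq hα, d.setSD_eq hα, ConstructionData.residual, Set.image_union,
    Set.image_iUnion]
  simp_rw [d.setSCxi_eq hα]
  -- The index type `Option F` splits into the direction `e₂` of `ℬ` and the directions `e₁ + ξ e₂`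
  -- of the classes `𝒞_ξ`.
  congr 1
  exact (Set.iUnion_option fun i =>
    Submodule.map (appendEquiv F : _ →ₗ[F] (Fin 6 → F)) '' (d.toData hα).blocksDir i).symm

theorem isSpread_derived (hα : ∀ x : Fˣ, x ∈ Subgroup.zpowers α) :
    IsSpread (setS0 F ∪ setSA d) := by
  rw [d.derived_eq hα]
  exact (d.toData hα).derived_spread.map (appendEquiv F)

theorem isDerivedQFano (hα : ∀ x : Fˣ, x ∈ Subgroup.zpowers α) :
    IsDerivedQFano F (setS0 F ∪ setSA d) := by
  have h := d.isSpread_derived hα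
  refine ⟨h.1, fun T hT => ?_⟩
  obtain ⟨x, hx, rfl⟩ := exists_eq_span_singleton hT
  simp only [Submodule.span_singleton_le_iff_mem]
  exact ncard_eq_one_of_existsUnique (h.2 x hx)

theorem isResidualQFano (hα : ∀ x : Fˣ, x ∈ Subgroup.zpowers α) :
    IsResidualQFano F (setS0 F ∪ setSA d) (setSB d ∪ setSC d ∪ setSD d) := by
  refine ⟨d.isDerivedQFano hα, ?_⟩
  rw [d.derived_eq hα, d.residual_eq hα]
  refine ⟨?_, ?_, ?_⟩
  · rintro _ ⟨B, hB, rfl⟩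
    rw [finrank_map_equiv, (d.toData hα).finrank_residual hB]
  · intro T hT hder
    obtain ⟨T, rfl⟩ : ∃ T', T = Submodule.map
        (appendEquiv F : (Fin 4 → F) × (Fin 2 → F) →ₗ[F] (Fin 6 → F)) T' :=
      ⟨_, (map_comap_equiv (appendEquiv F) T).symm⟩
    rw [finrank_map_equiv] at hT
    have hder' : T ∉ (d.toData hα).derived := fun h => hder ⟨_, ⟨T, h, rfl⟩, le_rfl⟩
    rw [← (d.toData hα).ncard_residual_above hT hder',
      ← Set.ncard_image_of_injective _ (map_equiv_injective (appendEquiv F))]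
    congr 1
    ext B
    constructor
    · rintro ⟨⟨B, hB, rfl⟩, hTB⟩
      exact ⟨B, ⟨hB, (Submodule.map_le_map_iff_of_injective (appendEquiv F).injective _ _).1 hTB⟩,
        rfl⟩
    · rintro ⟨B, ⟨hB, hTB⟩, rfl⟩
      exact ⟨⟨B, hB, rfl⟩, Submodule.map_mono hTB⟩
  · rintro T hT ⟨_, ⟨D, hD, rfl⟩, hTD⟩ _ ⟨B, hB, rfl⟩ hTB
    obtain ⟨T, rfl⟩ : ∃ T', T = Submodule.map
        (appendEquiv F : (Fin 4 → F) × (Fin 2 → F) →ₗ[F] (Fin 6 → F)) T' :=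
      ⟨_, (map_comap_equiv (appendEquiv F) T).symm⟩
    rw [finrank_map_equiv] at hT
    rw [Submodule.map_le_map_iff_of_injective (appendEquiv F).injective] at hTD hTB
    exact (d.toData hα).not_le_residual hT hD hTD hB hTB

theorem ncard_blocks (hα : ∀ x : Fˣ, x ∈ Subgroup.zpowers α) :
    (((setS0 F ∪ setSA d) ∪ (setSB d ∪ setSC d ∪ setSD d)).ncard : ℚ) =
      qBinom (Fintype.card F) 7 2 / qBinom (Fintype.card F) 3 2 := by
  rw [d.derived_eq hα, d.residual_eq hα, ← Set.image_union,
    Set.ncard_image_of_injective _ (map_equiv_injective (appendEquiv F))]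
  exact (d.toData hα).ncard_blocks

end Choices
end

/-! ### Quadratic extensions of finite fields -/

section
variable {F K : Type*} [Field F] [Field K] [Algebra F K]

/-- A coordinate `τ` on `K` modulo `F`, with respect to an element `ω` outside `F`. -/
structure QuadraticCoordinate (F K : Type*) [Field F] [Field K] [Algebra F K] where
  ω : K
  τ : K →ₗ[F] F
  τ_algebraMap : ∀ s : F, τ (algebraMap F K s) = 0
  τ_ω : τ ω = 1
  exists_eq : ∀ z : K, ∃ s : F, z = algebraMap F K s + τ z • ω

theorem exists_notMem_range (h2 : finrank F K = 2) : ∃ ω : K, ∀ s : F, algebraMap F K s ≠ ω := by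
  by_contra! h
  have : (⊤ : Submodule F K) = F ∙ (1 : K) := by
    rw [eq_comm, eq_top_iff]
    rintro x -
    obtain ⟨s, rfl⟩ := h x
    exact Submodule.mem_span_singleton.2 ⟨s, (Algebra.algebraMap_eq_smul_one s).symm⟩
  have h1 := congrArg (fun S : Submodule F K => finrank F S) this
  simp only [finrank_top, h2, finrank_span_singleton (one_ne_zero (α := K))] at h1
  omega

theorem exists_quadraticCoordinate (h2 : finrank F K = 2) {ω : K}
    (hω : ∀ s : F, algebraMap F K s ≠ ω) : ∃ c : QuadraticCoordinate F K, c.ω = ω := by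
  have hli : LinearIndependent F ![1, ω] := by
    rw [LinearIndependent.pair_iff' one_ne_zero]
    intro a ha
    exact hω a (by rw [Algebra.algebraMap_eq_smul_one, ha])
  let b := basisOfLinearIndependentOfCardEqFinrank hli (by simp [h2])
  have hb : ⇑b = ![1, ω] := coe_basisOfLinearIndependentOfCardEqFinrank _ _
  have hb0 : b 0 = 1 := congrFun hb 0
  have hb1 : b 1 = ω := congrFun hb 1
  refine ⟨⟨ω, b.coord 1, fun s => ?_, ?_, fun z => ⟨b.coord 0 z, ?_⟩⟩, rfl⟩
  · rw [Algebra.algebraMap_eq_smul_one, ← hb0]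
    simp
  · rw [← hb1]
    simp
  · have h := b.sum_repr z
    rw [Fin.sum_univ_two, hb0, hb1, ← Algebra.algebraMap_eq_smul_one] at h
    exact h.symm

namespace QuadraticCoordinate
variable (c : QuadraticCoordinate F K)

theorem τ_eq_zero_iff (z : K) : c.τ z = 0 ↔ ∃ s : F, z = algebraMap F K s := by
  constructor
  · intro h
    obtain ⟨s, hs⟩ := c.exists_eq z
    exact ⟨s, by rw [hs, h, zero_smul, add_zero]⟩
  · rintro ⟨s, rfl⟩
    exact c.τ_algebraMap s

theorem τ_eq_τ_iff (z w : K) : c.τ z = c.τ w ↔ ∃ s : F, z = w + algebraMap F K s := by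
  rw [← sub_eq_zero, ← map_sub, c.τ_eq_zero_iff]
  simp [sub_eq_iff_eq_add, add_comm]

end QuadraticCoordinate

variable [Fintype F] [Finite K]

/-- The nontrivial automorphism of a quadratic extension. -/
noncomputable abbrev conj (F K : Type*) [Field F] [Field K] [Algebra F K] [Fintype F] [Finite K] :
    K ≃ₐ[F] K := FiniteField.frobeniusAlgEquivOfAlgebraic F K

/-- An element outside `F` fixed by the conjugation would generate `K` together with `1`, so the
conjugation would be trivial, although its order is `2`. -/
theorem conj_apply_eq_iff (h2 : finrank F K = 2) (x : K) :
    conj F K x = x ↔ ∃ s : F, x = algebraMap F K s := by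
  constructor
  · intro h
    by_contra! hx
    obtain ⟨c, rfl⟩ := exists_quadraticCoordinate h2 fun s hs => hx s hs.symm
    have h1 : conj F K = 1 := by
      ext z
      obtain ⟨s, hs⟩ := c.exists_eq z
      rw [hs, map_add, map_smul, h, AlgEquiv.commutes, AlgEquiv.one_apply]
    have hord : orderOf (conj F K) = finrank F K :=
      FiniteField.orderOf_frobeniusAlgEquivOfAlgebraic F K
    rw [h1, orderOf_one, h2] at hord
    omega
  · rintro ⟨s, rfl⟩
    exact AlgEquiv.commutes _ s

/-- The norm is the power with exponent `(q^2 - 1) / (q - 1) = q + 1`, and conjugation is the `q`-th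
power. -/
theorem algebraMap_norm_eq (h2 : finrank F K = 2) (x : K) :
    algebraMap F K (Algebra.norm F x) = x * conj F K x := by
  rw [FiniteField.algebraMap_norm_eq_pow, natCard_eq_pow_finrank (K := F), h2,
    Nat.card_eq_fintype_card, FiniteField.coe_frobeniusAlgEquivOfAlgebraic, ← pow_succ']
  congr 1
  have h := two_le_card (K := F)
  rw [← one_pow 2, Nat.sq_sub_sq, one_pow]
  exact Nat.mul_div_cancel _ (by omega)

/-- A linear map `m x + n x̄` whose values `(m x + n x̄) / x` avoid the base field. -/
theorem exists_ratio_avoiding (h2 : finrank F K = 2) (hF : 2 < Fintype.card F) :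
    ∃ m n : K, n ≠ 0 ∧ ∀ x : K, x ≠ 0 → ∀ s : F, (m * x + n * conj F K x) / x ≠ algebraMap F K s := by
  -- If the ratio equals `s`, then `n x̄ = (s - m) x`, and taking norms gives `N(n) = N(s - m)`. So
  -- a nonzero value `e` missed by `s ↦ N(s - m)` suffices, with `n` of norm `e`.
  suffices H : ∃ (m : K) (e : F), e ≠ 0 ∧ ∀ s : F, Algebra.norm F (algebraMap F K s - m) ≠ e by
    obtain ⟨m, e, he, hme⟩ := H
    obtain ⟨n, rfl⟩ := FiniteField.norm_surjective F K e
    refine ⟨m, n, by rintro rfl; simp at he, fun x hx s hs => hme s ?_⟩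
    rw [div_eq_iff hx] at hs
    have h1 : n * conj F K x = (algebraMap F K s - m) * x := by linear_combination hs
    have h3 := congrArg (Algebra.norm F) h1
    have hc : Algebra.norm F (conj F K x) = Algebra.norm F x := Algebra.norm_eq_of_algEquiv _ x
    rw [map_mul, map_mul, hc] at h3
    exact (mul_right_cancel₀ (by simpa using hx) h3).symm
  by_cases hchar : ringChar F = 2
  · have : CharP F 2 := by
      rw [← hchar]
      exact ringChar.charP F
    have : CharP K 2 := charP_of_injective_algebraMap (algebraMap F K).injective 2
    obtain ⟨ω, hω⟩ := exists_notMem_range h2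
    have hσ : conj F K ω ≠ ω := fun h => by
      obtain ⟨s, hs⟩ := (conj_apply_eq_iff h2 ω).1 h
      exact hω s hs.symm
    have hinv : conj F K (conj F K ω) = ω := by
      have hord := pow_orderOf_eq_one (conj F K)
      rw [FiniteField.orderOf_frobeniusAlgEquivOfAlgebraic, h2, pow_two] at hord
      exact DFunLike.congr_fun hord ω
    obtain ⟨t, ht⟩ := (conj_apply_eq_iff h2 (ω + conj F K ω)).1 (by
      rw [map_add, hinv, add_comm])
    have ht0 : t ≠ 0 := by
      rintro rfl
      rw [map_zero] at ht
      exact hσ (CharTwo.add_eq_zero.1 ht).symm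
    have hnorm : ∀ s : F, Algebra.norm F (algebraMap F K s - ω) =
        s * (s + t) + Algebra.norm F ω := by
      intro s
      apply (algebraMap F K).injective
      rw [algebraMap_norm_eq h2, map_add, map_mul, map_add, algebraMap_norm_eq h2, ← ht, map_sub,
        AlgEquiv.commutes, CharTwo.sub_eq_add, CharTwo.sub_eq_add]
      ring
    -- In characteristic `2` the values at `0` and at the trace `t` coincide, so on a finite field
    -- some value is missed.
    have hns : ¬ Function.Surjective fun s : F => s * (s + t) := by
      rw [← Finite.injective_iff_surjective]
      intro hinj
      refine ht0 (hinj (?_ : t * (t + t) = 0 * (0 + t)))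
      rw [CharTwo.add_self_eq_zero]
      ring
    obtain ⟨e, he⟩ := not_forall.1 hns
    push Not at he
    -- The missed norm `e + N(ω)` may be zero. As `s ↦ s (s + t)` is additive, shifting `e` by `r (r
    -- + t) ≠ 0` gives a second missed value; such an `r` exists because `q > 2`.
    obtain ⟨r, hr0, hrt⟩ : ∃ r : F, r ≠ 0 ∧ r ≠ t := by
      classical
      by_contra! h
      have hle : Fintype.card F ≤ ({0, t} : Finset F).card := by
        refine Finset.card_le_card fun x _ => ?_
        by_cases hx : x = 0
        · simp [hx]
        · simp [h x hx]
      have := Finset.card_le_two (a := (0 : F)) (b := t)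
      omega
    have her : ∀ s, s * (s + t) ≠ e + r * (r + t) := by
      intro s hs
      refine he (s + r) ?_
      have h4 : (s + r) * (s + r + t) = s * (s + t) + r * (r + t) + (s * r + s * r) := by ring
      rw [h4, hs, CharTwo.add_self_eq_zero, add_zero, add_assoc, CharTwo.add_self_eq_zero, add_zero]
    have hrr : r * (r + t) ≠ 0 := by
      refine mul_ne_zero hr0 fun h => hrt ?_
      exact CharTwo.add_eq_zero.1 h
    by_cases h0 : e + Algebra.norm F ω = 0
    · refine ⟨ω, e + r * (r + t) + Algebra.norm F ω, ?_, fun s h => her s ?_⟩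
      · rw [add_right_comm, h0, zero_add]
        exact hrr
      · rw [hnorm] at h
        exact add_right_cancel h
    · refine ⟨ω, e + Algebra.norm F ω, h0, fun s h => he s ?_⟩
      rw [hnorm] at h
      exact add_right_cancel h
  -- In odd characteristic `m = 0` works: the norm of `s ∈ F` is `s ^ 2`.
  · obtain ⟨e, he⟩ := FiniteField.exists_nonsquare hchar
    refine ⟨0, e, ?_, fun s h => he ⟨s, ?_⟩⟩
    · rintro rfl
      exact he ⟨0, by simp⟩
    · rw [sub_zero, Algebra.norm_algebraMap, h2] at h
      rw [← h, pow_two]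

end

/-! ### A parallelism of `K × K` for a quadratic extension `K` of `F` -/

section
variable {F K : Type*} [Field F] [Field K] [Algebra F K] [Fintype F] [Finite K]

theorem finrank_span_pair {V : Type*} [AddCommGroup V] [Module F V] {x y : V}
    (h : LinearIndependent F ![x, y]) : finrank F (Submodule.span F {x, y}) = 2 := by
  have := finrank_span_eq_card h
  rwa [Matrix.range_cons, Matrix.range_cons, Matrix.range_empty, Set.union_empty,
    Set.singleton_union, Fintype.card_fin] at this

/-- The map `(x, y) ↦ (a x, b x + y)`. -/
def shear (F : Type*) {K : Type*} [Field F] [Field K] [Algebra F K] (a : Kˣ) (b : K) :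
    (K × K) ≃ₗ[F] (K × K) where
  toFun w := (a * w.1, b * w.1 + w.2)
  invFun w := (↑a⁻¹ * w.1, w.2 - b * (↑a⁻¹ * w.1))
  map_add' w w' := by
    refine Prod.ext ?_ ?_
    · exact mul_add _ _ _
    · simp only [Prod.fst_add, Prod.snd_add]
      ring
  map_smul' s w := by
    refine Prod.ext ?_ ?_
    · simp
    · simp
  left_inv w := by simp
  right_inv w := by simp

theorem shear_apply (a : Kˣ) (b : K) (w : K × K) :
    shear F a b w = ((a : K) * w.1, b * w.1 + w.2) := rfl

theorem mem_map_shear {a : Kˣ} {b : K} {W : Submodule F (K × K)} {x y : K} :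
    (x, y) ∈ W.map (shear F a b : (K × K) →ₗ[F] (K × K)) ↔
      (↑a⁻¹ * x, y - b * (↑a⁻¹ * x)) ∈ W :=
  Submodule.mem_map_equiv _

/-- The shears form a group, and the inner one is the quotient of the two given. Comparing two
images reduces to a single shear. -/
theorem map_shear_comp (a a' : Kˣ) (b b' : K) (W : Submodule F (K × K)) :
    W.map (shear F a b : (K × K) →ₗ[F] (K × K)) =
      (W.map (shear F (a'⁻¹ * a) (b - b' * ↑(a'⁻¹ * a)) : (K × K) →ₗ[F] (K × K))).map
        (shear F a' b' : (K × K) →ₗ[F] (K × K)) := by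
  rw [← Submodule.map_comp]
  congr 1
  refine LinearMap.ext fun w => ?_
  show shear F a b w = shear F a' b' (shear F (a'⁻¹ * a) (b - b' * ↑(a'⁻¹ * a)) w)
  simp only [shear_apply, Units.val_mul]
  refine Prod.ext ?_ ?_
  · simp [mul_assoc]
  · simp only
    ring

/-- The `2`-subspaces of `K × K` over `F` that are subspaces over `K`. -/
def fieldSpread (F K : Type*) [Field F] [Field K] [Algebra F K] : Set (Submodule F (K × K)) :=
  {W | finrank F W = 2 ∧ ∀ k : K, ∀ w ∈ W, k • w ∈ W}

theorem fieldSpread_isLineSpread (h2 : finrank F K = 2) : IsLineSpread (fieldSpread F K) := by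
  refine ⟨fun W hW => hW.1, fun w hw => ?_⟩
  have hd : finrank F ((K ∙ w).restrictScalars F) = 2 := by
    have h := finrank_mul_finrank F K (K ∙ w)
    rw [h2, finrank_span_singleton hw, mul_one] at h
    exact h.symm
  refine ⟨(K ∙ w).restrictScalars F, ⟨⟨hd, fun k v hv => (K ∙ w).smul_mem k hv⟩,
    Submodule.mem_span_singleton_self w⟩, ?_⟩
  rintro W ⟨⟨hW, hK⟩, hwW⟩
  refine (Submodule.eq_of_le_of_finrank_le ?_ (by rw [hW, hd])).symm
  intro v hv
  obtain ⟨k, rfl⟩ := Submodule.mem_span_singleton.1 (show v ∈ K ∙ w from hv)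
  exact hK k w hwW

/-- The parameters of the base spread: a linear map `m x + n x̄`, and a function `ρ` on the points
of the line `x = 0`. -/
structure BaseSpread (F K : Type*) [Field F] [Field K] [Algebra F K] [Fintype F] [Finite K] extends
    QuadraticCoordinate F K where
  m : K
  n : K
  n_ne : n ≠ 0
  ρ : K → F
  ρ_smul : ∀ s : F, s ≠ 0 → ∀ x, ρ (s • x) = ρ x
  mul_ρ : ∀ s : F, s ≠ 0 → ∀ x, x ≠ 0 → s * ρ x = ρ x
  mul_ratio_ne : ∀ x, x ≠ 0 → ∀ s : F, s ≠ 0 → s * τ ((m * x + n * conj F K x) / x) ≠ ρ x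
  existsUnique_ratio : ∀ x, x ≠ 0 → ∀ t, t ≠ ρ x →
    ∃! s : F, s ≠ 0 ∧ s * τ ((m * x + n * conj F K x) / x) = t

/-! ### The base spread and its orbit under the shears -/

namespace BaseSpread
variable (D : BaseSpread F K)

noncomputable def f : K →ₗ[F] K :=
  LinearMap.mulLeft F D.m + (LinearMap.mulLeft F D.n).comp (conj F K).toLinearMap

theorem f_apply (x : K) : D.f x = D.m * x + D.n * conj F K x := rfl

theorem ω_ne (s : F) : s • (1 : K) ≠ D.ω := by
  intro h
  have h1 := D.τ_ω
  rw [← h, ← Algebra.algebraMap_eq_smul_one, D.τ_algebraMap] at h1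
  exact zero_ne_one h1

theorem conj_ω_ne (h2 : finrank F K = 2) : conj F K D.ω ≠ D.ω := fun h => by
  obtain ⟨s, hs⟩ := (conj_apply_eq_iff h2 D.ω).1 h
  exact D.ω_ne s (by rw [hs, Algebra.algebraMap_eq_smul_one])

theorem exists_coords (z : K) : ∃ s t : F, z = s • (1 : K) + t • D.ω := by
  obtain ⟨s, hs⟩ := D.exists_eq z
  exact ⟨s, D.τ z, by rwa [← Algebra.algebraMap_eq_smul_one]⟩

/-- The members that meet the line `x = 0`. -/
def line (p : K) : Submodule F (K × K) := Submodule.span F {(0, p), (p, D.ρ p • (D.ω * p))}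

/-- The members disjoint from the line `x = 0`. -/
noncomputable def graph (c d : F) : Submodule F (K × K) := (c • (D.f + d • LinearMap.id)).graph

theorem mem_line {p x y : K} :
    (x, y) ∈ D.line p ↔ ∃ s t : F, x = s • p ∧ y = t • p + s • D.ρ p • (D.ω * p) := by
  rw [line, Submodule.mem_span_pair]
  constructor
  · rintro ⟨t, s, h⟩
    simp only [Prod.smul_mk, smul_zero, Prod.mk_add_mk, zero_add, Prod.mk.injEq] at h
    exact ⟨s, t, h.1.symm, h.2.symm⟩
  · rintro ⟨s, t, rfl, rfl⟩
    exact ⟨t, s, by simp⟩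

theorem mem_graph {c d : F} {x y : K} : (x, y) ∈ D.graph c d ↔ y = c • (D.f x + d • x) :=
  LinearMap.mem_graph_iff _ (x, y)

theorem finrank_line {p : K} (hp : p ≠ 0) : finrank F (D.line p) = 2 := by
  refine finrank_span_pair ?_
  rw [LinearIndependent.pair_iff]
  intro s t h
  simp only [Prod.smul_mk, smul_zero, Prod.mk_add_mk, zero_add, Prod.mk_eq_zero,
    smul_eq_zero, hp, or_false] at h
  obtain ⟨rfl, h⟩ := h
  simpa [hp] using h

theorem finrank_graph (h2 : finrank F K = 2) (c d : F) : finrank F (D.graph c d) = 2 := by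
  rw [graph, LinearMap.graph_eq_range_prod, LinearMap.finrank_range_of_inj, h2]
  intro x y h
  exact congrArg Prod.fst h

theorem zero_mem_line {p : K} (y : K) : (0, y) ∈ D.line p → ∃ t : F, y = t • p := by
  rw [mem_line]
  rintro ⟨s, t, hs, rfl⟩
  rcases smul_eq_zero.1 hs.symm with rfl | rfl
  · exact ⟨t, by simp⟩
  · exact ⟨t, by simp⟩

theorem self_mem_line (p : K) : (0, p) ∈ D.line p := Submodule.subset_span (by simp)

theorem line_smul {s : F} (hs : s ≠ 0) {p : K} (hp : p ≠ 0) : D.line (s • p) = D.line p := by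
  refine Submodule.eq_of_le_of_finrank_le ?_
    (by rw [D.finrank_line hp, D.finrank_line (smul_ne_zero hs hp)])
  rw [line, Submodule.span_le]
  rintro _ (rfl | rfl)
  · exact D.mem_line.2 ⟨0, s, by simp, by simp⟩
  · refine D.mem_line.2 ⟨s, 0, rfl, ?_⟩
    rw [D.ρ_smul s hs, zero_smul, zero_add, mul_smul_comm, smul_comm]

theorem line_eq_of_zero_mem {p y : K} (hp : p ≠ 0) (hy : y ≠ 0) (h : (0, y) ∈ D.line p) :
    D.line p = D.line y := by
  obtain ⟨t, rfl⟩ := D.zero_mem_line y h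
  rw [D.line_smul (fun h0 => hy (by rw [h0, zero_smul])) hp]

theorem mem_line_self_iff {x y : K} (hx : x ≠ 0) :
    (x, y) ∈ D.line x ↔ D.τ (y / x) = D.ρ x := by
  rw [mem_line]
  constructor
  · rintro ⟨s, t, hs, rfl⟩
    have hs1 : s = 1 := by
      have h1 : (s - 1) • x = 0 := by rw [sub_smul, one_smul, ← hs, sub_self]
      exact sub_eq_zero.1 ((smul_eq_zero.1 h1).resolve_right hx)
    have h2 : (t • x + s • D.ρ x • (D.ω * x)) / x = algebraMap F K t + D.ρ x • D.ω := by
      rw [hs1, one_smul, Algebra.smul_def, Algebra.smul_def, Algebra.smul_def]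
      field_simp
    rw [h2, map_add, D.τ_algebraMap, map_smul, D.τ_ω, zero_add, smul_eq_mul, mul_one]
  · intro h
    obtain ⟨s, hs⟩ := D.exists_eq (y / x)
    rw [h, div_eq_iff hx] at hs
    refine ⟨1, s, by simp, ?_⟩
    rw [hs, one_smul, Algebra.smul_def, Algebra.smul_def, Algebra.smul_def]
    ring

theorem line_eq_of_mem {p x y : K} (hp : p ≠ 0) (hx : x ≠ 0) (h : (x, y) ∈ D.line p) :
    D.line p = D.line x := by
  obtain ⟨s, t, rfl, -⟩ := D.mem_line.1 h
  rw [D.line_smul (fun h0 => hx (by rw [h0, zero_smul])) hp]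

theorem mem_graph_iff_div {c d : F} {x y : K} (hx : x ≠ 0) :
    (x, y) ∈ D.graph c d ↔ y / x = c • (D.f x / x) + algebraMap F K (c * d) := by
  rw [mem_graph, div_eq_iff hx, map_mul, Algebra.smul_def, Algebra.smul_def, Algebra.smul_def]
  field_simp

/-- The base spread. -/
def members : Set (Submodule F (K × K)) :=
  {W | (∃ p, p ≠ 0 ∧ W = D.line p) ∨ ∃ c d : F, c ≠ 0 ∧ W = D.graph c d}

/-- A vector `(x, y)` with `x ≠ 0` is located by `τ (y / x)`: the value `ρ x` means it is on the
line through `(0, x)`, while on `graph c d` the value is `c * τ (f x / x)`. As `c` runs through the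
nonzero scalars, the latter takes each value other than `ρ x` once, and then the `F`-part of `y / x`
determines `d`. -/
theorem members_isLineSpread (h2 : finrank F K = 2) : IsLineSpread D.members := by
  refine ⟨?_, ?_⟩
  · rintro W (⟨p, hp, rfl⟩ | ⟨c, d, -, rfl⟩)
    · exact D.finrank_line hp
    · exact D.finrank_graph h2 c d
  rintro ⟨x, y⟩ hxy
  by_cases hx : x = 0
  · subst hx
    have hy : y ≠ 0 := by
      rintro rfl
      exact hxy rfl
    refine ⟨D.line y, ⟨Or.inl ⟨y, hy, rfl⟩, D.self_mem_line y⟩, ?_⟩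
    rintro W ⟨⟨p, hp, rfl⟩ | ⟨c, d, -, rfl⟩, h⟩
    · exact D.line_eq_of_zero_mem hp hy h
    · rw [D.mem_graph] at h
      simp only [map_zero, smul_zero, add_zero] at h
      exact absurd h hy
  have hgraph : ∀ c d : F, (x, y) ∈ D.graph c d → D.τ (y / x) = c * D.τ (D.f x / x) := by
    intro c d h
    rw [(D.mem_graph_iff_div hx).1 h, map_add, map_smul, D.τ_algebraMap, add_zero, smul_eq_mul]
  by_cases ht : D.τ (y / x) = D.ρ x
  · refine ⟨D.line x, ⟨Or.inl ⟨x, hx, rfl⟩, (D.mem_line_self_iff hx).2 ht⟩, ?_⟩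
    rintro W ⟨⟨p, hp, rfl⟩ | ⟨c, d, hc, rfl⟩, h⟩
    · exact D.line_eq_of_mem hp hx h
    · exact absurd ((hgraph c d h).symm.trans ht) (D.mul_ratio_ne x hx c hc)
  · obtain ⟨c, ⟨hc, hct⟩, hu⟩ := D.existsUnique_ratio x hx _ ht
    have hct' : D.τ (y / x) = D.τ (c • (D.f x / x)) := by
      rw [map_smul, smul_eq_mul]
      exact hct.symm
    obtain ⟨s, hs⟩ := (D.τ_eq_τ_iff _ _).1 hct'
    refine ⟨D.graph c (s / c), ⟨Or.inr ⟨c, _, hc, rfl⟩, ?_⟩, ?_⟩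
    · rw [D.mem_graph_iff_div hx, mul_div_cancel₀ _ hc, hs]
    · rintro W ⟨⟨p, hp, rfl⟩ | ⟨c', d, hc', rfl⟩, h⟩
      · have h' := D.line_eq_of_mem hp hx h
        rw [h', D.mem_line_self_iff hx] at h
        exact absurd h ht
      · obtain rfl := hu c' ⟨hc', (hgraph c' d h).symm⟩
        have h1 := (D.mem_graph_iff_div hx).1 h
        rw [hs] at h1
        have h3 := (algebraMap F K).injective (add_left_cancel h1)
        rw [h3, mul_div_cancel_left₀ _ hc]

/-- Independence of the identity and the conjugation over `K`, tested at `1` and at `ω`. -/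
theorem coeffs_eq_zero (D : BaseSpread F K) (h2 : finrank F K = 2) {a b : K} (h : ∀ x, a * x = b * conj F K x) :
    a = 0 ∧ b = 0 := by
  have h1 := h 1
  rw [map_one, mul_one, mul_one] at h1
  subst h1
  have h3 : a * (D.ω - conj F K D.ω) = 0 := by rw [mul_sub, ← h D.ω, sub_self]
  have h4 : a = 0 := (mul_eq_zero.1 h3).resolve_right (sub_ne_zero.2 (D.conj_ω_ne h2).symm)
  exact ⟨h4, h4⟩

/-- A shear fixes the line `x = 0` pointwise, so it cannot exchange the two kinds of members.
Between members `line`, it must keep the same `p`, and the image of the second generator yields `a`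
and `b` in `F`. Between graphs, the coefficient of `x̄` puts `a` in `F`, and then that of `x` puts
`b` there. -/
theorem mem_base_of_shear_mem (h2 : finrank F K = 2) {a : Kˣ} {b : K} {L L' : Submodule F (K × K)}
    (hL : L ∈ D.members) (hL' : L' ∈ D.members)
    (h : L.map (shear F a b : (K × K) →ₗ[F] (K × K)) = L') :
    ∃ s t : F, (a : K) = algebraMap F K s ∧ b = algebraMap F K t := by
  have hmap : ∀ w ∈ L, shear F a b w ∈ L' := fun w hw => h ▸ Submodule.mem_map_of_mem hw
  rcases hL with ⟨p, hp, rfl⟩ | ⟨c, d, hc, rfl⟩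
  · have h0 := hmap _ (D.self_mem_line p)
    rw [shear_apply, mul_zero, mul_zero, zero_add] at h0
    rcases hL' with ⟨p', hp', rfl⟩ | ⟨c, d, hc, rfl⟩
    · rw [D.line_eq_of_zero_mem hp' hp h0] at hmap
      have h1 := hmap (p, D.ρ p • (D.ω * p)) (Submodule.subset_span (by simp))
      rw [shear_apply, D.mem_line] at h1
      obtain ⟨s, t, hs, ht⟩ := h1
      replace hs : (a : K) * p = s • p := hs
      replace ht : b * p + D.ρ p • (D.ω * p) = t • p + s • D.ρ p • (D.ω * p) := ht
      rw [Algebra.smul_def] at hs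
      have has : (a : K) = algebraMap F K s := mul_right_cancel₀ hp hs
      have hs0 : s ≠ 0 := by
        rintro rfl
        rw [map_zero] at has
        exact a.ne_zero has
      refine ⟨s, t, has, ?_⟩
      rw [smul_smul, D.mul_ρ s hs0 p hp] at ht
      have := add_right_cancel ht
      rw [Algebra.smul_def] at this
      exact mul_right_cancel₀ hp this
    · rw [D.mem_graph] at h0
      simp only [map_zero, smul_zero, add_zero] at h0
      exact absurd h0 hp
  · rcases hL' with ⟨p, hp, hLp⟩ | ⟨c', d', hc', rfl⟩
    · have h0 := D.self_mem_line p
      rw [← hLp, ← h, mem_map_shear, D.mem_graph] at h0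
      simp only [mul_zero, sub_zero, map_zero, smul_zero, add_zero] at h0
      exact absurd h0 hp
    · have hx : ∀ x : K, b * x + c • (D.f x + d • x) = c' • (D.f (a * x) + d' • (a * x)) := by
        intro x
        have h1 := hmap (x, c • (D.f x + d • x)) (D.mem_graph.2 rfl)
        rwa [shear_apply, D.mem_graph] at h1
      simp only [f_apply, Algebra.smul_def, map_mul] at hx
      have hc0 : algebraMap F K c' ≠ 0 := by simpa using hc'
      have hcoef := D.coeffs_eq_zero h2
        (a := b + algebraMap F K c * D.m + algebraMap F K c * algebraMap F K d -
          algebraMap F K c' * D.m * a - algebraMap F K c' * algebraMap F K d' * a)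
        (b := algebraMap F K c' * D.n * conj F K a - algebraMap F K c * D.n)
        (fun x => by linear_combination hx x)
      have hconj : conj F K a = algebraMap F K (c / c') := by
        have h3 : D.n * (algebraMap F K c' * conj F K a - algebraMap F K c) = 0 := by
          linear_combination hcoef.2
        rw [map_div₀, eq_div_iff hc0]
        linear_combination (mul_eq_zero.1 h3).resolve_left D.n_ne
      have ha : (a : K) = algebraMap F K (c / c') := by
        apply (conj F K).injective
        rw [hconj, AlgEquiv.commutes]
      refine ⟨c / c', c * (d' - d), ha, ?_⟩
      have h4 := hcoef.1
      rw [ha, map_div₀] at h4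
      rw [map_mul, map_sub]
      field_simp at h4
      linear_combination h4

theorem map_shear_members_subset (h2 : finrank F K = 2) {a : Kˣ} {b : K} {s t : F}
    (ha : (a : K) = algebraMap F K s) (hb : b = algebraMap F K t) :
    Submodule.map (shear F a b : (K × K) →ₗ[F] (K × K)) '' D.members ⊆ D.members := by
  have hs : s ≠ 0 := by
    rintro rfl
    rw [map_zero] at ha
    exact a.ne_zero ha
  rintro _ ⟨L, ⟨p, hp, rfl⟩ | ⟨c, d, hc, rfl⟩, rfl⟩
  · refine Or.inl ⟨p, hp, Submodule.eq_of_le_of_finrank_le ?_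
      (by rw [finrank_map_equiv])⟩
    rw [line, Submodule.map_span, Submodule.span_le]
    rintro _ ⟨_, rfl | rfl, rfl⟩
    · exact D.mem_line.2 ⟨0, 1, by simp, by simp⟩
    · refine D.mem_line.2 ⟨s, t, ?_, ?_⟩
      · rw [ha, Algebra.smul_def s]
      · rw [hb, smul_smul, D.mul_ρ s hs p hp, Algebra.smul_def t]
  -- Substituting `x = x' / s` in `t x + c (f x + d x)` gives `(c / s) (f x' + (d + t / c) x')`.
  · refine Or.inr ⟨c / s, d + t / c, div_ne_zero hc hs, Submodule.eq_of_le_of_finrank_le ?_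
      (by rw [finrank_map_equiv, D.finrank_graph h2, D.finrank_graph h2])⟩
    rintro _ ⟨⟨x, y⟩, hxy, rfl⟩
    obtain rfl := D.mem_graph.1 hxy
    refine D.mem_graph.2 ?_
    have hc' : algebraMap F K c ≠ 0 := by simpa using hc
    have hs' : algebraMap F K s ≠ 0 := by simpa using hs
    simp only [ha, hb, f_apply, Algebra.smul_def, map_mul, map_add, map_div₀, AlgEquiv.commutes]
    field_simp
    ring

/-- A sheared line meets `x = 0` only in `F p`, which is not closed under `ω`. Closure of a sheared
graph under `ω` would force `ω` to equal its conjugate, as `n ≠ 0`. -/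
theorem map_shear_notMem_fieldSpread (h2 : finrank F K = 2) (a : Kˣ) (b : K)
    {L : Submodule F (K × K)} (hL : L ∈ D.members) :
    L.map (shear F a b : (K × K) →ₗ[F] (K × K)) ∉ fieldSpread F K := by
  rintro ⟨-, hK⟩
  rcases hL with ⟨p, hp, rfl⟩ | ⟨c, d, hc, rfl⟩
  · have h0 : (0, p) ∈ (D.line p).map (shear F a b : (K × K) →ₗ[F] (K × K)) := by
      rw [mem_map_shear]
      simpa using D.self_mem_line p
    have h1 := hK D.ω _ h0
    rw [Prod.smul_mk, smul_zero, smul_eq_mul, mem_map_shear, mul_zero, mul_zero, sub_zero] at h1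
    obtain ⟨t, ht⟩ := D.zero_mem_line _ h1
    refine D.ω_ne t ?_
    rw [Algebra.smul_def] at ht
    rw [← Algebra.algebraMap_eq_smul_one]
    exact (mul_right_cancel₀ hp ht).symm
  · have h0 := Submodule.mem_map_of_mem (f := (shear F a b : (K × K) →ₗ[F] (K × K)))
      (D.mem_graph (c := c) (d := d) (x := 1) |>.2 rfl)
    have h1 := hK D.ω _ h0
    rw [LinearEquiv.coe_coe, shear_apply, Prod.smul_mk, mem_map_shear, D.mem_graph] at h1
    simp only [smul_eq_mul, mul_one, f_apply, map_one, Algebra.smul_def] at h1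
    have ha : (↑a⁻¹ : K) * (D.ω * a) = D.ω := by
      rw [mul_comm D.ω, Units.inv_mul_cancel_left]
    rw [ha] at h1
    have hc0 : algebraMap F K c ≠ 0 := by simpa using hc
    have h3 : algebraMap F K c * (D.n * (D.ω - conj F K D.ω)) = 0 := by linear_combination h1
    exact mul_ne_zero hc0 (mul_ne_zero D.n_ne (sub_ne_zero.2 (D.conj_ω_ne h2).symm)) h3

theorem exists_shear_eq (h2 : finrank F K = 2) {W : Submodule F (K × K)} (hW : finrank F W = 2)
    (hWK : W ∉ fieldSpread F K) : ∃ (a : Kˣ) (b : K), ∃ L ∈ D.members,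
      L.map (shear F a b : (K × K) →ₗ[F] (K × K)) = W := by
  by_cases hv : ∃ p, p ≠ 0 ∧ (0, p) ∈ W
  · obtain ⟨p, hp, hpW⟩ := hv
    obtain ⟨⟨u, v⟩, huv, hu⟩ : ∃ w ∈ W, w.1 ≠ 0 := by
      by_contra! h
      have hWv : W = (⊥ : Submodule F K).prod ⊤ :=
        Submodule.eq_of_le_of_finrank_le (fun w hw => ⟨h w hw, Submodule.mem_top⟩)
          (by rw [finrank_prod_bot_top h2, hW])
      refine hWK ⟨hW, fun k w hw => ?_⟩
      rw [hWv] at hw ⊢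
      exact ⟨by rw [Prod.smul_fst, show w.1 = 0 from hw.1, smul_zero]; exact Submodule.zero_mem _,
        Submodule.mem_top⟩
    refine ⟨Units.mk0 (u / p) (div_ne_zero hu hp), (v - D.ρ p • (D.ω * p)) / p, D.line p,
      Or.inl ⟨p, hp, rfl⟩, Submodule.eq_of_le_of_finrank_le ?_
        (by rw [finrank_map_equiv, D.finrank_line hp, hW])⟩
    rw [line, Submodule.map_span, Submodule.span_le]
    rintro _ ⟨_, rfl | rfl, rfl⟩
    · rw [LinearEquiv.coe_coe, shear_apply, mul_zero, mul_zero, zero_add]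
      exact hpW
    · rw [LinearEquiv.coe_coe, shear_apply, Units.val_mk0, div_mul_cancel₀ _ hp,
        div_mul_cancel₀ _ hp, sub_add_cancel]
      exact huv
  -- Now `W` is the graph of an `F`-linear map, with values `y₁` at `1` and `y₂` at `ω`. It is not
  -- `K`-linear, which is to say `y₂ ≠ ω y₁`.
  · push Not at hv
    have hzero : ∀ y, (0, y) ∈ W → y = 0 := fun y hy => by
      by_contra h0
      exact hv y h0 hy
    have hsh : shadow W = ⊤ := by
      have h := finrank_shadow_add W
      have hv0 : vertical W = ⊥ := (Submodule.eq_bot_iff _).2 hzero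
      rw [hv0, finrank_bot, add_zero, hW] at h
      exact Submodule.eq_top_of_finrank_eq (by rw [h, h2])
    obtain ⟨⟨x₁, y₁⟩, hy₁, rfl : x₁ = 1⟩ : (1 : K) ∈ shadow W := by rw [hsh]; trivial
    obtain ⟨⟨x₂, y₂⟩, hy₂, rfl : x₂ = D.ω⟩ : D.ω ∈ shadow W := by rw [hsh]; trivial
    have hspan : ∀ w ∈ W, ∃ s t : F, w = s • ((1 : K), y₁) + t • (D.ω, y₂) := by
      rintro ⟨x, y⟩ hw
      obtain ⟨s, t, rfl⟩ := D.exists_coords x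
      refine ⟨s, t, ?_⟩
      have h0 := W.sub_mem hw (W.add_mem (W.smul_mem s hy₁) (W.smul_mem t hy₂))
      rw [Prod.smul_mk, Prod.smul_mk, Prod.mk_add_mk, Prod.mk_sub_mk, sub_self] at h0
      rw [Prod.smul_mk, Prod.smul_mk, Prod.mk_add_mk, sub_eq_zero.1 (hzero _ h0)]
    have hne : y₂ - D.ω * y₁ ≠ 0 := by
      intro h0
      rw [sub_eq_zero] at h0
      have hmul : ∀ w, w ∈ W ↔ w.2 = w.1 * y₁ := by
        intro w
        constructor
        · intro hw
          obtain ⟨s, t, rfl⟩ := hspan w hw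
          simp only [Prod.smul_mk, Prod.mk_add_mk, h0]
          simp only [Algebra.smul_def]
          ring
        · intro hw
          obtain ⟨s, t, hst⟩ := D.exists_coords w.1
          have hw' : w = s • ((1 : K), y₁) + t • (D.ω, y₂) := by
            refine Prod.ext hst ?_
            rw [hw, hst, h0]
            simp only [Prod.smul_mk, Prod.mk_add_mk]
            simp only [Algebra.smul_def]
            ring
          rw [hw']
          exact W.add_mem (W.smul_mem s hy₁) (W.smul_mem t hy₂)
      refine hWK ⟨hW, fun k w hw => ?_⟩
      rw [hmul] at hw ⊢
      rw [Prod.smul_snd, Prod.smul_fst, hw, smul_eq_mul, smul_eq_mul, mul_assoc]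
    have hω : conj F K D.ω - D.ω ≠ 0 := sub_ne_zero.2 (D.conj_ω_ne h2)
    have hq : D.n * (conj F K D.ω - D.ω) / (y₂ - D.ω * y₁) ≠ 0 :=
      div_ne_zero (mul_ne_zero D.n_ne hω) hne
    -- The sheared graph is `y = f (a⁻¹ x) + b a⁻¹ x`. The value at `1` gives `b = a (y₁ - f a⁻¹)`;
    -- with that, the value at `ω` determines the conjugate of `a`.
    obtain ⟨a, ha⟩ := (conj F K).surjective (D.n * (conj F K D.ω - D.ω) / (y₂ - D.ω * y₁))
    have ha0 : a ≠ 0 := by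
      rintro rfl
      rw [map_zero] at ha
      exact hq ha.symm
    have hca : conj F K a⁻¹ = (y₂ - D.ω * y₁) / (D.n * (conj F K D.ω - D.ω)) := by
      rw [map_inv₀, ha, inv_div]
    have hgraph : ∀ x y : K, D.f (a⁻¹ * x) = y - (a * (y₁ - D.f a⁻¹)) * (a⁻¹ * x) →
        (x, y) ∈ (D.graph 1 0).map
          (shear F (Units.mk0 a ha0) (a * (y₁ - D.f a⁻¹)) : (K × K) →ₗ[F] (K × K)) := by
      intro x y h
      rw [mem_map_shear, D.mem_graph, one_smul, zero_smul, add_zero]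
      exact h.symm
    refine ⟨Units.mk0 a ha0, a * (y₁ - D.f a⁻¹), D.graph 1 0, Or.inr ⟨1, 0, one_ne_zero, rfl⟩,
      (Submodule.eq_of_le_of_finrank_le ?_
        (by rw [finrank_map_equiv, D.finrank_graph h2, hW])).symm⟩
    intro w hw
    obtain ⟨s, t, rfl⟩ := hspan w hw
    refine Submodule.add_mem _ (Submodule.smul_mem _ s (hgraph _ _ ?_))
      (Submodule.smul_mem _ t (hgraph _ _ ?_))
    · rw [mul_one]
      field_simp
      ring
    · rw [f_apply, f_apply, map_mul, hca]
      have := D.n_ne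
      field_simp
      ring

/-- The images of the base spread, together with the spread of `K`-subspaces. -/
def parallelism : Set (Set (Submodule F (K × K))) :=
  insert (fieldSpread F K) (Set.range fun ab : Kˣ × K =>
    Submodule.map (shear F ab.1 ab.2 : (K × K) →ₗ[F] (K × K)) '' D.members)

theorem eq_of_subset_of_isLineSpread {V : Type*} [AddCommGroup V] [Module F V]
    {S S' : Set (Submodule F V)} (hS : IsLineSpread S) (hS' : IsLineSpread S') (h : S ⊆ S') :
    S = S' := by
  refine h.antisymm fun W hW => ?_
  have hb : W ≠ ⊥ := by
    intro h0
    have := hS'.1 W hW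
    rw [h0, finrank_bot] at this
    omega
  obtain ⟨x, hx, hx0⟩ := Submodule.exists_mem_ne_zero_of_ne_bot hb
  obtain ⟨W', ⟨hW', hxW'⟩, -⟩ := hS.2 x hx0
  rwa [hS'.eq_of_mem hW (h hW') hx0 hx hxW']

/-- If `W` lies in two images of the base spread, the two shears differ by one with parameters in
`F`. That shear stabilizes the base spread, so the images coincide. -/
theorem parallelism_isLineParallelism (h2 : finrank F K = 2) :
    IsLineParallelism D.parallelism := by
  have hfield := fieldSpread_isLineSpread (F := F) (K := K) h2
  have hmem := D.members_isLineSpread h2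
  refine ⟨?_, fun W hW => ?_⟩
  · rintro _ (rfl | ⟨⟨a, b⟩, rfl⟩)
    · exact hfield
    · exact hmem.map (shear F a b)
  by_cases hWK : W ∈ fieldSpread F K
  · refine ⟨_, ⟨Set.mem_insert _ _, hWK⟩, ?_⟩
    rintro _ ⟨rfl | ⟨⟨a, b⟩, rfl⟩, hWS⟩
    · rfl
    · obtain ⟨L, hL, rfl⟩ := hWS
      exact absurd hWK (D.map_shear_notMem_fieldSpread h2 a b hL)
  · obtain ⟨a, b, L, hL, rfl⟩ := D.exists_shear_eq h2 hW hWK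
    refine ⟨_, ⟨Set.mem_insert_of_mem _ ⟨(a, b), rfl⟩, L, hL, rfl⟩, ?_⟩
    rintro _ ⟨rfl | ⟨⟨a', b'⟩, rfl⟩, hWS⟩
    · exact absurd hWS hWK
    obtain ⟨L', hL', h⟩ := hWS
    simp only at h ⊢
    rw [map_shear_comp a' a b' b] at h
    obtain ⟨s, t, hs, ht⟩ :=
      D.mem_base_of_shear_mem h2 hL' hL (map_equiv_injective (shear F a b) h)
    have hsub := eq_of_subset_of_isLineSpread (hmem.map _) hmem
      (D.map_shear_members_subset h2 hs ht)
    conv_rhs => rw [← hsub]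
    rw [Set.image_image]
    exact Set.image_congr fun M _ => map_shear_comp a' a b' b M

theorem exists_of_card (h2 : finrank F K = 2) : Nonempty (BaseSpread F K) := by
  obtain ⟨ω, hω⟩ := exists_notMem_range h2
  obtain ⟨c, rfl⟩ := exists_quadraticCoordinate h2 hω
  by_cases hF : 2 < Fintype.card F
  · obtain ⟨m, n, hn, h⟩ := exists_ratio_avoiding h2 hF
    have hτ : ∀ x, x ≠ 0 → c.τ ((m * x + n * conj F K x) / x) ≠ 0 := fun x hx h0 => by
      obtain ⟨s, hs⟩ := (c.τ_eq_zero_iff _).1 h0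
      exact h x hx s hs
    exact ⟨{ c with
      m := m
      n := n
      n_ne := hn
      ρ := fun _ => 0
      ρ_smul := fun _ _ _ => rfl
      mul_ρ := fun _ _ _ _ => mul_zero _
      mul_ratio_ne := fun x hx s hs => mul_ne_zero hs (hτ x hx)
      existsUnique_ratio := fun x hx t ht =>
        ⟨t / c.τ ((m * x + n * conj F K x) / x),
          ⟨div_ne_zero ht (hτ x hx), div_mul_cancel₀ _ (hτ x hx)⟩,
          fun s hs => (eq_div_iff (hτ x hx)).2 hs.2⟩ }⟩
  · have hcard : Fintype.card F = 2 := le_antisymm (not_lt.1 hF) two_le_card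
    have hone : ∀ s : F, s ≠ 0 → s = 1 := by
      intro s hs
      have h := FiniteField.pow_card_sub_one_eq_one s hs
      rwa [hcard, pow_one] at h
    exact ⟨{ c with
      m := 0
      n := 1
      n_ne := one_ne_zero
      -- For `q = 2` the only nonzero scalar is `1`, so the graphs take a single value at `x`, and
      -- `ρ x` must be the other element of `F`.
      ρ := fun x => c.τ ((0 * x + 1 * conj F K x) / x) + 1
      ρ_smul := fun s hs x => by rw [hone s hs, one_smul]
      mul_ρ := fun s hs x _ => by rw [hone s hs, one_mul]
      mul_ratio_ne := fun x _ s hs => by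
        rw [hone s hs, one_mul]
        simp
      existsUnique_ratio := fun x _ t ht => by
        refine ⟨1, ⟨one_ne_zero, ?_⟩, fun s hs => hone s hs.1⟩
        rw [one_mul]
        by_contra hne
        refine ht ?_
        rw [← sub_eq_iff_eq_add']
        exact hone _ (sub_ne_zero.2 (Ne.symm hne)) }⟩

end BaseSpread
end

/-! ### Existence of the choices -/

section
variable (F : Type*) [Field F] [Fintype F]

theorem exists_quadratic_extension :
    ∃ (K : Type) (_ : Field K) (_ : Algebra F K) (_ : Finite K), finrank F K = 2 := by
  obtain ⟨p, hp⟩ := CharP.exists F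
  have : Fact p.Prime := ⟨CharP.char_is_prime F p⟩
  exact ⟨FiniteField.Extension F p 2, inferInstance, inferInstance, inferInstance,
    FiniteField.finrank_extension F p 2⟩

theorem exists_parallelism :
    ∃ P : Set (Set (Submodule F (Fin 4 → F))), IsLineParallelism P := by
  obtain ⟨K, _, _, _, h2⟩ := exists_quadratic_extension F
  obtain ⟨D⟩ := BaseSpread.exists_of_card (F := F) (K := K) h2
  have e : (K × K) ≃ₗ[F] (Fin 4 → F) :=
    LinearEquiv.ofFinrankEq _ _ (by rw [finrank_prod, h2, finrank_fin_fun])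
  exact ⟨_, (D.parallelism_isLineParallelism h2).map e⟩

/-- A parallelism of `F^4`, split into classes of the required sizes. -/
theorem exists_classes : ∃ (A : Set (Submodule F (Fin 4 → F)))
    (B : Set (Set (Submodule F (Fin 4 → F)))) (C : F → Set (Set (Submodule F (Fin 4 → F)))),
    IsParallelism ({A} ∪ B ∪ ⋃ ξ, C ξ) ∧ A ∉ B ∧ (∀ ξ, A ∉ C ξ) ∧ (∀ ξ, Disjoint B (C ξ)) ∧
      (∀ ξ η, ξ ≠ η → Disjoint (C ξ) (C η)) ∧ B.ncard = Fintype.card F ∧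
      ∀ ξ, (C ξ).ncard = Fintype.card F := by
  obtain ⟨P, hP⟩ := exists_parallelism F
  -- The `1 + q + q * q` spreads are labelled so that the summands become `A`, `B` and the classes
  -- `C ξ`.
  have hcard : Nat.card (Unit ⊕ F ⊕ F × F) = Nat.card P := by
    rw [Nat.card_coe_set_eq, hP.ncard_eq (by simp), Nat.card_sum, Nat.card_sum, Nat.card_prod,
      Nat.card_unique, Nat.card_eq_fintype_card]
    ring
  let e : Unit ⊕ F ⊕ F × F ≃ P := (Finite.card_eq.1 hcard).some
  let g : Unit ⊕ F ⊕ F × F → Set (Submodule F (Fin 4 → F)) := fun x => (e x).1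
  have hg : Function.Injective g := Subtype.val_injective.comp e.injective
  have hrange : Set.range g = P := by
    rw [show g = Subtype.val ∘ e from rfl, Set.range_comp, e.range_eq_univ, Set.image_univ, Subtype.range_coe]
  refine ⟨g (.inl ()), Set.range fun x => g (.inr (.inl x)),
    fun ξ => Set.range fun x => g (.inr (.inr (ξ, x))), ?_, ?_, ?_, ?_, ?_, ?_, ?_⟩
  · have h : {g (.inl ())} ∪ (Set.range fun x => g (.inr (.inl x))) ∪
        ⋃ ξ, (Set.range fun x => g (.inr (.inr (ξ, x)))) = P := by
      rw [← hrange]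
      ext S
      simp only [Set.mem_union, Set.mem_singleton_iff, Set.mem_range, Set.mem_iUnion]
      constructor
      · rintro ((rfl | ⟨x, rfl⟩) | ⟨ξ, x, rfl⟩)
        exacts [⟨_, rfl⟩, ⟨_, rfl⟩, ⟨_, rfl⟩]
      · rintro ⟨_ | x | ⟨ξ, x⟩, rfl⟩
        exacts [Or.inl (Or.inl rfl), Or.inl (Or.inr ⟨x, rfl⟩), Or.inr ⟨ξ, x, rfl⟩]
    rw [h]
    exact hP
  · rintro ⟨x, hx⟩
    simpa using hg hx
  · rintro ξ ⟨x, hx⟩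
    simpa using hg hx
  · intro ξ
    rw [Set.disjoint_left]
    rintro _ ⟨x, rfl⟩ ⟨y, hy⟩
    simpa using hg hy
  · intro ξ η hne
    rw [Set.disjoint_left]
    rintro _ ⟨x, rfl⟩ ⟨y, hy⟩
    have := hg hy
    simp only [Sum.inr.injEq, Prod.mk.injEq] at this
    exact hne this.1.symm
  · rw [Set.ncard_range_of_injective, Nat.card_eq_fintype_card]
    intro x y h
    simpa using hg h
  · intro ξ
    rw [Set.ncard_range_of_injective, Nat.card_eq_fintype_card]
    intro x y h
    simpa using hg h

variable {F}

/-- A numbering of the `3`-subspaces that is one-to-one above each member of a spread. -/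
theorem exists_index {A : Set (Submodule F (Fin 4 → F))} (hA : IsLineSpread A) :
    ∃ index : Submodule F (Fin 4 → F) → Fin (Fintype.card F + 1),
      ∀ X ∈ A, Set.BijOn index {Y | finrank F Y = 3 ∧ X ≤ Y} Set.univ := by
  classical
  have hcard : ∀ X ∈ A, Nat.card {Y : Submodule F (Fin 4 → F) | finrank F Y = 3 ∧ X ≤ Y} =
      Nat.card (Fin (Fintype.card F + 1)) := by
    intro X hX
    rw [Nat.card_coe_set_eq, ncard_hyperplanes_above (by simp) (hA.1 X hX), Nat.card_fin]
  -- The bijections for different `X` can be chosen independently, as each `3`-subspace contains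
  -- only one member of `A`. The value `0` elsewhere plays no role.
  let e : ∀ X, X ∈ A → ({Y : Submodule F (Fin 4 → F) | finrank F Y = 3 ∧ X ≤ Y} ≃
      Fin (Fintype.card F + 1)) := fun X hX => (Finite.card_eq.1 (hcard X hX)).some
  let index : Submodule F (Fin 4 → F) → Fin (Fintype.card F + 1) := fun Y =>
    if h : ∃ X ∈ A, finrank F Y = 3 ∧ X ≤ Y then e h.choose h.choose_spec.1 ⟨Y, h.choose_spec.2⟩
    else 0
  have hindex : ∀ X (hX : X ∈ A) (Y : Submodule F (Fin 4 → F)) (hY : finrank F Y = 3 ∧ X ≤ Y),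
      index Y = e X hX ⟨Y, hY⟩ := by
    intro X hX Y hY
    have h : ∃ X ∈ A, finrank F Y = 3 ∧ X ≤ Y := ⟨X, hX, hY⟩
    have hXc : h.choose = X :=
      hA.eq_of_le h.choose_spec.1 hX hY.1 h.choose_spec.2.2 hY.2
    have key : ∀ X' (hX' : X' ∈ A) (hY' : finrank F Y = 3 ∧ X' ≤ Y), X' = X →
        e X' hX' ⟨Y, hY'⟩ = e X hX ⟨Y, hY⟩ := by
      rintro X' hX' hY' rfl
      rfl
    simp only [index, dif_pos h]
    exact key _ h.choose_spec.1 h.choose_spec.2 hXc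
  refine ⟨index, fun X hX => ⟨fun _ _ => Set.mem_univ _, ?_, ?_⟩⟩
  · intro Y hY Y' hY' h
    rw [hindex X hX Y hY, hindex X hX Y' hY'] at h
    exact congrArg Subtype.val ((e X hX).injective h)
  · intro j _
    refine ⟨((e X hX).symm j).1, ((e X hX).symm j).2, ?_⟩
    rw [hindex X hX _ ((e X hX).symm j).2]
    simp

/-- A colouring of the nonzero elements of a field with `q^2` elements by `q + 1` colours, each used
`q - 1` times. -/
theorem exists_colouring {K : Type*} [Field K] [Algebra F K] [Finite K] (h2 : finrank F K = 2) :
    ∃ col : K → Fin (Fintype.card F + 1),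
      ∀ j, {k : K | k ≠ 0 ∧ col k = j}.ncard = Fintype.card F - 1 := by
  classical
  have hcard : Nat.card {k : K | k ≠ 0} =
      Nat.card (Fin (Fintype.card F + 1) × Fin (Fintype.card F - 1)) := by
    have h := ncard_nonzero (⊤ : Submodule F K)
    rw [finrank_top, h2] at h
    rw [Nat.card_coe_set_eq, Nat.card_prod, Nat.card_fin, Nat.card_fin, ← Nat.sq_sub_sq, one_pow,
      ← h]
    congr 1
    ext k
    simp
  let e : {k : K | k ≠ 0} ≃ Fin (Fintype.card F + 1) × Fin (Fintype.card F - 1) :=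
    (Finite.card_eq.1 hcard).some
  refine ⟨fun k => if h : k ≠ 0 then (e ⟨k, h⟩).1 else 0, fun j => ?_⟩
  have himage : {k : K | k ≠ 0 ∧ (if h : k ≠ 0 then (e ⟨k, h⟩).1 else 0) = j} =
      Set.range fun i => ((e.symm (j, i)).1 : K) := by
    ext k
    constructor
    · rintro ⟨hk, h⟩
      rw [dif_pos hk] at h
      exact ⟨(e ⟨k, hk⟩).2, by simp [← h]⟩
    · rintro ⟨i, rfl⟩
      refine ⟨(e.symm (j, i)).2, ?_⟩
      have h : ((e.symm (j, i)).1 : K) ≠ 0 := (e.symm (j, i)).2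
      show (if h : ((e.symm (j, i)).1 : K) ≠ 0 then (e ⟨_, h⟩).1 else 0) = j
      rw [dif_pos h]
      simp
  rw [himage, Set.ncard_range_of_injective, Nat.card_fin]
  intro i i' h
  simpa using e.symm.injective (Subtype.ext h)

/-- The matrices of the extension space, in terms of their first two columns. -/
def lineMatrixMap (α : Fˣ) :
    ((Fin 2 → F) × (Fin 2 → F)) →ₗ[F] Matrix (Fin 2) (Fin (Fintype.card F + 1)) F where
  toFun p := lineMatrix α p.1 p.2
  map_add' p p' := by
    ext a i
    simp only [lineMatrix, Matrix.add_apply, Prod.fst_add, Prod.snd_add, Pi.add_apply]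
    split_ifs <;> ring
  map_smul' s p := by
    ext a i
    simp only [lineMatrix, Matrix.smul_apply, Prod.smul_fst, Prod.smul_snd, Pi.smul_apply,
      smul_eq_mul, RingHom.id_apply]
    split_ifs <;> ring

/-- A linear parametrization of the extension space by `K × K` for which `K × 0` is an extension
code. -/
theorem exists_code_parametrization (α : Fˣ) {K : Type*} [Field K] [Algebra F K] [Finite K]
    (h2 : finrank F K = 2) :
    ∃ ψ : (K × K) →ₗ[F] Matrix (Fin 2) (Fin (Fintype.card F + 1)) F, Function.Injective ψ ∧
      LinearMap.range ψ = extensionSpace F α ∧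
      ∀ i, Function.Bijective fun k : K => (ψ (k, 0)).col i := by
  obtain ⟨ω, hω⟩ := exists_notMem_range h2
  let φ : K ≃ₗ[F] (Fin 2 → F) := LinearEquiv.ofFinrankEq _ _ (by rw [h2, finrank_fin_fun])
  have hcol0 : ∀ k l : K, (lineMatrix α (φ k) (φ (ω * k + l))).col 0 = φ k :=
    fun k l => lineMatrix_col_zero _ _ _
  have hcol1 : ∀ k l : K, (lineMatrix α (φ k) (φ (ω * k + l))).col 1 = φ (ω * k + l) :=
    fun k l => lineMatrix_col_one _ _ _
  have hmem : ∀ k l : K, lineMatrix α (φ k) (φ (ω * k + l)) ∈ extensionSpace F α :=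
    fun k l => lineMatrix_mem α _ _
  -- The first two columns are `k` and `ω k + l`. For `l = 0` every column is a multiple `z k`, with
  -- `z` equal to `1`, `ω` or `α ^ (i - 2) + ω`, all nonzero because `ω` is outside `F`.
  let ψ : (K × K) →ₗ[F] Matrix (Fin 2) (Fin (Fintype.card F + 1)) F :=
    (lineMatrixMap α).comp (LinearMap.prod (φ.toLinearMap.comp (LinearMap.fst F K K))
      (φ.toLinearMap.comp (LinearMap.coprod (LinearMap.mulLeft F ω) LinearMap.id)))
  have hψ : ∀ k l, ψ (k, l) = lineMatrix α (φ k) (φ (ω * k + l)) := fun _ _ => rfl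
  refine ⟨ψ, ?_, ?_, ?_⟩
  · rintro ⟨k, l⟩ ⟨k', l'⟩ h
    rw [hψ, hψ] at h
    have h0 := congrArg (fun M => Matrix.col M 0) h
    have h1 := congrArg (fun M => Matrix.col M 1) h
    simp only [hcol0, hcol1, EmbeddingLike.apply_eq_iff_eq] at h0 h1
    subst h0
    rw [add_left_cancel h1]
  · apply le_antisymm
    · rintro _ ⟨⟨k, l⟩, rfl⟩
      exact hmem k l
    · intro Z hZ
      refine ⟨(φ.symm (Z.col 0), φ.symm (Z.col 1) - ω * φ.symm (Z.col 0)), ?_⟩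
      rw [hψ, HasLineColumns.eq_lineMatrix hZ, lineMatrix_col_zero, lineMatrix_col_one]
      simp
  · intro i
    have hex : ∃ z : K, z ≠ 0 ∧ ∀ k, (ψ (k, 0)).col i = φ (z * k) := by
      obtain hi | hi | hi : (i : ℕ) = 0 ∨ (i : ℕ) = 1 ∨ 2 ≤ (i : ℕ) := by omega
      · obtain rfl : i = 0 := Fin.ext hi
        exact ⟨1, one_ne_zero, fun k => by rw [hψ, hcol0, one_mul]⟩
      · obtain rfl : i = 1 := Fin.ext (by rw [hi, val_one_card])
        refine ⟨ω, fun h => hω 0 (by rw [h, map_zero]), fun k => by rw [hψ, hcol1, add_zero]⟩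
      · refine ⟨algebraMap F K ((α : F) ^ ((i : ℕ) - 2)) + ω, fun h => ?_, fun k => ?_⟩
        · exact hω (-(α : F) ^ ((i : ℕ) - 2)) (by rw [map_neg, neg_eq_iff_add_eq_zero, h])
        · rw [hψ, lineMatrix_col_of_le _ _ _ hi, ← map_smul, ← map_add, add_zero, add_mul,
            Algebra.smul_def]
    obtain ⟨z, hz, h⟩ := hex
    simp_rw [h]
    exact φ.bijective.comp (mulLeft_bijective₀ z hz)

/-- An extension code, and a partition of the remaining matrices of the extension space. -/
theorem exists_code (α : Fˣ) :
    ∃ (code : Submodule F (Matrix (Fin 2) (Fin (Fintype.card F + 1)) F))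
      (part : Fin (Fintype.card F + 1) → Set (Matrix (Fin 2) (Fin (Fintype.card F + 1)) F)),
      IsExtensionCode α code ∧
      ⋃ j, part j = (extensionSpace F α : Set _) \ (code : Set _) ∧
      (∀ i j, i ≠ j → Disjoint (part i) (part j)) ∧
      (∀ j, ∀ Z ∈ part j, ∀ c ∈ code, Z + c ∈ part j) ∧
      ∀ j, (part j).ncard = Fintype.card F ^ 2 * (Fintype.card F - 1) := by
  obtain ⟨K, _, _, _, h2⟩ := exists_quadratic_extension F
  obtain ⟨col, hcol⟩ := exists_colouring (F := F) (K := K) h2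
  obtain ⟨ψ, hψ, hrange, hbij⟩ := exists_code_parametrization α (K := K) h2
  have hmemcode : ∀ p, ψ p ∈ LinearMap.range (ψ.comp (LinearMap.inl F K K)) ↔ p.2 = 0 := by
    rintro ⟨k, l⟩
    constructor
    · rintro ⟨k', h⟩
      exact (congrArg Prod.snd (hψ h)).symm
    · rintro (rfl : l = 0)
      exact ⟨k, rfl⟩
  -- The code is the image of `K × 0`, so its cosets are indexed by the second coordinate, and
  -- colouring the nonzero ones partitions the rest.
  refine ⟨LinearMap.range (ψ.comp (LinearMap.inl F K K)),
    fun j => ψ '' {p | p.2 ≠ 0 ∧ col p.2 = j}, ⟨?_, ?_, ?_⟩, ?_, ?_, ?_, ?_⟩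
  · rw [← hrange]
    exact LinearMap.range_comp_le_range _ _
  · rw [LinearMap.finrank_range_of_inj, h2]
    exact hψ.comp LinearMap.inl_injective
  · refine fun i => ⟨fun _ _ => Set.mem_univ _, ?_, ?_⟩
    · rintro _ ⟨k, rfl⟩ _ ⟨k', rfl⟩ h
      exact congrArg (fun k => ψ (k, 0)) ((hbij i).injective h)
    · intro u _
      obtain ⟨k, hk⟩ := (hbij i).surjective u
      exact ⟨_, ⟨k, rfl⟩, hk⟩
  · ext Z
    rw [Set.mem_iUnion, Set.mem_sdiff, SetLike.mem_coe, SetLike.mem_coe, ← hrange]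
    constructor
    · rintro ⟨j, p, ⟨hp, -⟩, rfl⟩
      exact ⟨⟨p, rfl⟩, fun h => hp ((hmemcode p).1 h)⟩
    · rintro ⟨⟨p, rfl⟩, h⟩
      exact ⟨col p.2, p, ⟨fun h0 => h ((hmemcode p).2 h0), rfl⟩, rfl⟩
  · intro i j hij
    rw [Set.disjoint_left]
    rintro _ ⟨p, ⟨-, hp⟩, rfl⟩ ⟨p', ⟨-, hp'⟩, h⟩
    rw [hψ h] at hp'
    exact hij (hp.symm.trans hp')
  · rintro j _ ⟨p, ⟨hp, hpj⟩, rfl⟩ _ ⟨k, rfl⟩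
    exact ⟨p + (k, 0), by simpa using ⟨hp, hpj⟩, map_add _ _ _⟩
  · intro j
    rw [Set.ncard_image_of_injective _ hψ, ← hcol j]
    have hset : {p : K × K | p.2 ≠ 0 ∧ col p.2 = j} =
        Set.univ ×ˢ {k : K | k ≠ 0 ∧ col k = j} := by
      ext p
      simp
    rw [hset, Set.ncard_prod, ConstructionData.ncard_univ_of_finrank_two (K := F) h2]

theorem nonempty_choices (α : Fˣ) : Nonempty (Choices F α) := by
  obtain ⟨A, B, C, hP, hAB, hAC, hBC, hC, hB, hCn⟩ := exists_classes F
  obtain ⟨code, part, hcode, hunion, hdisj, hadd, hcard⟩ := exists_code α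
  obtain ⟨index, hindex⟩ := exists_index (hP.1 A (Or.inl (Or.inl rfl)))
  exact ⟨⟨A, B, C, hP, hAB, hAC, hBC, hC, hB, hCn, code, hcode, part, hunion, hdisj, hadd, hcard,
    index, hindex⟩⟩

end

end QFano

theorem theorem3 (F : Type*) [Field F] [Fintype F] [LinearOrder F] (α : Fˣ)
    (hα : ∀ x : Fˣ, x ∈ Subgroup.zpowers α) :
    Nonempty (QFano.Choices F α) ∧
    ∀ d : QFano.Choices F α,
      QFano.IsSpread (QFano.setS0 F ∪ QFano.setSA d) ∧
      QFano.IsDerivedQFano F (QFano.setS0 F ∪ QFano.setSA d) ∧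
      QFano.IsResidualQFano F (QFano.setS0 F ∪ QFano.setSA d)
        (QFano.setSB d ∪ QFano.setSC d ∪ QFano.setSD d) ∧
      (((QFano.setS0 F ∪ QFano.setSA d) ∪
          (QFano.setSB d ∪ QFano.setSC d ∪ QFano.setSD d)).ncard : ℚ) =
        QFano.qBinom (Fintype.card F) 7 2 / QFano.qBinom (Fintype.card F) 3 2 :=
  ⟨QFano.nonempty_choices α, fun d =>
    ⟨d.isSpread_derived hα, d.isDerivedQFano hα, d.isResidualQFano hα, d.ncard_blocks hα⟩⟩
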